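/- Let $R=R_0\oplus R_1$ be a supercommutative ring ($\mathbb Z/2$-graded, $ab=(-1)^{|a||b|}ba$ for homogeneous $a,b$, and $a^2=0$ for odd $a$), let $V=R^{p|q}$, and let $A$ be an even invertible operator on $V$, i.e. an even invertible supermatrix with blocks $A_{00},A_{11}$ over $R_0$ and $A_{01},A_{10}$ over $R_1$. Let $$\operatorname{Ber}M=\det(M_{00}-M_{01}M_{11}^{-1}M_{10})\,(\det M_{11})^{-1},\qquad R_A(z)=\operatorname{Ber}(1+zA)\in R_0[[z]].$$ Let $\Lambda^kV$ be the degree $k$ part of the quotient of the tensor algebra of $V$ by the relations $v\otimes u+(-1)^{|v||u|}u\otimes v=0$ for homogeneous $u,v$ and $v\otimes v=0$ for even $v$ (the latter follows from the former if $2$ is invertible), and let $\Sigma^kV=\operatorname{Ber}V\otimes\Lambda^{p-k}V^*$, where $A$ acts on the even rank one module $\operatorname{Ber}V$ by $\operatorname{Ber}A$ and on $V^*$ by the dual of $A^{-1}$. Let $\operatorname{Tr}$ denote the supertrace, with values in $R_0$, and put $\operatorname{Tr}\Lambda^kA=0$ for $k<0$ and $\operatorname{Tr}\Sigma^kA=0$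 for $k>p$. For $k\in\mathbb Z$ set $$c_k=\operatorname{Tr}\Lambda^kA,\qquad \gamma_k=\operatorname{Tr}\Lambda^kA-\operatorname{Tr}\Sigma^{q+k}A .$$ Then the following hold. 1. Whenever $R_A(z)=P(z)/Q(z)$ in $R_0[[z]]$ with $P,Q\in R_0[z]$, $\deg P\le p$, $\deg Q\le q$ and $Q(z)=1+b_1z+\dots+b_qz^q$, one has, with $b_0=1$, $$b_0\gamma_{k+q}+b_1\gamma_{k+q-1}+\dots+b_q\gamma_k=0\qquad\text{for all }k\in\mathbb Z.$$ 2. Such $P$ and $Q$ exist if $A$ is in general position, in the sense that the Hankel determinant $\det(c_{p-q+1+i+j})_{0\le i,j\le q-1}$ is invertible in $R_0$, and also if $A$ becomes block diagonal ($A_{01}=A_{10}=0$) after an even change of basis; the latter always holds for a superspace over a field (where $R_1=0$). 3. For every $A$ (in general position or not) and every $k\in\mathbb Z$, the Hankel determinant of order $q+1$ vanishes: $$\det\bigl(\gamma_{k+i+j}\bigr)_{0\le i,j\le q}=0 .$$ -/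

import Mathlib

/-! Superalgebra over a supercommutative ring `R = R₀ ⊕ R₁`, graded by `𝒜 : ZMod 2 → AddSubgroup R`:
even supermatrices, the Berezinian, exterior powers of `R^{p|q}`, supertraces. -/

/-- The sign `(-1)^i` of a parity `i`. -/
def paritySign (i : ZMod 2) : ℤ := if i = 0 then 1 else -1

/-- Parity of the standard basis vectors of `R^{p|q}`. -/
def idxParity {p q : ℕ} : Fin p ⊕ Fin q → ZMod 2 := Sum.elim (fun _ => 0) (fun _ => 1)

/-- Supercommutativity: `a b = (-1)^{|a||b|} b a` for homogeneous elements, and odd elements have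
square zero (automatic as soon as `2` is not a zero divisor). -/
class IsSupercommutative {R : Type*} [Ring R] (𝒜 : ZMod 2 → AddSubgroup R) : Prop where
  comm : ∀ (i j : ZMod 2) (a b : R), a ∈ 𝒜 i → b ∈ 𝒜 j → a * b = paritySign (i * j) • (b * a)
  odd_sq : ∀ a ∈ 𝒜 1, a * a = 0

section EvenPart

variable {R : Type*} [Ring R] (𝒜 : ZMod 2 → AddSubgroup R) [SetLike.GradedMonoid 𝒜]

/-- The even part of a supercommutative ring is a commutative ring. -/
instance evenPartCommRing [IsSupercommutative 𝒜] : CommRing (𝒜 0) :=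
  { SetLike.GradeZero.instRing 𝒜 with
    mul_comm := fun a b => Subtype.ext (by
      have h := IsSupercommutative.comm (𝒜 := 𝒜) 0 0 (a : R) (b : R) a.2 b.2
      simpa [paritySign] using h) }

/-- The ring of even `p|q × p|q` supermatrices: even entries in the diagonal blocks and odd entries
in the antidiagonal blocks. -/
def evenMat (p q : ℕ) : Subring (Matrix (Fin p ⊕ Fin q) (Fin p ⊕ Fin q) R) where
  carrier := {M | ∀ i j, M i j ∈ 𝒜 (idxParity i + idxParity j)}
  zero_mem' := fun i j => (𝒜 _).zero_mem
  one_mem' := fun i j => by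
    by_cases h : i = j
    · subst h
      have h2 : idxParity i + idxParity i = (0 : ZMod 2) := CharTwo.add_self_eq_zero _
      simpa [h2] using SetLike.GradedOne.one_mem (A := 𝒜)
    · simp [Matrix.one_apply_ne h]
  add_mem' := fun ha hb i j => (𝒜 _).add_mem (ha i j) (hb i j)
  neg_mem' := fun ha i j => (𝒜 _).neg_mem (ha i j)
  mul_mem' := fun {a b} ha hb i j => by
    rw [Matrix.mul_apply]
    refine (𝒜 _).sum_mem fun k _ => ?_
    have h := SetLike.GradedMul.mul_mem (ha i k) (hb k j)
    have e : idxParity i + idxParity k + (idxParity k + idxParity j)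
        = idxParity i + idxParity j := by
      rw [add_assoc, ← add_assoc (idxParity k), CharTwo.add_self_eq_zero, zero_add]
    rwa [e] at h

variable {𝒜} {p q : ℕ}

/-- The block `M₀₀`, with entries in the even part. -/
def block00 (M : evenMat 𝒜 p q) : Matrix (Fin p) (Fin p) (𝒜 0) :=
  fun i j => ⟨M.1 (Sum.inl i) (Sum.inl j), by simpa [idxParity] using M.2 (Sum.inl i) (Sum.inl j)⟩

/-- The block `M₁₁`, with entries in the even part. -/
def block11 (M : evenMat 𝒜 p q) : Matrix (Fin q) (Fin q) (𝒜 0) :=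
  fun i j => ⟨M.1 (Sum.inr i) (Sum.inr j), by
    have h := M.2 (Sum.inr i) (Sum.inr j)
    simpa [idxParity, CharTwo.add_self_eq_zero] using h⟩

/-- For a `q × q` matrix `N` with even entries, the product `M₀₁ N M₁₀`; its entries are even. -/
def oddBlockProd (M : evenMat 𝒜 p q) (N : Matrix (Fin q) (Fin q) (𝒜 0)) :
    Matrix (Fin p) (Fin p) (𝒜 0) :=
  fun i j => ⟨∑ k, ∑ l, M.1 (Sum.inl i) (Sum.inr k) * (N k l : R) * M.1 (Sum.inr l) (Sum.inl j), by
    refine (𝒜 0).sum_mem fun k _ => (𝒜 0).sum_mem fun l _ => ?_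
    have h1 : M.1 (Sum.inl i) (Sum.inr k) ∈ 𝒜 1 := by
      simpa [idxParity] using M.2 (Sum.inl i) (Sum.inr k)
    have h2 : M.1 (Sum.inr l) (Sum.inl j) ∈ 𝒜 1 := by
      simpa [idxParity] using M.2 (Sum.inr l) (Sum.inl j)
    have h := SetLike.GradedMul.mul_mem (SetLike.GradedMul.mul_mem h1 (N k l).2) h2
    have e : (1 : ZMod 2) + 0 + 1 = 0 := by decide
    rwa [e] at h⟩

/-- The Berezinian `det (M₀₀ - M₀₁ M₁₁⁻¹ M₁₀) / det M₁₁` of an even supermatrix whose block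
`M₁₁` is invertible. -/
noncomputable def Ber [IsSupercommutative 𝒜] (M : evenMat 𝒜 p q) : 𝒜 0 :=
  (block00 M - oddBlockProd M (block11 M)⁻¹).det * Ring.inverse (block11 M).det

/-- The supertranspose, `M₀₀ᵀ` and `M₁₁ᵀ` on the diagonal, `M₁₀ᵀ` top right and `-M₀₁ᵀ` bottom left:
the matrix, in the dual basis, of the operator on `V*` that is dual to `M`. -/
def supertranspose (M : evenMat 𝒜 p q) : evenMat 𝒜 p q :=
  ⟨fun i j => paritySign (idxParity i * (idxParity i + idxParity j)) • M.1 j i, fun i j => by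
    rw [add_comm (idxParity i) (idxParity j)]
    exact (𝒜 _).zsmul_mem (M.2 j i) _⟩

end EvenPart

section CharacteristicSeries

variable {R : Type*} [Ring R] (𝒜 : ZMod 2 → AddSubgroup R)

/-- The grading of `R⟦z⟧`, with `z` an even variable. -/
def seriesGrading (i : ZMod 2) : AddSubgroup (PowerSeries R) where
  carrier := {f | ∀ n, PowerSeries.coeff n f ∈ 𝒜 i}
  zero_mem' := fun n => by simp
  add_mem' := fun ha hb n => by
    rw [map_add]
    exact (𝒜 i).add_mem (ha n) (hb n)
  neg_mem' := fun ha n => by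
    rw [map_neg]
    exact (𝒜 i).neg_mem (ha n)

instance seriesGradedMonoid [SetLike.GradedMonoid 𝒜] :
    SetLike.GradedMonoid (seriesGrading 𝒜) where
  one_mem := fun n => by
    rw [PowerSeries.coeff_one]
    split_ifs
    · exact SetLike.GradedOne.one_mem
    · exact (𝒜 0).zero_mem
  mul_mem := fun i j a b ha hb n => by
    rw [PowerSeries.coeff_mul]
    exact (𝒜 (i + j)).sum_mem fun x _ => SetLike.GradedMul.mul_mem (ha x.1) (hb x.2)

instance seriesSupercommutative [IsSupercommutative 𝒜] :
    IsSupercommutative (seriesGrading 𝒜) where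
  comm := fun i j a b ha hb => by
    ext n
    rw [map_zsmul, PowerSeries.coeff_mul, PowerSeries.coeff_mul,
      ← Finset.Nat.sum_antidiagonal_swap, Finset.smul_sum]
    exact Finset.sum_congr rfl fun x _ => IsSupercommutative.comm i j _ _ (ha _) (hb _)
  odd_sq := fun a ha => by
    ext n
    rw [PowerSeries.coeff_mul, map_zero]
    refine Finset.sum_involution (fun x _ => x.swap) ?_ ?_ ?_ ?_
    · intro x _
      have h := IsSupercommutative.comm (𝒜 := 𝒜) 1 1 _ _ (ha x.1) (ha x.2)
      have e : ((1 : ZMod 2) * 1 = 0) = False := by decide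
      simp only [paritySign, e, if_false, neg_smul, one_smul] at h
      simp [h]
    · intro x _ hx hs
      apply hx
      have : x.1 = x.2 := by
        have := congrArg Prod.snd hs
        simpa using this
      rw [this]
      exact IsSupercommutative.odd_sq _ (ha x.2)
    · intro x hx
      simpa [add_comm] using hx
    · intro x _
      simp

variable {𝒜} {p q : ℕ} [SetLike.GradedMonoid 𝒜]

/-- The even supermatrix `1 + z A` over `R⟦z⟧`. -/
noncomputable def onePlusZ (A : evenMat 𝒜 p q) : evenMat (seriesGrading 𝒜) p q :=
  1 + ⟨A.1.map fun a => PowerSeries.X * PowerSeries.C a, fun i j n => by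
    rw [Matrix.map_apply]
    rcases n with _ | n
    · simp
    · rw [PowerSeries.coeff_succ_X_mul, PowerSeries.coeff_C]
      split_ifs
      · exact A.2 i j
      · exact (𝒜 _).zero_mem⟩

/-- The characteristic function `R_A(z) = Ber(1 + z A)`, as a power series over `R₀`. -/
noncomputable def charSeries [IsSupercommutative 𝒜] (A : evenMat 𝒜 p q) : PowerSeries (𝒜 0) :=
  PowerSeries.mk fun n =>
    ⟨PowerSeries.coeff n (Ber (onePlusZ A) : PowerSeries R), (Ber (onePlusZ A)).2 n⟩

end CharacteristicSeries

section ExteriorAlgebra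

variable {R : Type*} [Ring R] (𝒜 : ZMod 2 → AddSubgroup R) (p q : ℕ)

/-- The superspace `V = R^{p|q}`, as columns of (right) coordinates: `x` stands for `∑ eᵢ xᵢ`. -/
abbrev SuperSpace (R : Type*) (p q : ℕ) : Type _ := Fin p ⊕ Fin q → R

/-- Homogeneous vectors of `R^{p|q}` of parity `n`. -/
def spaceGrading (n : ZMod 2) : AddSubgroup (SuperSpace R p q) where
  carrier := {v | ∀ i, v i ∈ 𝒜 (n + idxParity i)}
  zero_mem' := fun _ => (𝒜 _).zero_mem
  add_mem' := fun ha hb i => (𝒜 _).add_mem (ha i) (hb i)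
  neg_mem' := fun ha i => (𝒜 _).neg_mem (ha i)

/-- A scalar, as a generator of the exterior algebra. -/
noncomputable def genScalar (r : R) : TensorAlgebra ℤ (R × SuperSpace R p q) :=
  TensorAlgebra.ι ℤ (r, 0)

/-- A vector, as a generator of the exterior algebra. -/
noncomputable def genVector (v : SuperSpace R p q) : TensorAlgebra ℤ (R × SuperSpace R p q) :=
  TensorAlgebra.ι ℤ (0, v)

/-- The relations of the exterior algebra of `V = R^{p|q}`. The first four present the tensor
algebra of the `R`-bimodule `V` (where `v r = (-1)^{|v||r|} r v`); the relations `wedge` are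
`v ⊗ u + (-1)^{|v||u|} u ⊗ v = 0`; the relations `sq` follow from them if `2` is invertible. -/
inductive ExtRel :
    TensorAlgebra ℤ (R × SuperSpace R p q) → TensorAlgebra ℤ (R × SuperSpace R p q) → Prop
  | one : ExtRel (genScalar p q 1) 1
  | mul (r s : R) : ExtRel (genScalar p q (r * s)) (genScalar p q r * genScalar p q s)
  | smul (v : SuperSpace R p q) (r : R) :
      ExtRel (genVector p q fun i => v i * r) (genVector p q v * genScalar p q r)
  | comm (i j : ZMod 2) (v : SuperSpace R p q) (r : R) (hv : v ∈ spaceGrading 𝒜 p q i)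
      (hr : r ∈ 𝒜 j) :
      ExtRel (genVector p q v * genScalar p q r)
        (paritySign (i * j) • (genScalar p q r * genVector p q v))
  | wedge (i j : ZMod 2) (v u : SuperSpace R p q) (hv : v ∈ spaceGrading 𝒜 p q i)
      (hu : u ∈ spaceGrading 𝒜 p q j) :
      ExtRel (genVector p q v * genVector p q u + paritySign (i * j) •
        (genVector p q u * genVector p q v)) 0
  | sq (v : SuperSpace R p q) (hv : v ∈ spaceGrading 𝒜 p q 0) :
      ExtRel (genVector p q v * genVector p q v) 0

/-- The exterior algebra `Λ(V)` of the superspace `V = R^{p|q}`. -/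
def ExtAlg : Type _ := RingQuot (ExtRel 𝒜 p q)

noncomputable instance extAlgRing : Ring (ExtAlg 𝒜 p q) := inferInstanceAs (Ring (RingQuot (ExtRel 𝒜 p q)))

/-- The projection of the algebra of all words in scalars and vectors onto `Λ(V)`. -/
noncomputable def extMk : TensorAlgebra ℤ (R × SuperSpace R p q) →+* ExtAlg 𝒜 p q :=
  RingQuot.mkRingHom (ExtRel 𝒜 p q)

theorem extMk_rel {x y : TensorAlgebra ℤ (R × SuperSpace R p q)} (h : ExtRel 𝒜 p q x y) :
    extMk 𝒜 p q x = extMk 𝒜 p q y :=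
  RingQuot.mkRingHom_rel h

/-- The scalars in `Λ(V)`. -/
noncomputable def extScalar : R →+* ExtAlg 𝒜 p q where
  toFun r := extMk 𝒜 p q (genScalar p q r)
  map_one' := (extMk_rel 𝒜 p q ExtRel.one).trans (map_one _)
  map_mul' r s := (extMk_rel 𝒜 p q (ExtRel.mul r s)).trans (map_mul _ _ _)
  map_zero' := by
    have h : genScalar p q (0 : R) = 0 := (TensorAlgebra.ι ℤ).map_zero
    rw [h, map_zero]
  map_add' r s := by
    have h : genScalar p q (r + s) = genScalar p q r + genScalar p q s := by
      unfold genScalar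
      rw [← map_add, Prod.mk_add_mk, add_zero]
    rw [h, map_add]

/-- The vectors in `Λ(V)`. -/
noncomputable def extVector (v : SuperSpace R p q) : ExtAlg 𝒜 p q := extMk 𝒜 p q (genVector p q v)

noncomputable instance extAlgModule : Module R (ExtAlg 𝒜 p q) := Module.compHom _ (extScalar 𝒜 p q)

theorem ext_smul_def (r : R) (x : ExtAlg 𝒜 p q) : r • x = extScalar 𝒜 p q r * x := rfl

/-- The wedge product of `k` vectors. -/
noncomputable def wedgeProd {k : ℕ} (v : Fin k → SuperSpace R p q) : ExtAlg 𝒜 p q :=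
  (List.ofFn fun i => extVector 𝒜 p q (v i)).prod

/-- The exterior power `Λᵏ(V)`. -/
noncomputable def extPow (k : ℕ) : Submodule R (ExtAlg 𝒜 p q) :=
  Submodule.span R (Set.range fun v : Fin k → SuperSpace R p q => wedgeProd 𝒜 p q v)

/-- The parity on `Λᵏ(V)` inherited from `V` (and `R`). -/
noncomputable def extPowGrading (k : ℕ) (n : ZMod 2) : AddSubgroup (extPow 𝒜 p q k) :=
  (AddSubgroup.closure {x : ExtAlg 𝒜 p q | ∃ (a : ZMod 2) (b : Fin k → ZMod 2) (r : R)
      (v : Fin k → SuperSpace R p q), r ∈ 𝒜 a ∧ (∀ i, v i ∈ spaceGrading 𝒜 p q (b i)) ∧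
      a + ∑ i, b i = n ∧ x = r • wedgeProd 𝒜 p q v}).comap (extPow 𝒜 p q k).subtype.toAddMonoidHom

variable {𝒜} {p q} [SetLike.GradedMonoid 𝒜]

theorem mulVec_mem (B : evenMat 𝒜 p q) {n : ZMod 2} {v : SuperSpace R p q}
    (hv : v ∈ spaceGrading 𝒜 p q n) : B.1.mulVec v ∈ spaceGrading 𝒜 p q n := fun i => by
  change (∑ j, B.1 i j * v j) ∈ _
  refine (𝒜 _).sum_mem fun j _ => ?_
  have h := SetLike.GradedMul.mul_mem (B.2 i j) (hv j)
  have e : idxParity i + idxParity j + (n + idxParity j) = n + idxParity i := by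
    have h2 : idxParity j + idxParity j = (0 : ZMod 2) := CharTwo.add_self_eq_zero _
    linear_combination h2
  rwa [e] at h

/-- On words, the map which fixes scalars and sends a vector `v` to `B v`. -/
noncomputable def wordMap (B : evenMat 𝒜 p q) :
    TensorAlgebra ℤ (R × SuperSpace R p q) →+* ExtAlg 𝒜 p q :=
  (TensorAlgebra.lift ℤ (AddMonoidHom.mk'
    (fun x : R × SuperSpace R p q => extMk 𝒜 p q (TensorAlgebra.ι ℤ (x.1, B.1.mulVec x.2)))
    (fun x y => by
      rw [← map_add, ← map_add, Prod.fst_add, Prod.snd_add, Matrix.mulVec_add, Prod.mk_add_mk])).toIntLinearMap).toRingHom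

theorem wordMap_genScalar (B : evenMat 𝒜 p q) (r : R) :
    wordMap B (genScalar p q r) = extMk 𝒜 p q (genScalar p q r) := by
  refine (TensorAlgebra.lift_ι_apply _ _).trans ?_
  change extMk 𝒜 p q (TensorAlgebra.ι ℤ (r, B.1.mulVec 0)) = _
  rw [Matrix.mulVec_zero]
  rfl

theorem wordMap_genVector (B : evenMat 𝒜 p q) (v : SuperSpace R p q) :
    wordMap B (genVector p q v) = extMk 𝒜 p q (genVector p q (B.1.mulVec v)) :=
  TensorAlgebra.lift_ι_apply _ _

/-- The algebra endomorphism `Λ(B)` of `Λ(V)` induced by an even operator `B`. -/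
noncomputable def extMap (B : evenMat 𝒜 p q) : ExtAlg 𝒜 p q →+* ExtAlg 𝒜 p q :=
  RingQuot.lift ⟨wordMap B, fun x y h => by
    induction h with
    | one =>
      rw [wordMap_genScalar, map_one, extMk_rel 𝒜 p q ExtRel.one, map_one]
    | mul r s =>
      rw [map_mul, wordMap_genScalar, wordMap_genScalar, wordMap_genScalar,
        extMk_rel 𝒜 p q (ExtRel.mul r s), map_mul]
    | smul v r =>
      have e : (B.1.mulVec fun i => v i * r) = fun i => B.1.mulVec v i * r := by
        funext i
        simp only [Matrix.mulVec, dotProduct, Finset.sum_mul, mul_assoc]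
      rw [map_mul, wordMap_genScalar, wordMap_genVector, wordMap_genVector, e,
        extMk_rel 𝒜 p q (ExtRel.smul _ r), map_mul]
    | comm i j v r hv hr =>
      rw [map_zsmul, map_mul, map_mul, wordMap_genScalar, wordMap_genVector, ← map_mul,
        extMk_rel 𝒜 p q (ExtRel.comm i j _ r (mulVec_mem B hv) hr), map_zsmul, map_mul]
    | wedge i j v u hv hu =>
      rw [map_add, map_zsmul, map_mul, map_mul, wordMap_genVector, wordMap_genVector, ← map_mul,
        ← map_mul, ← map_zsmul, ← map_add,
        extMk_rel 𝒜 p q (ExtRel.wedge i j _ _ (mulVec_mem B hv) (mulVec_mem B hu)), map_zero,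
        map_zero]
    | sq v hv =>
      rw [map_mul, wordMap_genVector, ← map_mul,
        extMk_rel 𝒜 p q (ExtRel.sq _ (mulVec_mem B hv)), map_zero, map_zero]⟩

theorem extMap_extScalar (B : evenMat 𝒜 p q) (r : R) :
    extMap B (extScalar 𝒜 p q r) = extScalar 𝒜 p q r :=
  (RingQuot.lift_mkRingHom_apply _ _ _).trans (wordMap_genScalar B r)

theorem extMap_extVector (B : evenMat 𝒜 p q) (v : SuperSpace R p q) :
    extMap B (extVector 𝒜 p q v) = extVector 𝒜 p q (B.1.mulVec v) :=
  (RingQuot.lift_mkRingHom_apply _ _ _).trans (wordMap_genVector B v)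

/-- `Λ(B)` as an `R`-linear map. -/
noncomputable def extMapLin (B : evenMat 𝒜 p q) : ExtAlg 𝒜 p q →ₗ[R] ExtAlg 𝒜 p q where
  toFun := extMap B
  map_add' := map_add _
  map_smul' r x := by
    rw [ext_smul_def, map_mul, extMap_extScalar]
    rfl

theorem extMap_wedgeProd (B : evenMat 𝒜 p q) {k : ℕ} (v : Fin k → SuperSpace R p q) :
    extMap B (wedgeProd 𝒜 p q v) = wedgeProd 𝒜 p q fun i => B.1.mulVec (v i) := by
  unfold wedgeProd
  rw [map_list_prod, List.map_ofFn]
  congr 2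
  funext i
  exact extMap_extVector B (v i)

/-- The operator `Λᵏ(B)` on `Λᵏ(V)`. -/
noncomputable def extPowMap (B : evenMat 𝒜 p q) (k : ℕ) :
    extPow 𝒜 p q k →ₗ[R] extPow 𝒜 p q k :=
  (extMapLin B).restrict (p := extPow 𝒜 p q k) (q := extPow 𝒜 p q k) fun x hx => by
    have h : extPow 𝒜 p q k ≤ (extPow 𝒜 p q k).comap (extMapLin B) := by
      refine Submodule.span_le.2 ?_
      rintro _ ⟨v, rfl⟩
      refine Submodule.subset_span ⟨fun i => B.1.mulVec (v i), ?_⟩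
      exact (extMap_wedgeProd B v).symm
    exact h hx

end ExteriorAlgebra

section Traces

variable {R : Type*} [Ring R] (𝒜 : ZMod 2 → AddSubgroup R)

/-- A finite homogeneous basis of a `ZMod 2`-graded `R`-module. -/
structure HomogeneousBasis {M : Type*} [AddCommGroup M] [Module R M]
    (ℳ : ZMod 2 → AddSubgroup M) where
  size : ℕ
  parity : Fin size → ZMod 2
  basis : Module.Basis (Fin size) R M
  mem : ∀ i, basis i ∈ ℳ (parity i)

/-- The supertrace `Tr f₀₀ - Tr f₁₁` of an even operator `f` on a free graded module with a finite
homogeneous basis (any such basis gives the same value). -/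
noncomputable def superTrace [GradedRing 𝒜] {M : Type*} [AddCommGroup M] [Module R M]
    (ℳ : ZMod 2 → AddSubgroup M) (f : M →ₗ[R] M) : 𝒜 0 :=
  open Classical in
  if h : Nonempty (HomogeneousBasis (R := R) ℳ) then
    ∑ i, paritySign (h.some.parity i) •
      (DirectSum.decompose 𝒜 (h.some.basis.repr (f (h.some.basis i)) i) 0 : 𝒜 0)
  else 0

variable {𝒜} {p q : ℕ} [GradedRing 𝒜]

/-- `Tr Λᵏ B` for `k ∈ ℤ`, equal to `0` for `k < 0`. -/
noncomputable def trExt (B : evenMat 𝒜 p q) (k : ℤ) : 𝒜 0 :=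
  if 0 ≤ k then superTrace 𝒜 (extPowGrading 𝒜 p q k.toNat) (extPowMap B k.toNat) else 0

variable [IsSupercommutative 𝒜]

/-- Multiplication by the even scalar `a`, after `f`. -/
def evenScale {M : Type*} [AddCommGroup M] [Module R M] (a : 𝒜 0) (f : M →ₗ[R] M) :
    M →ₗ[R] M where
  toFun x := (a : R) • f x
  map_add' x y := by rw [map_add, smul_add]
  map_smul' r x := by
    have hc : (a : R) * r = r * (a : R) := by
      have h : ∀ j : ZMod 2, ∀ s ∈ 𝒜 j, (a : R) * s = s * (a : R) := fun j s hs => by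
        have h := IsSupercommutative.comm (𝒜 := 𝒜) 0 j (a : R) s a.2 hs
        simpa [paritySign] using h
      induction r using DirectSum.Decomposition.inductionOn 𝒜 with
      | zero => rw [mul_zero, zero_mul]
      | homogeneous s => exact h _ _ s.2
      | add s t hs ht => rw [mul_add, add_mul, hs, ht]
    rw [map_smul, smul_smul, hc, ← smul_smul, RingHom.id_apply]

/-- For `k = p - m`, the operator `Σᵏ A` on `Σᵏ V = Ber V ⊗ Λᵐ(V*)`: on the rank one even module
`Ber V` the operator `A` acts by the scalar `Ber A`, on `V*` by the dual of `A⁻¹`. Through the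
standard basis of `V = R^{p|q}`, `V*` is identified with `R^{p|q}` and `Ber V` with `R`. -/
noncomputable def sigmaMap (A : (evenMat 𝒜 p q)ˣ) (m : ℕ) :
    extPow 𝒜 p q m →ₗ[R] extPow 𝒜 p q m :=
  evenScale (Ber (A : evenMat 𝒜 p q))
    (extPowMap (supertranspose ((A⁻¹ : (evenMat 𝒜 p q)ˣ) : evenMat 𝒜 p q)) m)

/-- `Tr Σᵏ A` for `k ∈ ℤ`, equal to `0` for `k > p`. -/
noncomputable def trSigma (A : (evenMat 𝒜 p q)ˣ) (k : ℤ) : 𝒜 0 :=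
  if k ≤ p then
    superTrace 𝒜 (extPowGrading 𝒜 p q ((p : ℤ) - k).toNat) (sigmaMap A ((p : ℤ) - k).toNat)
  else 0

/-- `γ_k = Tr Λᵏ A - Tr Σ^{q+k} A`. -/
noncomputable def gammaSeq (A : (evenMat 𝒜 p q)ˣ) (k : ℤ) : 𝒜 0 :=
  trExt (A : evenMat 𝒜 p q) k - trSigma A (q + k)

end Traces

/-- The Hankel determinant of order `n` of the sequence `s` with top left entry `s k`. -/
def hankelDet {S : Type*} [CommRing S] (s : ℤ → S) (k : ℤ) (n : ℕ) : S :=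
  (Matrix.of fun i j : Fin n => s (k + (i : ℕ) + (j : ℕ))).det

/-- `P(z)/Q(z)` represents the power series `f`, with `deg P ≤ p`, `deg Q ≤ q`, `Q(0) = 1`. -/
def IsFractionOf {S : Type*} [CommRing S] (p q : ℕ) (P Q : Polynomial S) (f : PowerSeries S) :
    Prop :=
  P.natDegree ≤ p ∧ Q.natDegree ≤ q ∧ Q.coeff 0 = 1 ∧
    Polynomial.toPowerSeries Q * f = Polynomial.toPowerSeries P

/-- After an even change of basis, both antidiagonal blocks of `A` vanish. -/
def IsBlockDiagonalizable {R : Type*} [Ring R] {𝒜 : ZMod 2 → AddSubgroup R}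
    [SetLike.GradedMonoid 𝒜] {p q : ℕ} (A : evenMat 𝒜 p q) : Prop :=
  ∃ C : (evenMat 𝒜 p q)ˣ, ∃ B : evenMat 𝒜 p q, (C : evenMat 𝒜 p q) * A = B * C ∧
    (∀ i j, B.1 (Sum.inl i) (Sum.inr j) = 0) ∧ ∀ i j, B.1 (Sum.inr i) (Sum.inl j) = 0

/-!
The theorem rests on the identity `R_A(z) = ∑ Tr Λᵏ A zᵏ` (`charSeries_eq_mk_trExt`) and on the fact
that `Tr Λᵏ A` and `Tr Σ^{q+k} A` are the coefficients of the expansions of the same fraction at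
`z = 0` and at `z = ∞`.

*Traces.* The exterior algebra acts on a model spanned by the monomials `e^l`, with `l i ≤ 1` for even
`i`, which makes the monomials a basis (`extPowBasis`) and gives a formula for the supertrace that is
polynomial in the entries of `A` and invariant under conjugation. For a triangular matrix, monomials
are mapped to multiples of themselves up to terms of lower weight, and the identity can be read off
(`charSeries_of_isUpper`). A matrix over an arbitrary supercommutative ring cannot be made triangular,
but its deformation `D + s^N A` over `R⟦s⟧` can, where `D` is the diagonal matrix of the powers of `s`
(`exists_triangular_deformation`). The entries of `A` are the coefficients of the highest power of `s`
in the deformation, so that polynomial identities which hold for triangular matrices, and are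
invariant under conjugation, pass to `A` by comparison of top coefficients (`HasTop`). Invariance of
the left hand side is the multiplicativity of the Berezinian (`Ber_mul`), which comes down to
`det (1 + YX) det (1 + XY) = 1` for odd `X` and `Y` (`det_one_add_odd_mul_det`).

*Duality.* As the Berezinian is invariant under the supertranspose, the identity for `A⁻¹` gives
`Tr Σ^{q+k} A = Ber A · Tr Λ^{p-q-k} A⁻¹` (`trSigma_eq`). Now `Ber (1 + zA) = Ber A · Ber (z + A⁻¹)`, and
both sides are values of the fraction `Ber (x + yA)`, or of that for `A⁻¹`, whose numerator and
denominator are homogeneous in `x` and `y` (`pencilNum`, `pencilDen`). It follows that a polynomial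
whose highest coefficient is invertible kills `γ`, where polynomials act on sequences by translation
(`exists_seqAct_gammaSeq_eq_zero`). A sequence killed by such a polynomial is determined by its terms
far to the right, where `γ_k = Tr Λᵏ A`.

*Conclusion.* If `R_A = P / Q`, then `Q · γ` is killed by that polynomial and vanishes far to the
right, so it is zero. The determinants of order `q + 1` with rows `(γ_k, …, γ_{k+q})` vanish when all
`k` are large, as is seen for triangular matrices and transferred to `A` by top coefficients
(`det_trExt_eq_zero`); the recurrence carries this over to all rows (`det_gammaSeq_eq_zero`). If the
Hankel determinant of order `q` is invertible, a vector in the kernel of its rows yields `Q`, since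
the determinants of order `q + 1` vanish. For block diagonal matrices `P` and `Q` are the
determinants of `1 + z A₀₀` and `1 + z A₁₁`.
-/

set_option linter.unusedSectionVars false


/-! ### Even and odd matrices -/

section BerezinianProduct

variable {R : Type*} [Ring R] {𝒜 : ZMod 2 → AddSubgroup R} [SetLike.GradedMonoid 𝒜]
  [IsSupercommutative 𝒜]

variable (𝒜) in
/-- The inclusion `R₀ → R`. -/
def evenIncl : 𝒜 0 →+* R where
  toFun a := a
  map_one' := rfl
  map_mul' _ _ := rfl
  map_zero' := rfl
  map_add' _ _ := rfl

@[simp] theorem evenIncl_apply (a : 𝒜 0) : evenIncl 𝒜 a = (a : R) := rfl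

theorem evenIncl_injective : Function.Injective (evenIncl 𝒜) := Subtype.val_injective

/-- The entrywise inclusion of matrices over `R₀` into matrices over `R`. -/
def inclMat {m n : Type*} (M : Matrix m n (𝒜 0)) : Matrix m n R := M.map (evenIncl 𝒜)

theorem inclMat_injective {m n : Type*} :
    Function.Injective (inclMat : Matrix m n (𝒜 0) → Matrix m n R) := fun M N h => by
  ext i j
  exact congrFun (congrFun h i) j

theorem inclMat_mul {l m n : Type*} [Fintype m] (M : Matrix l m (𝒜 0)) (N : Matrix m n (𝒜 0)) :
    inclMat (M * N) = inclMat M * inclMat N := Matrix.map_mul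

theorem inclMat_add {m n : Type*} (M N : Matrix m n (𝒜 0)) :
    inclMat (M + N) = inclMat M + inclMat N := rfl

theorem inclMat_sub {m n : Type*} (M N : Matrix m n (𝒜 0)) :
    inclMat (M - N) = inclMat M - inclMat N := rfl

theorem inclMat_one {n : Type*} [DecidableEq n] : inclMat (1 : Matrix n n (𝒜 0)) = 1 :=
  Matrix.map_one _ (map_zero _) (map_one _)

/-- A matrix all of whose entries are odd. -/
def IsOddMat (𝒜 : ZMod 2 → AddSubgroup R) {m n : Type*} (M : Matrix m n R) : Prop :=
  ∀ i j, M i j ∈ 𝒜 1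

theorem odd_mul_odd_mem {a b : R} (ha : a ∈ 𝒜 1) (hb : b ∈ 𝒜 1) : a * b ∈ 𝒜 0 := by
  have h := SetLike.GradedMul.mul_mem ha hb
  rwa [show (1 : ZMod 2) + 1 = 0 by decide] at h

theorem odd_mul_even_mem {a b : R} (ha : a ∈ 𝒜 1) (hb : b ∈ 𝒜 0) : a * b ∈ 𝒜 1 := by
  have h := SetLike.GradedMul.mul_mem ha hb
  rwa [add_zero] at h

theorem even_mul_odd_mem {a b : R} (ha : a ∈ 𝒜 0) (hb : b ∈ 𝒜 1) : a * b ∈ 𝒜 1 := by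
  have h := SetLike.GradedMul.mul_mem ha hb
  rwa [zero_add] at h

theorem odd_mul_odd_comm {a b : R} (ha : a ∈ 𝒜 1) (hb : b ∈ 𝒜 1) : a * b = -(b * a) := by
  have h := IsSupercommutative.comm (𝒜 := 𝒜) 1 1 a b ha hb
  simpa [paritySign] using h

theorem even_mul_comm {i : ZMod 2} {a b : R} (ha : a ∈ 𝒜 0) (hb : b ∈ 𝒜 i) : a * b = b * a := by
  have h := IsSupercommutative.comm (𝒜 := 𝒜) 0 i a b ha hb
  simpa [paritySign] using h

theorem IsOddMat.mul_inclMat {l m n : Type*} [Fintype m] {Y : Matrix l m R} (hY : IsOddMat 𝒜 Y)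
    (N : Matrix m n (𝒜 0)) : IsOddMat 𝒜 (Y * inclMat N) := fun i j =>
  (𝒜 1).sum_mem fun k _ => odd_mul_even_mem (hY i k) (N k j).2

theorem IsOddMat.incl_mul {l m n : Type*} [Fintype m] {Y : Matrix m n R} (hY : IsOddMat 𝒜 Y)
    (N : Matrix l m (𝒜 0)) : IsOddMat 𝒜 (inclMat N * Y) := fun i j =>
  (𝒜 1).sum_mem fun k _ => even_mul_odd_mem (N i k).2 (hY k j)

/-- The product of two odd matrices, as a matrix over `R₀`. -/
def oddMul {l m n : Type*} [Fintype m] (Y : Matrix l m R) (X : Matrix m n R)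
    (hY : IsOddMat 𝒜 Y) (hX : IsOddMat 𝒜 X) : Matrix l n (𝒜 0) :=
  fun i j => ⟨(Y * X) i j, (𝒜 0).sum_mem fun k _ => odd_mul_odd_mem (hY i k) (hX k j)⟩

theorem inclMat_oddMul {l m n : Type*} [Fintype m] (Y : Matrix l m R) (X : Matrix m n R)
    (hY : IsOddMat 𝒜 Y) (hX : IsOddMat 𝒜 X) : inclMat (oddMul Y X hY hX) = Y * X := rfl

theorem inclMat_mul_inv {n : Type*} [Fintype n] [DecidableEq n] {M : Matrix n n (𝒜 0)}
    (h : IsUnit M.det) : inclMat M * inclMat M⁻¹ = 1 := by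
  rw [← inclMat_mul, Matrix.mul_nonsing_inv _ h, inclMat_one]

theorem inclMat_inv_mul {n : Type*} [Fintype n] [DecidableEq n] {M : Matrix n n (𝒜 0)}
    (h : IsUnit M.det) : inclMat M⁻¹ * inclMat M = 1 := by
  rw [← inclMat_mul, Matrix.nonsing_inv_mul _ h, inclMat_one]

theorem det_one_add_column {n : Type*} [Fintype n] [DecidableEq n] {S : Type*} [CommRing S]
    (u : n → S) (i : n) :
    (1 + Matrix.of fun j k => if k = i then u j else 0 : Matrix n n S).det = 1 + u i := by
  have h := Matrix.det_one_add_replicateCol_mul_replicateRow (ι := Unit) u (Pi.single i 1)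
  rw [single_one_dotProduct] at h
  rw [← h]
  congr 2
  ext j k
  simp [Matrix.mul_apply, Pi.single_apply]

theorem det_one_add_row {n : Type*} [Fintype n] [DecidableEq n] {S : Type*} [CommRing S]
    (u : n → S) (i : n) :
    (1 + Matrix.of fun j k => if j = i then u k else 0 : Matrix n n S).det = 1 + u i := by
  rw [← det_one_add_column u i, ← Matrix.det_transpose]
  congr 1
  ext j k
  simp [Matrix.one_apply, eq_comm]

/-- For odd matrices, `det (1 + YX)` and `det (1 + XY)` are inverse to each other (for even ones they
are equal). Changing one entry of `X` multiplies the two determinants by `1 + ηξ` and `1 + ξη`, with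
`η` and `ξ` odd, and `(1 + ηξ)(1 + ξη) = 1`. -/
theorem det_one_add_odd_mul_det {m n : Type*} [Fintype m] [DecidableEq m] [Fintype n]
    [DecidableEq n] (Y : Matrix m n R) (X : Matrix n m R) (hY : IsOddMat 𝒜 Y)
    (hX : IsOddMat 𝒜 X) :
    (1 + oddMul Y X hY hX).det * (1 + oddMul X Y hX hY).det = 1 := by
  classical
  suffices H : ∀ s : Finset (n × m), ∀ X : Matrix n m R, ∀ hX : IsOddMat 𝒜 X,
      (∀ l i, (l, i) ∉ s → X l i = 0) →
      (1 + oddMul Y X hY hX).det * (1 + oddMul X Y hX hY).det = 1 from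
    H Finset.univ X hX fun l i h => absurd (Finset.mem_univ _) h
  intro s
  induction s using Finset.induction_on with
  | empty =>
    intro X hX h
    have h0 : X = 0 := by
      ext l i
      exact h l i (Finset.notMem_empty _)
    have e1 : oddMul Y X hY hX = 0 := inclMat_injective (by
      rw [inclMat_oddMul, h0, Matrix.mul_zero]; rfl)
    have e2 : oddMul X Y hX hY = 0 := inclMat_injective (by
      rw [inclMat_oddMul, h0, Matrix.zero_mul]; rfl)
    rw [e1, e2]
    simp
  | insert a s ha ih =>
    obtain ⟨l, i⟩ := a
    intro X hX h
    let X' : Matrix n m R := fun l' i' => if (l', i') = (l, i) then 0 else X l' i'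
    have hX' : IsOddMat 𝒜 X' := fun l' i' => by
      change (if _ then _ else _) ∈ _
      split_ifs
      exacts [(𝒜 1).zero_mem, hX _ _]
    have key := ih X' hX' fun l' i' hli => by
      change (if _ then _ else _) = _
      split_ifs with he
      · rfl
      · exact h _ _ (by simp [Finset.mem_insert, he, hli])
    set ξ : R := X l i with hξ
    have hξ1 : ξ ∈ 𝒜 1 := hX l i
    have hXX : X = X' + Matrix.single l i ξ := by
      ext l' i'
      change _ = (if (l', i') = (l, i) then 0 else X l' i') + Matrix.single l i ξ l' i'
      simp only [Prod.mk.injEq, Matrix.single_apply]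
      by_cases hc : l' = l ∧ i' = i
      · obtain ⟨rfl, rfl⟩ := hc
        simp [hξ]
      · rw [if_neg hc, if_neg (fun hc' => hc ⟨hc'.1.symm, hc'.2.symm⟩), add_zero]
    set M' := 1 + oddMul Y X' hY hX' with hM'
    set N' := 1 + oddMul X' Y hX' hY with hN'
    have uM : IsUnit M'.det := IsUnit.of_mul_eq_one _ key
    have uN : IsUnit N'.det := IsUnit.of_mul_eq_one _ ((mul_comm _ _).trans key)
    have iM : inclMat M' = 1 + Y * X' := by
      rw [hM', inclMat_add, inclMat_one, inclMat_oddMul]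
    have iN : inclMat N' = 1 + X' * Y := by
      rw [hN', inclMat_add, inclMat_one, inclMat_oddMul]
    -- since `H = Y N'⁻¹ = M'⁻¹ Y`, restoring the entry `ξ` multiplies `M'` by `1 + H ξ E_li` on the
    -- right and `N'` by `1 + ξ E_li H` on the left
    set H : Matrix m n R := Y * inclMat N'⁻¹ with hH
    have oH : IsOddMat 𝒜 H := hY.mul_inclMat _
    have HN : H * inclMat N' = Y := by
      rw [hH, Matrix.mul_assoc, inclMat_inv_mul uN, Matrix.mul_one]
    have YN : Y * inclMat N' = inclMat M' * Y := by
      rw [iM, iN, Matrix.mul_add, Matrix.add_mul, Matrix.mul_one, Matrix.one_mul, Matrix.mul_assoc]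
    have MH : inclMat M' * H = Y := by
      rw [hH, ← Matrix.mul_assoc, ← YN, Matrix.mul_assoc, inclMat_mul_inv uN, Matrix.mul_one]
    let u : m → 𝒜 0 := fun j => ⟨H j l * ξ, odd_mul_odd_mem (oH j l) hξ1⟩
    let w : n → 𝒜 0 := fun j => ⟨ξ * H i j, odd_mul_odd_mem hξ1 (oH i j)⟩
    have e1 : 1 + oddMul Y X hY hX
        = M' * (1 + Matrix.of fun j k => if k = i then u j else 0) := by
      apply inclMat_injective
      rw [inclMat_mul, iM, inclMat_add, inclMat_add, inclMat_one, inclMat_oddMul]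
      have : inclMat (Matrix.of fun j k => if k = i then u j else 0)
          = H * Matrix.single l i ξ := by
        ext j k
        by_cases hk : k = i
        · subst hk
          simp [inclMat, u]
        · simp [inclMat, hk, Matrix.mul_single_apply_of_ne _ _ _ _ _ hk]
      rw [this, Matrix.mul_add, Matrix.mul_one, ← Matrix.mul_assoc, ← iM, MH, iM, hXX, Matrix.mul_add,
        add_assoc]
    have e2 : 1 + oddMul X Y hX hY
        = (1 + Matrix.of fun j k => if j = l then w k else 0) * N' := by
      apply inclMat_injective
      rw [inclMat_mul, iN, inclMat_add, inclMat_add, inclMat_one, inclMat_oddMul]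
      have : inclMat (Matrix.of fun j k => if j = l then w k else 0)
          = Matrix.single l i ξ * H := by
        ext j k
        by_cases hk : j = l
        · subst hk
          simp [inclMat, w]
        · simp [inclMat, hk, Matrix.single_mul_apply_of_ne _ _ _ _ _ hk]
      rw [this, Matrix.add_mul, Matrix.one_mul, Matrix.mul_assoc, ← iN, HN, iN, hXX, Matrix.add_mul,
        add_assoc]
    have e3 : (1 + u i) * (1 + w l) = 1 := by
      apply evenIncl_injective
      rw [map_mul, map_add, map_add, map_one]
      change (1 + H i l * ξ) * (1 + ξ * H i l) = 1
      have a1 : H i l * ξ * (ξ * H i l) = 0 := by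
        rw [mul_assoc, ← mul_assoc ξ, IsSupercommutative.odd_sq ξ hξ1, zero_mul, mul_zero]
      have a2 := odd_mul_odd_comm (oH i l) hξ1
      rw [mul_add, add_mul, add_mul, a1, a2]
      simp
    rw [e1, e2, Matrix.det_mul, Matrix.det_mul, det_one_add_column, det_one_add_row]
    calc _ = (M'.det * N'.det) * ((1 + u i) * (1 + w l)) := by ring
      _ = 1 := by rw [key, e3, one_mul]

/-! ### The Berezinian -/

section Blocks

variable {p q : ℕ}

/-- The odd block `M₀₁`. -/
def block01 (M : evenMat 𝒜 p q) : Matrix (Fin p) (Fin q) R := fun i j => M.1 (Sum.inl i) (Sum.inr j)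

/-- The odd block `M₁₀`. -/
def block10 (M : evenMat 𝒜 p q) : Matrix (Fin q) (Fin p) R := fun i j => M.1 (Sum.inr i) (Sum.inl j)

theorem block01_odd (M : evenMat 𝒜 p q) : IsOddMat 𝒜 (block01 M) := fun i j => by
  change M.1 (Sum.inl i) (Sum.inr j) ∈ 𝒜 1
  simpa [idxParity] using M.2 (Sum.inl i) (Sum.inr j)

theorem block10_odd (M : evenMat 𝒜 p q) : IsOddMat 𝒜 (block10 M) := fun i j => by
  change M.1 (Sum.inr i) (Sum.inl j) ∈ 𝒜 1
  simpa [idxParity] using M.2 (Sum.inr i) (Sum.inl j)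

theorem inclMat_oddBlockProd (M : evenMat 𝒜 p q) (N : Matrix (Fin q) (Fin q) (𝒜 0)) :
    inclMat (oddBlockProd M N) = block01 M * inclMat N * block10 M := by
  ext i j
  change (∑ k, ∑ l, M.1 (Sum.inl i) (Sum.inr k) * (N k l : R) * M.1 (Sum.inr l) (Sum.inl j)) = _
  simp only [Matrix.mul_apply, Finset.sum_mul]
  rw [Finset.sum_comm]
  rfl

theorem inclMat_block00_mul (M N : evenMat 𝒜 p q) :
    inclMat (block00 (M * N)) = inclMat (block00 M) * inclMat (block00 N)
      + block01 M * block10 N := by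
  ext i j
  change (M.1 * N.1) _ _ = _
  rw [Matrix.mul_apply, Fintype.sum_sum_type]
  rfl

theorem inclMat_block11_mul (M N : evenMat 𝒜 p q) :
    inclMat (block11 (M * N)) = block10 M * block01 N
      + inclMat (block11 M) * inclMat (block11 N) := by
  ext i j
  change (M.1 * N.1) _ _ = _
  rw [Matrix.mul_apply, Fintype.sum_sum_type]
  rfl

theorem block01_mul (M N : evenMat 𝒜 p q) :
    block01 (M * N) = inclMat (block00 M) * block01 N + block01 M * inclMat (block11 N) := by
  ext i j
  change (M.1 * N.1) _ _ = _
  rw [Matrix.mul_apply, Fintype.sum_sum_type]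
  rfl

theorem block10_mul (M N : evenMat 𝒜 p q) :
    block10 (M * N) = block10 M * inclMat (block00 N) + inclMat (block11 M) * block10 N := by
  ext i j
  change (M.1 * N.1) _ _ = _
  rw [Matrix.mul_apply, Fintype.sum_sum_type]
  rfl

/-- The Berezinian is multiplicative. With `x = M₁₁⁻¹ M₁₀` and `y = N₀₁ N₁₁⁻¹`, the product has lower
right block `M₁₁ (1 + x y) N₁₁`, and its Schur complement is the product of those of `M` and `N` with
`(1 + y x)⁻¹` in between. -/
theorem Ber_mul_aux (M N : evenMat 𝒜 p q) (hM : IsUnit (block11 M).det)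
    (hN : IsUnit (block11 N).det) :
    IsUnit (block11 (M * N)).det ∧ Ber (M * N) = Ber M * Ber N := by
  set a := inclMat (block00 M) with ha
  set d := inclMat (block11 M) with hd
  set a' := inclMat (block00 N) with ha'
  set d' := inclMat (block11 N) with hd'
  set b := block01 M with hb
  set c := block10 M with hc
  set b' := block01 N with hb'
  set c' := block10 N with hc'
  set di := inclMat (block11 M)⁻¹ with hdi
  set di' := inclMat (block11 N)⁻¹ with hdi'
  have d1 : d * di = 1 := inclMat_mul_inv hM
  have d2 : di' * d' = 1 := inclMat_inv_mul hN
  set x := di * c with hx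
  set y := b' * di' with hy
  have ox : IsOddMat 𝒜 x := (block10_odd M).incl_mul _
  have oy : IsOddMat 𝒜 y := (block01_odd N).mul_inclMat _
  have dx : d * x = c := by rw [hx, ← Matrix.mul_assoc, d1, Matrix.one_mul]
  have yd : y * d' = b' := by rw [hy, Matrix.mul_assoc, d2, Matrix.mul_one]
  set W := 1 + oddMul x y ox oy with hW
  set V := 1 + oddMul y x oy ox with hV
  have K : V.det * W.det = 1 := det_one_add_odd_mul_det y x oy ox
  have uW : IsUnit W.det := IsUnit.of_mul_eq_one _ ((mul_comm _ _).trans K)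
  set w := inclMat W with hw
  set wi := inclMat W⁻¹ with hwi
  have w1 : w = 1 + x * y := by rw [hw, hW, inclMat_add, inclMat_one, inclMat_oddMul]
  have w2 : w * wi = 1 := inclMat_mul_inv uW
  have w3 : wi * w = 1 := inclMat_inv_mul uW
  have e11 : block11 (M * N) = block11 M * W * block11 N := by
    apply inclMat_injective
    rw [inclMat_block11_mul, inclMat_mul, inclMat_mul, ← hw, ← hd, ← hd', w1, ← hc, ← hb',
      ← dx, ← yd, Matrix.mul_add, Matrix.add_mul, Matrix.mul_one, add_comm]
    simp only [Matrix.mul_assoc]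
  have u11 : IsUnit (block11 (M * N)).det := by
    rw [e11, Matrix.det_mul, Matrix.det_mul]
    exact (hM.mul uW).mul hN
  refine ⟨u11, ?_⟩
  set s := block00 M - oddBlockProd M (block11 M)⁻¹ with hs
  set s' := block00 N - oddBlockProd N (block11 N)⁻¹ with hs'
  have as : a = inclMat s + b * x := by
    rw [hs, inclMat_sub, inclMat_oddBlockProd, Matrix.mul_assoc, sub_add_cancel]
  have as' : a' = inclMat s' + y * c' := by
    rw [hs', inclMat_sub, inclMat_oddBlockProd, sub_add_cancel]
  -- `Z` is the inverse of `1 + y x`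
  set Z := 1 - oddMul (y * wi) x (oy.mul_inclMat _) ox with hZ
  have iZ : inclMat Z = 1 - y * wi * x := by rw [hZ, inclMat_sub, inclMat_one, inclMat_oddMul]
  have VZ : V * Z = 1 := by
    apply inclMat_injective
    rw [inclMat_mul, iZ, hV, inclMat_add, inclMat_one, inclMat_oddMul]
    have : (1 + y * x) * y = y * w := by
      rw [w1, Matrix.add_mul, Matrix.mul_add, Matrix.one_mul, Matrix.mul_one, Matrix.mul_assoc]
    rw [Matrix.mul_sub, Matrix.mul_one, ← Matrix.mul_assoc (1 + y * x) (y * wi) x,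
      ← Matrix.mul_assoc (1 + y * x) y wi, this,
      Matrix.mul_assoc y, w2, Matrix.mul_one, add_sub_cancel_right]
  have Zd : Z.det = W.det := by
    have h := congrArg Matrix.det VZ
    rw [Matrix.det_mul, Matrix.det_one] at h
    calc Z.det = (V.det * W.det) * Z.det := by rw [K, one_mul]
      _ = W.det * (V.det * Z.det) := by ring
      _ = W.det := by rw [h, mul_one]
  have schur : block00 (M * N) - oddBlockProd (M * N) (block11 (M * N))⁻¹ = s * Z * s' := by
    apply inclMat_injective
    have inv : inclMat (block11 (M * N))⁻¹ = di' * wi * di := by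
      rw [e11, Matrix.mul_inv_rev, Matrix.mul_inv_rev, inclMat_mul, inclMat_mul, Matrix.mul_assoc]
    have e01 : block01 (M * N) = (inclMat s * y + b * w) * d' := by
      rw [block01_mul, ← ha, as, w1, ← hb', ← yd, ← hb, ← hd']
      simp only [Matrix.mul_add, Matrix.add_mul, Matrix.mul_assoc, Matrix.mul_one]
      abel
    have e10 : block10 (M * N) = d * (x * inclMat s' + w * c') := by
      rw [block10_mul, ← ha', as', w1, ← hc, ← dx, ← hd, ← hc']
      simp only [Matrix.mul_add, Matrix.add_mul, Matrix.mul_assoc, Matrix.one_mul]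
      abel
    have d1' : d' * di' = 1 := inclMat_mul_inv hN
    have d2' : di * d = 1 := inclMat_inv_mul hM
    have prod : block01 (M * N) * (di' * wi * di) * block10 (M * N)
        = (inclMat s * y + b * w) * wi * (x * inclMat s' + w * c') := by
      rw [e01, e10]
      calc _ = (inclMat s * y + b * w) * (d' * di') * wi * (di * d)
            * (x * inclMat s' + w * c') := by simp only [Matrix.mul_assoc]
        _ = _ := by rw [d1', d2', Matrix.mul_one, Matrix.mul_one]
    have r1 : (inclMat s * y + b * w) * wi * (x * inclMat s' + w * c')
        = inclMat s * y * wi * x * inclMat s' + inclMat s * y * c' + b * x * inclMat s'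
          + b * w * c' := by
      have t1 : inclMat s * y * wi * (w * c') = inclMat s * y * c' := by
        rw [← Matrix.mul_assoc, Matrix.mul_assoc _ wi, w3, Matrix.mul_one]
      have t2 : b * w * wi = b := by rw [Matrix.mul_assoc, w2, Matrix.mul_one]
      rw [Matrix.add_mul, t2, Matrix.add_mul, Matrix.mul_add, Matrix.mul_add, t1]
      simp only [Matrix.mul_assoc]
      abel
    rw [inclMat_sub, inclMat_oddBlockProd, inv, prod, r1, inclMat_block00_mul, inclMat_mul,
      inclMat_mul, iZ, ← ha, ← ha', ← hb, ← hc', as, as', w1]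
    simp only [Matrix.mul_add, Matrix.add_mul, Matrix.mul_sub, Matrix.sub_mul, Matrix.mul_assoc,
      Matrix.mul_one]
    abel
  have hinv : Ring.inverse (block11 (M * N)).det
      = Ring.inverse (block11 M).det * Ring.inverse W.det * Ring.inverse (block11 N).det := by
    rw [e11, Matrix.det_mul, Matrix.det_mul, Ring.mul_inverse_rev, Ring.mul_inverse_rev]
    ring
  unfold Ber
  rw [schur, hinv, Matrix.det_mul, Matrix.det_mul, Zd]
  have := Ring.mul_inverse_cancel _ uW
  linear_combination (s.det * s'.det * Ring.inverse (block11 M).det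
    * Ring.inverse (block11 N).det) * this

theorem Ber_mul (M N : evenMat 𝒜 p q) (hM : IsUnit (block11 M).det)
    (hN : IsUnit (block11 N).det) : Ber (M * N) = Ber M * Ber N := (Ber_mul_aux M N hM hN).2

theorem block11_one : block11 (1 : evenMat 𝒜 p q) = 1 := by
  apply inclMat_injective
  ext i j
  rw [inclMat_one]
  change (1 : Matrix (Fin p ⊕ Fin q) (Fin p ⊕ Fin q) R) _ _ = _
  simp [Matrix.one_apply]

theorem block00_one : block00 (1 : evenMat 𝒜 p q) = 1 := by
  apply inclMat_injective
  ext i j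
  rw [inclMat_one]
  change (1 : Matrix (Fin p ⊕ Fin q) (Fin p ⊕ Fin q) R) _ _ = _
  simp [Matrix.one_apply]

/-- The Berezinian of a block upper triangular supermatrix. -/
theorem Ber_of_block_upper (M : evenMat 𝒜 p q)
    (h : ∀ i j, M.1 (Sum.inr i) (Sum.inl j) = 0) :
    Ber M = (block00 M).det * Ring.inverse (block11 M).det := by
  have h0 : oddBlockProd M (block11 M)⁻¹ = 0 := by
    apply inclMat_injective
    have : block10 M = 0 := by
      ext i j
      exact h i j
    rw [inclMat_oddBlockProd, this, Matrix.mul_zero]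
    rfl
  rw [Ber, h0, sub_zero]

theorem Ber_one : Ber (1 : evenMat 𝒜 p q) = 1 := by
  rw [Ber_of_block_upper, block00_one, block11_one]
  · simp
  · intro i j
    exact Matrix.one_apply_ne (by simp)

/-- The lower right block of an invertible even supermatrix is invertible: up to the product of odd
matrices `A₁₀ (A⁻¹)₀₁`, its inverse is `(A⁻¹)₁₁`. -/
theorem isUnit_det_block11 (A : (evenMat 𝒜 p q)ˣ) : IsUnit (block11 (A : evenMat 𝒜 p q)).det := by
  set B : evenMat 𝒜 p q := ((A⁻¹ : (evenMat 𝒜 p q)ˣ) : evenMat 𝒜 p q) with hB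
  have h := inclMat_block11_mul (A : evenMat 𝒜 p q) B
  rw [hB, Units.mul_inv, block11_one, inclMat_one, ← hB] at h
  have o : IsOddMat 𝒜 (-block10 (A : evenMat 𝒜 p q)) := fun i j =>
    (𝒜 1).neg_mem (block10_odd _ i j)
  have e : block11 (A : evenMat 𝒜 p q) * block11 B
      = 1 + oddMul (-block10 (A : evenMat 𝒜 p q)) (block01 B) o (block01_odd B) := by
    apply inclMat_injective
    rw [inclMat_mul, inclMat_add, inclMat_one, inclMat_oddMul, h, Matrix.neg_mul]
    abel
  have u := IsUnit.of_mul_eq_one _ (det_one_add_odd_mul_det _ _ o (block01_odd B))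
  rw [← e, Matrix.det_mul] at u
  exact isUnit_of_mul_isUnit_left u

end Blocks

end BerezinianProduct

/-! ### Parity signs and the parity automorphism -/

theorem paritySign_zero : paritySign 0 = 1 := rfl

theorem paritySign_add (i j : ZMod 2) : paritySign (i + j) = paritySign i * paritySign j := by
  revert i j; decide

theorem paritySign_mul_self (i : ZMod 2) : paritySign i * paritySign i = 1 := by
  revert i; decide

theorem parity_cases (i : ZMod 2) : i = 0 ∨ i = 1 := by
  revert i; decide

section Twist

variable {R : Type*} [Ring R] (𝒜 : ZMod 2 → AddSubgroup R) [GradedRing 𝒜]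

/-- The map `r ↦ (-1)^{i|r|} r`, additively. -/
def parityTwistAdd (i : ZMod 2) : R →+ R where
  toFun r := (DirectSum.decompose 𝒜 r 0 : R) + paritySign i • (DirectSum.decompose 𝒜 r 1 : R)
  map_zero' := by simp
  map_add' r s := by
    simp only [DirectSum.decompose_add, DirectSum.add_apply, AddSubgroup.coe_add, smul_add]
    abel

theorem parityTwistAdd_of_mem (i : ZMod 2) {j : ZMod 2} {r : R} (hr : r ∈ 𝒜 j) :
    parityTwistAdd 𝒜 i r = paritySign (i * j) • r := by
  change (DirectSum.decompose 𝒜 r 0 : R) + paritySign i • (DirectSum.decompose 𝒜 r 1 : R) = _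
  have h01 : (0 : ZMod 2) ≠ 1 := by decide
  rcases parity_cases j with rfl | rfl
  · rw [DirectSum.decompose_of_mem_same 𝒜 hr, DirectSum.decompose_of_mem_ne 𝒜 hr h01]
    simp [paritySign_zero]
  · rw [DirectSum.decompose_of_mem_same 𝒜 hr, DirectSum.decompose_of_mem_ne 𝒜 hr h01.symm]
    simp

/-- Two additive maps on a graded ring agree if they do so on homogeneous elements. -/
theorem addHom_ext_homogeneous {M : Type*} [AddCommMonoid M] {f g : R →+ M}
    (h : ∀ i, ∀ r ∈ 𝒜 i, f r = g r) : f = g := by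
  ext r
  induction r using DirectSum.Decomposition.inductionOn 𝒜 with
  | zero => rw [map_zero, map_zero]
  | homogeneous s => exact h _ _ s.2
  | add s t hs ht => rw [map_add, map_add, hs, ht]

/-- The ring endomorphism `r ↦ (-1)^{i|r|} r` of a superring, for a parity `i`. -/
def parityTwist (i : ZMod 2) : R →+* R :=
  { parityTwistAdd 𝒜 i with
    map_one' := (parityTwistAdd_of_mem 𝒜 i SetLike.GradedOne.one_mem).trans (by
      rw [mul_zero, paritySign_zero, one_smul])
    map_mul' := fun r s => by
      change parityTwistAdd 𝒜 i (r * s) = parityTwistAdd 𝒜 i r * parityTwistAdd 𝒜 i s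
      induction r using DirectSum.Decomposition.inductionOn 𝒜 with
      | zero => rw [zero_mul, map_zero, zero_mul]
      | add r r' hr hr' => rw [add_mul, map_add, hr, hr', map_add, add_mul]
      | homogeneous r =>
        induction s using DirectSum.Decomposition.inductionOn 𝒜 with
        | zero => rw [mul_zero, map_zero, mul_zero]
        | add s s' hs hs' => rw [mul_add, map_add, hs, hs', map_add, mul_add]
        | homogeneous s =>
          rw [parityTwistAdd_of_mem 𝒜 i (SetLike.GradedMul.mul_mem r.2 s.2),
            parityTwistAdd_of_mem 𝒜 i r.2, parityTwistAdd_of_mem 𝒜 i s.2, smul_mul_smul_comm,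
            mul_add, paritySign_add] }

theorem parityTwist_of_mem (i : ZMod 2) {j : ZMod 2} {r : R} (hr : r ∈ 𝒜 j) :
    parityTwist 𝒜 i r = paritySign (i * j) • r := parityTwistAdd_of_mem 𝒜 i hr

theorem parityTwist_mem (i : ZMod 2) {j : ZMod 2} {r : R} (hr : r ∈ 𝒜 j) :
    parityTwist 𝒜 i r ∈ 𝒜 j := by
  rw [parityTwist_of_mem 𝒜 i hr]
  exact (𝒜 j).zsmul_mem hr _

end Twist

/-! ### The exterior algebra in terms of the standard basis -/

section ExtLift

variable {R : Type*} [Ring R] {𝒜 : ZMod 2 → AddSubgroup R} {p q : ℕ} [GradedRing 𝒜]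
  [IsSupercommutative 𝒜]

section

variable {A : Type*} [Ring A] (f : R →+* A) (E : Fin p ⊕ Fin q → A)

/-- The image `∑ Eᵢ vᵢ` of a vector, given images of the scalars and of the basis vectors. -/
def liftVector (v : SuperSpace R p q) : A := ∑ i, E i * f (v i)

theorem liftVector_add (v u : SuperSpace R p q) :
    liftVector f E (v + u) = liftVector f E v + liftVector f E u := by
  simp [liftVector, mul_add, Finset.sum_add_distrib]

/-- The extension to words of given images of the scalars and of the basis vectors. -/
noncomputable def liftWord : TensorAlgebra ℤ (R × SuperSpace R p q) →+* A :=
  (TensorAlgebra.lift ℤ (AddMonoidHom.mk' (fun x : R × SuperSpace R p q =>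
    f x.1 + liftVector f E x.2) fun x y => by
      rw [Prod.fst_add, Prod.snd_add, map_add, liftVector_add]
      abel).toIntLinearMap).toRingHom

theorem liftWord_genScalar (r : R) : liftWord f E (genScalar p q r) = f r := by
  refine (TensorAlgebra.lift_ι_apply _ _).trans ?_
  change f r + liftVector f E 0 = _
  simp [liftVector]

theorem liftWord_genVector (v : SuperSpace R p q) :
    liftWord f E (genVector p q v) = liftVector f E v := by
  refine (TensorAlgebra.lift_ι_apply _ _).trans ?_
  change f 0 + liftVector f E v = _
  simp

variable (𝒜) in
/-- The conditions under which images `f` of the scalars and `E` of the basis vectors of `R^{p|q}`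
extend to the exterior algebra. -/
structure IsExtFamily : Prop where
  comm : ∀ i r, E i * f r = f (parityTwist 𝒜 (idxParity i) r) * E i
  anti : ∀ i j, E i * E j = -(paritySign (idxParity i * idxParity j) • (E j * E i))
  sq : ∀ i, idxParity i = 0 → E i * E i = 0

variable {f E} (h : IsExtFamily 𝒜 f E)
include h

theorem liftVector_mul_scalar {i j : ZMod 2} {v : SuperSpace R p q} {r : R}
    (hv : v ∈ spaceGrading 𝒜 p q i) (hr : r ∈ 𝒜 j) :
    liftVector f E v * f r = paritySign (i * j) • (f r * liftVector f E v) := by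
  rw [liftVector, Finset.sum_mul, Finset.mul_sum, Finset.smul_sum]
  refine Finset.sum_congr rfl fun k _ => ?_
  have e1 := IsSupercommutative.comm (𝒜 := 𝒜) _ _ _ _ (hv k) hr
  have e2 := h.comm k r
  rw [parityTwist_of_mem 𝒜 _ hr, map_zsmul] at e2
  have e3 : f r * E k = paritySign (idxParity k * j) • (E k * f r) := by
    rw [e2, smul_mul_assoc, smul_smul, paritySign_mul_self, one_smul]
  rw [mul_assoc, ← map_mul, e1, ← mul_assoc (f r), e3, map_zsmul, smul_mul_assoc, smul_smul,
    mul_smul_comm, mul_assoc, map_mul, add_mul, paritySign_add]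

theorem liftVector_mul {n : ZMod 2} {v u : SuperSpace R p q} (hv : v ∈ spaceGrading 𝒜 p q n) :
    liftVector f E v * liftVector f E u = ∑ i, ∑ j,
      paritySign (idxParity j * (n + idxParity i)) • (E i * E j * f (v i * u j)) := by
  rw [liftVector, liftVector, Finset.sum_mul_sum]
  refine Finset.sum_congr rfl fun i _ => Finset.sum_congr rfl fun j _ => ?_
  have e2 := h.comm j (v i)
  rw [parityTwist_of_mem 𝒜 _ (hv i), map_zsmul] at e2
  have e3 : f (v i) * E j
      = paritySign (idxParity j * (n + idxParity i)) • (E j * f (v i)) := by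
    rw [e2, smul_mul_assoc, smul_smul, paritySign_mul_self, one_smul]
  rw [mul_assoc, ← mul_assoc (f _), e3, smul_mul_assoc, mul_smul_comm, map_mul]
  simp only [mul_assoc]

theorem liftVector_wedge {n m : ZMod 2} {v u : SuperSpace R p q}
    (hv : v ∈ spaceGrading 𝒜 p q n) (hu : u ∈ spaceGrading 𝒜 p q m) (i j : Fin p ⊕ Fin q) :
    paritySign (idxParity j * (n + idxParity i)) • (E i * E j * f (v i * u j))
      + paritySign (n * m) •
        (paritySign (idxParity i * (m + idxParity j)) • (E j * E i * f (u j * v i))) = 0 := by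
  have e1 := IsSupercommutative.comm (𝒜 := 𝒜) _ _ _ _ (hv i) (hu j)
  have e2 := h.anti i j
  rw [e1, e2, map_zsmul, neg_mul, smul_mul_assoc, mul_smul_comm, smul_neg, smul_smul, smul_smul,
    smul_smul, ← neg_smul, ← add_smul]
  convert zero_smul ℤ _
  clear e1 e2 hv hu
  generalize idxParity i = a
  generalize idxParity j = b
  revert n m a b
  decide

theorem liftVector_sq {v : SuperSpace R p q} (hv : v ∈ spaceGrading 𝒜 p q 0) :
    liftVector f E v * liftVector f E v = 0 := by
  rw [liftVector_mul h hv, ← Fintype.sum_prod_type']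
  refine Finset.sum_involution (fun x _ => x.swap) ?_ ?_ ?_ ?_
  · rintro ⟨i, j⟩ _
    have := liftVector_wedge h hv hv i j
    rwa [zero_mul, paritySign_zero, one_smul] at this
  · rintro ⟨i, j⟩ _ hx hs
    apply hx
    have hij : j = i := congrArg Prod.fst hs
    subst hij
    rcases parity_cases (idxParity j) with hp | hp
    · simp [h.sq j hp]
    · have := hv j
      rw [hp, zero_add] at this
      simp [IsSupercommutative.odd_sq _ this]
  · intro x _
    exact Finset.mem_univ _
  · intro x _
    exact Prod.swap_swap x

/-- The universal property of the exterior algebra, in terms of the basis vectors. -/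
noncomputable def extLift : ExtAlg 𝒜 p q →+* A :=
  RingQuot.lift ⟨liftWord f E, fun x y hxy => by
    induction hxy with
    | one => rw [liftWord_genScalar, map_one, map_one]
    | mul r s => rw [map_mul, liftWord_genScalar, liftWord_genScalar, liftWord_genScalar, map_mul]
    | smul v r =>
      rw [map_mul, liftWord_genScalar, liftWord_genVector, liftWord_genVector]
      simp only [liftVector, map_mul, Finset.sum_mul, mul_assoc]
    | comm i j v r hv hr =>
      rw [map_zsmul, map_mul, map_mul, liftWord_genScalar, liftWord_genVector,
        liftVector_mul_scalar h hv hr]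
    | wedge i j v u hv hu =>
      rw [map_add, map_zsmul, map_mul, map_mul, liftWord_genVector, liftWord_genVector, map_zero,
        liftVector_mul h hv, liftVector_mul h hu, Finset.sum_comm, Finset.smul_sum,
        ← Finset.sum_add_distrib]
      refine Finset.sum_eq_zero fun b _ => ?_
      rw [Finset.smul_sum, ← Finset.sum_add_distrib]
      exact Finset.sum_eq_zero fun a _ => liftVector_wedge h hv hu a b
    | sq v hv => rw [map_mul, liftWord_genVector, map_zero, liftVector_sq h hv]⟩

theorem extLift_extScalar (r : R) : extLift h (extScalar 𝒜 p q r) = f r :=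
  (RingQuot.lift_mkRingHom_apply _ _ _).trans (liftWord_genScalar f E r)

theorem extLift_extVector (v : SuperSpace R p q) :
    extLift h (extVector 𝒜 p q v) = liftVector f E v :=
  (RingQuot.lift_mkRingHom_apply _ _ _).trans (liftWord_genVector f E v)

end

end ExtLift

/-! ### Monomials in the basis vectors -/

section Monomials

variable {p q : ℕ}

/-- The position of a basis vector of `R^{p|q}`, even basis vectors first. -/
def basisRank (i : Fin p ⊕ Fin q) : ℕ := (finSumFinEquiv i : Fin (p + q))

theorem basisRank_injective : Function.Injective (basisRank (p := p) (q := q)) :=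
  Fin.val_injective.comp finSumFinEquiv.injective

/-- The sign `κ` in the relation `eᵢ eⱼ = κ eⱼ eᵢ` of the exterior algebra. -/
def swapSign (i j : Fin p ⊕ Fin q) : ℤ := -paritySign (idxParity i * idxParity j)

theorem swapSign_comm (i j : Fin p ⊕ Fin q) : swapSign i j = swapSign j i := by
  rw [swapSign, swapSign, mul_comm]

theorem swapSign_mul_self (i j : Fin p ⊕ Fin q) : swapSign i j * swapSign i j = 1 := by
  rw [swapSign, neg_mul_neg, paritySign_mul_self]

/-- The coefficient of the monomial `e^{l + δᵢ}` in `eᵢ e^l`: the sign from moving `eᵢ` to its place,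
or zero if `eᵢ` is even and already occurs in `e^l`. -/
def insSign (i : Fin p ⊕ Fin q) (l : Fin p ⊕ Fin q → ℕ) : ℤ :=
  (if idxParity i = 0 ∧ l i ≠ 0 then 0 else 1) *
    ∏ j, if basisRank j < basisRank i then swapSign i j ^ l j else 1

theorem insSign_add_single {i j : Fin p ⊕ Fin q} (hij : i ≠ j) (l : Fin p ⊕ Fin q → ℕ) :
    insSign i (l + Pi.single j 1)
      = insSign i l * if basisRank j < basisRank i then swapSign i j else 1 := by
  have h : ∀ k, (if basisRank k < basisRank i then
        swapSign i k ^ (l + Pi.single j 1 : Fin p ⊕ Fin q → ℕ) k else 1)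
      = (if basisRank k < basisRank i then swapSign i k ^ l k else 1) *
        if k = j then (if basisRank j < basisRank i then swapSign i j else 1) else 1 := fun k => by
    by_cases hk : k = j
    · subst hk
      by_cases hr : basisRank k < basisRank i <;> simp [hr, pow_succ]
    · simp [hk]
  unfold insSign
  rw [Finset.prod_congr rfl fun k _ => h k, Finset.prod_mul_distrib, Finset.prod_ite_eq',
    if_pos (Finset.mem_univ _), mul_assoc]
  simp [hij]

theorem insSign_anti {i j : Fin p ⊕ Fin q} (hij : i ≠ j) (l : Fin p ⊕ Fin q → ℕ) :
    insSign i (l + Pi.single j 1) * insSign j l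
      = swapSign i j * (insSign j (l + Pi.single i 1) * insSign i l) := by
  rw [insSign_add_single hij, insSign_add_single hij.symm, swapSign_comm j i]
  have h := swapSign_mul_self i j
  rcases lt_or_gt_of_ne (basisRank_injective.ne hij) with hr | hr
  · rw [if_neg hr.not_gt, if_pos hr]
    linear_combination (-(insSign i l * insSign j l)) * h
  · rw [if_neg hr.not_gt, if_pos hr]
    ring

theorem insSign_self {i : Fin p ⊕ Fin q} (hi : idxParity i = 0) (l : Fin p ⊕ Fin q → ℕ) :
    insSign i (l + Pi.single i 1) = 0 := by
  simp [insSign, hi]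

/-- The exponents of the monomials that form a basis of the exterior algebra: even basis vectors
occur at most once. -/
def IsReducedExp (l : Fin p ⊕ Fin q → ℕ) : Prop := ∀ i, idxParity i = 0 → l i ≤ 1

theorem IsReducedExp.add_single {l : Fin p ⊕ Fin q → ℕ} (hl : IsReducedExp l) {i : Fin p ⊕ Fin q}
    (hi : insSign i l ≠ 0) : IsReducedExp (l + Pi.single i 1) := fun j hj => by
  by_cases hij : j = i
  · subst hij
    have : l j = 0 := by
      by_contra h0
      exact hi (by simp [insSign, hj, h0])
    simp [this]
  · simpa [hij] using hl j hj

theorem sum_add_single (l : Fin p ⊕ Fin q → ℕ) (i : Fin p ⊕ Fin q) :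
    ∑ j, (l + Pi.single i 1 : Fin p ⊕ Fin q → ℕ) j = ∑ j, l j + 1 := by
  simp [Finset.sum_add_distrib]

/-- A reduced monomial is the product of its first basis vector and a shorter reduced monomial. -/
theorem IsReducedExp.exists_first {l : Fin p ⊕ Fin q → ℕ} (hl : IsReducedExp l) {k : ℕ}
    (hk : ∑ i, l i = k + 1) : ∃ i l', IsReducedExp l' ∧ ∑ i, l' i = k ∧ l = l' + Pi.single i 1 ∧
      insSign i l' = 1 := by
  classical
  have hne : (Finset.univ.filter fun i => l i ≠ 0).Nonempty := by
    by_contra h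
    rw [Finset.not_nonempty_iff_eq_empty, Finset.filter_eq_empty_iff] at h
    have : ∑ i, l i = 0 := Finset.sum_eq_zero fun i _ => by simpa using h (Finset.mem_univ i)
    omega
  obtain ⟨i, hi, hmin⟩ := Finset.exists_min_image _ basisRank hne
  have hi0 : l i ≠ 0 := (Finset.mem_filter.1 hi).2
  have e : l = Function.update l i (l i - 1) + Pi.single i 1 := by
    funext j
    by_cases hj : j = i
    · subst hj
      simp
      omega
    · simp [hj]
  refine ⟨i, Function.update l i (l i - 1), ?_, ?_, e, ?_⟩
  · intro j hj
    by_cases hji : j = i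
    · subst hji
      have := hl j hj
      simp
      omega
    · simpa [hji] using hl j hj
  · have := sum_add_single (Function.update l i (l i - 1)) i
    rw [← e] at this
    omega
  · have h1 : (if idxParity i = 0 ∧ Function.update l i (l i - 1) i ≠ 0 then (0 : ℤ) else 1) = 1 := by
      refine if_neg ?_
      rintro ⟨h0, h1⟩
      have := hl i h0
      rw [Function.update_self] at h1
      omega
    rw [insSign, h1, one_mul]
    refine Finset.prod_eq_one fun j _ => ?_
    split_ifs with hr
    · have hji : j ≠ i := fun h => by simp [h] at hr
      have : l j = 0 := by
        by_contra h0
        exact absurd (hmin j (Finset.mem_filter.2 ⟨Finset.mem_univ _, h0⟩)) (not_le.2 hr)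
      rw [Function.update_of_ne hji, this, pow_zero]
    · rfl

/-- Moving a factor to its place in an ordered product of powers of elements that commute up to
signs. -/
theorem mul_prod_pow_of_skewCommute {A : Type*} [Ring A] {n : ℕ} (g : Fin n → A)
    (κ : Fin n → Fin n → ℤ) (h : ∀ i j, g i * g j = κ i j • (g j * g i)) (l : Fin n → ℕ)
    (i : Fin n) :
    g i * (List.ofFn fun m => g m ^ l m).prod = (∏ j, if j < i then κ i j ^ l j else 1) •
      (List.ofFn fun m => g m ^ (l + Pi.single i 1 : Fin n → ℕ) m).prod := by
  induction n with
  | zero => exact i.elim0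
  | succ n ih =>
    rw [List.ofFn_succ, List.ofFn_succ, List.prod_cons, List.prod_cons]
    refine Fin.cases ?_ (fun i' => ?_) i
    · simp [pow_succ', mul_assoc]
    · have hpow : ∀ e : ℕ, g i'.succ * g 0 ^ e = κ i'.succ 0 ^ e • (g 0 ^ e * g i'.succ) := by
        intro e
        induction e with
        | zero => simp
        | succ e ihe =>
          rw [pow_succ, ← mul_assoc, ihe, smul_mul_assoc, mul_assoc, h, mul_smul_comm, smul_smul,
            ← pow_succ, mul_assoc]
      have hs : (fun m : Fin n => g m.succ ^
            (l + Pi.single i'.succ 1 : Fin (n + 1) → ℕ) m.succ)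
          = fun m => (g ∘ Fin.succ) m ^ (l ∘ Fin.succ + Pi.single i' 1 : Fin n → ℕ) m := by
        funext m
        simp [Pi.single_apply]
      rw [← mul_assoc, hpow, smul_mul_assoc, mul_assoc, hs, Fin.prod_univ_succ]
      have := ih (g ∘ Fin.succ) (fun a b => κ a.succ b.succ) (fun a b => h _ _) (l ∘ Fin.succ) i'
      simp only [Function.comp_apply] at this ⊢
      rw [this, mul_smul_comm, smul_smul]
      simp [Fin.succ_lt_succ_iff]

/-- The monomial `e^l`, with the factors ordered by position. -/
def orderedMonomial {A : Type*} [Ring A] (E : Fin p ⊕ Fin q → A) (l : Fin p ⊕ Fin q → ℕ) : A :=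
  (List.ofFn fun m : Fin (p + q) => E (finSumFinEquiv.symm m) ^ l (finSumFinEquiv.symm m)).prod

theorem orderedMonomial_zero {A : Type*} [Ring A] (E : Fin p ⊕ Fin q → A) :
    orderedMonomial E 0 = 1 := by
  simp [orderedMonomial]

end Monomials

section ExtBasis

variable {R : Type*} [Ring R] {𝒜 : ZMod 2 → AddSubgroup R} {p q : ℕ} [GradedRing 𝒜]
  [IsSupercommutative 𝒜]

theorem IsExtFamily.mul_orderedMonomial {A : Type*} [Ring A] {f : R →+* A}
    {E : Fin p ⊕ Fin q → A} (h : IsExtFamily 𝒜 f E) (i : Fin p ⊕ Fin q)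
    (l : Fin p ⊕ Fin q → ℕ) :
    E i * orderedMonomial E l = insSign i l • orderedMonomial E (l + Pi.single i 1) := by
  have key := mul_prod_pow_of_skewCommute (fun m : Fin (p + q) => E (finSumFinEquiv.symm m))
    (fun a b => swapSign (finSumFinEquiv.symm a) (finSumFinEquiv.symm b))
    (fun a b => by rw [h.anti, swapSign, neg_smul]) (l ∘ finSumFinEquiv.symm) (finSumFinEquiv i)
  have e1 : (l ∘ finSumFinEquiv.symm + Pi.single (finSumFinEquiv i) 1 : Fin (p + q) → ℕ)
      = fun m => (l + Pi.single i 1 : Fin p ⊕ Fin q → ℕ) (finSumFinEquiv.symm m) := by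
    funext m
    simp [Pi.single_apply, Equiv.symm_apply_eq]
  have e2 : (∏ j : Fin (p + q), if j < finSumFinEquiv i then
        swapSign (finSumFinEquiv.symm (finSumFinEquiv i)) (finSumFinEquiv.symm j) ^
          (l ∘ finSumFinEquiv.symm) j else 1)
      = ∏ j, if basisRank j < basisRank i then swapSign i j ^ l j else 1 := by
    rw [← Equiv.prod_comp finSumFinEquiv]
    simp [basisRank]
  rw [e1, e2, Equiv.symm_apply_apply] at key
  change E i * orderedMonomial E l = _ • orderedMonomial E (l + Pi.single i 1) at key
  by_cases h0 : idxParity i = 0 ∧ l i ≠ 0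
  · have hz : orderedMonomial E (l + Pi.single i 1) = 0 := by
      refine List.prod_eq_zero ((List.mem_ofFn' _ _).2 ⟨finSumFinEquiv i, ?_⟩)
      obtain ⟨n, hn⟩ := Nat.exists_eq_succ_of_ne_zero h0.2
      simp [hn, pow_succ, mul_assoc, h.sq i h0.1]
    rw [key, hz, smul_zero, smul_zero]
  · rw [key, insSign, if_neg h0, one_mul]

/-- The operator by which the basis vector `eᵢ` acts on combinations of monomials, with coefficients
on the left: moving `eᵢ` past a coefficient twists the coefficient by a sign. -/
noncomputable def modelVector (𝒜 : ZMod 2 → AddSubgroup R) [GradedRing 𝒜] (i : Fin p ⊕ Fin q) :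
    AddMonoid.End ((Fin p ⊕ Fin q → ℕ) →₀ R) :=
  Finsupp.liftAddHom fun l => (Finsupp.singleAddHom (l + Pi.single i 1)).comp
    (insSign i l • parityTwistAdd 𝒜 (idxParity i))

theorem modelVector_single (i : Fin p ⊕ Fin q) (l : Fin p ⊕ Fin q → ℕ) (x : R) :
    modelVector 𝒜 i (Finsupp.single l x)
      = Finsupp.single (l + Pi.single i 1) (insSign i l • parityTwist 𝒜 (idxParity i) x) := by
  refine (Finsupp.liftAddHom_apply_single _ _ _).trans ?_
  rfl

theorem parityTwist_comm (i j : ZMod 2) (x : R) :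
    parityTwist 𝒜 i (parityTwist 𝒜 j x) = parityTwist 𝒜 j (parityTwist 𝒜 i x) := by
  refine DFunLike.congr_fun (addHom_ext_homogeneous 𝒜
    (f := ((parityTwist 𝒜 i).comp (parityTwist 𝒜 j)).toAddMonoidHom)
    (g := ((parityTwist 𝒜 j).comp (parityTwist 𝒜 i)).toAddMonoidHom) fun k r hr => ?_) x
  change parityTwist 𝒜 i (parityTwist 𝒜 j r) = parityTwist 𝒜 j (parityTwist 𝒜 i r)
  rw [parityTwist_of_mem 𝒜 j hr, parityTwist_of_mem 𝒜 i hr, map_zsmul, map_zsmul,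
    parityTwist_of_mem 𝒜 j hr, parityTwist_of_mem 𝒜 i hr, smul_comm]

/-- The exterior algebra acts on the combinations of monomials; this shows that the monomials of
reduced exponents are linearly independent. -/
theorem isExtFamily_model : IsExtFamily 𝒜
    (Module.toAddMonoidEnd R ((Fin p ⊕ Fin q → ℕ) →₀ R)) (modelVector 𝒜) where
  comm i r := by
    refine Finsupp.addHom_ext fun l x => ?_
    change modelVector 𝒜 i (r • Finsupp.single l x)
      = parityTwist 𝒜 (idxParity i) r • modelVector 𝒜 i (Finsupp.single l x)
    rw [Finsupp.smul_single, modelVector_single, modelVector_single, Finsupp.smul_single,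
      smul_eq_mul, smul_eq_mul, map_mul, mul_smul_comm]
  anti i j := by
    refine Finsupp.addHom_ext fun l x => ?_
    change modelVector 𝒜 i (modelVector 𝒜 j (Finsupp.single l x))
      = -(paritySign (idxParity i * idxParity j) •
        modelVector 𝒜 j (modelVector 𝒜 i (Finsupp.single l x)))
    rw [← neg_smul]
    change _ = swapSign i j • _
    simp only [modelVector_single, map_zsmul, smul_smul]
    by_cases hij : i = j
    · subst hij
      rcases parity_cases (idxParity i) with hi | hi
      · simp [insSign_self hi]
      · simp [swapSign, hi, paritySign]
    · rw [insSign_anti hij, Finsupp.smul_single, parityTwist_comm, add_right_comm, smul_smul]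
  sq i hi := by
    refine Finsupp.addHom_ext fun l x => ?_
    change modelVector 𝒜 i (modelVector 𝒜 i (Finsupp.single l x)) = 0
    rw [modelVector_single, modelVector_single, insSign_self hi, zero_smul, Finsupp.single_zero]

variable (𝒜 p q) in
/-- The basis vectors in `Λ(V)`. -/
noncomputable def extBasisVector (i : Fin p ⊕ Fin q) : ExtAlg 𝒜 p q :=
  extVector 𝒜 p q (Pi.single i 1)

theorem single_mem_spaceGrading (i : Fin p ⊕ Fin q) {n : ZMod 2} {r : R} (hr : r ∈ 𝒜 n) :
    Pi.single i r ∈ spaceGrading 𝒜 p q (n + idxParity i) := fun j => by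
  by_cases h : j = i
  · subst h
    rw [Pi.single_eq_same, add_assoc, CharTwo.add_self_eq_zero, add_zero]
    exact hr
  · rw [Pi.single_eq_of_ne h]
    exact (𝒜 _).zero_mem

theorem single_one_mem_spaceGrading (i : Fin p ⊕ Fin q) :
    Pi.single i 1 ∈ spaceGrading 𝒜 p q (idxParity i) := by
  have := single_mem_spaceGrading (𝒜 := 𝒜) i (SetLike.GradedOne.one_mem (A := 𝒜))
  rwa [zero_add] at this

theorem isExtFamily_ext :
    IsExtFamily 𝒜 (extScalar 𝒜 p q) (extBasisVector 𝒜 p q) where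
  comm i r := by
    refine DFunLike.congr_fun (addHom_ext_homogeneous 𝒜
      (f := (AddMonoidHom.mulLeft (extBasisVector 𝒜 p q i)).comp
        (extScalar 𝒜 p q).toAddMonoidHom)
      (g := ((AddMonoidHom.mulRight (extBasisVector 𝒜 p q i)).comp
        (extScalar 𝒜 p q).toAddMonoidHom).comp (parityTwist 𝒜 (idxParity i)).toAddMonoidHom)
      fun k r hr => ?_) r
    change extBasisVector 𝒜 p q i * extScalar 𝒜 p q r
      = extScalar 𝒜 p q (parityTwist 𝒜 (idxParity i) r) * extBasisVector 𝒜 p q i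
    rw [parityTwist_of_mem 𝒜 _ hr, map_zsmul, smul_mul_assoc]
    have := extMk_rel 𝒜 p q
      (ExtRel.comm _ _ _ r (single_one_mem_spaceGrading (𝒜 := 𝒜) i) hr)
    rwa [map_zsmul, map_mul, map_mul] at this
  anti i j := by
    have := extMk_rel 𝒜 p q (ExtRel.wedge _ _ _ _ (single_one_mem_spaceGrading (𝒜 := 𝒜) i)
      (single_one_mem_spaceGrading (𝒜 := 𝒜) j))
    rw [map_add, map_zsmul, map_mul, map_mul, map_zero] at this
    exact eq_neg_of_add_eq_zero_left this
  sq i hi := by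
    have := extMk_rel 𝒜 p q (ExtRel.sq _ (hi ▸ single_one_mem_spaceGrading (𝒜 := 𝒜) i))
    rwa [map_mul, map_zero] at this

theorem extVector_add (v u : SuperSpace R p q) :
    extVector 𝒜 p q (v + u) = extVector 𝒜 p q v + extVector 𝒜 p q u := by
  have h : genVector p q (v + u) = genVector p q v + genVector p q u := by
    unfold genVector
    rw [← map_add, Prod.mk_add_mk, add_zero]
  rw [extVector, h, map_add]
  rfl

theorem extVector_eq_liftVector (v : SuperSpace R p q) :
    extVector 𝒜 p q v = liftVector (extScalar 𝒜 p q) (extBasisVector 𝒜 p q) v := by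
  have h0 : v = ∑ i, Pi.single i (v i) := (Finset.univ_sum_single v).symm
  have h1 := map_sum (AddMonoidHom.mk' (extVector 𝒜 p q) extVector_add)
    (fun i => Pi.single i (v i)) Finset.univ
  rw [← h0] at h1
  refine h1.trans (Finset.sum_congr rfl fun i _ => ?_)
  have h2 := extMk_rel 𝒜 p q (ExtRel.smul (Pi.single i 1) (v i))
  rw [map_mul] at h2
  refine Eq.trans ?_ h2
  change extVector 𝒜 p q _ = extVector 𝒜 p q _
  congr 1
  funext j
  by_cases hj : j = i
  · subst hj
    simp
  · simp [hj]

variable (𝒜 p q) in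
/-- The standard monomial `e^l` in `Λ(V)`. -/
noncomputable def extMonomial (l : Fin p ⊕ Fin q → ℕ) : ExtAlg 𝒜 p q :=
  orderedMonomial (extBasisVector 𝒜 p q) l

variable (𝒜 p q) in
/-- The coordinates of an element of `Λ(V)` with respect to the standard monomials, read off from its
action on the vacuum of the model. -/
noncomputable def extCoord : ExtAlg 𝒜 p q →ₗ[R] (Fin p ⊕ Fin q → ℕ) →₀ R where
  toFun x := extLift (isExtFamily_model (𝒜 := 𝒜)) x (Finsupp.single 0 1)
  map_add' x y := by
    rw [map_add]
    rfl
  map_smul' r x := by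
    rw [ext_smul_def, map_mul, extLift_extScalar]
    rfl

theorem extCoord_vector_mul (v : SuperSpace R p q) (x : ExtAlg 𝒜 p q) :
    extCoord 𝒜 p q (extVector 𝒜 p q v * x)
      = ∑ i, modelVector 𝒜 i (v i • extCoord 𝒜 p q x) := by
  change extLift (isExtFamily_model (𝒜 := 𝒜)) (extVector 𝒜 p q v * x) (Finsupp.single 0 1) = _
  rw [map_mul, extLift_extVector]
  change (∑ i, _ : AddMonoid.End ((Fin p ⊕ Fin q → ℕ) →₀ R)) _ = _
  exact AddMonoidHom.finsetSum_apply _ _ _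

theorem extCoord_one : extCoord 𝒜 p q 1 = Finsupp.single 0 1 := by
  change extLift (isExtFamily_model (𝒜 := 𝒜)) 1 (Finsupp.single 0 1) = _
  rw [map_one]
  rfl

theorem extCoord_basisVector_mul (i : Fin p ⊕ Fin q) (x : ExtAlg 𝒜 p q) :
    extCoord 𝒜 p q (extBasisVector 𝒜 p q i * x) = modelVector 𝒜 i (extCoord 𝒜 p q x) := by
  rw [extBasisVector, extCoord_vector_mul, Finset.sum_eq_single i]
  · simp
  · intro j _ hj
    simp [hj]
  · intro h
    exact absurd (Finset.mem_univ _) h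

theorem basisVector_mul_extMonomial (i : Fin p ⊕ Fin q) (l : Fin p ⊕ Fin q → ℕ) :
    extBasisVector 𝒜 p q i * extMonomial 𝒜 p q l
      = insSign i l • extMonomial 𝒜 p q (l + Pi.single i 1) :=
  isExtFamily_ext.mul_orderedMonomial i l

theorem extMonomial_zero : extMonomial 𝒜 p q 0 = 1 := orderedMonomial_zero _

theorem extCoord_extMonomial {l : Fin p ⊕ Fin q → ℕ} (hl : IsReducedExp l) :
    extCoord 𝒜 p q (extMonomial 𝒜 p q l) = Finsupp.single l 1 := by
  obtain ⟨k, hk⟩ : ∃ k, ∑ i, l i = k := ⟨_, rfl⟩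
  induction k generalizing l with
  | zero =>
    have : l = 0 := by
      funext i
      exact (Finset.sum_eq_zero_iff.1 hk) i (Finset.mem_univ i)
    rw [this, extMonomial_zero, extCoord_one]
  | succ k ih =>
    obtain ⟨i, l', hl', hk', rfl, hs⟩ := hl.exists_first hk
    have h := basisVector_mul_extMonomial (𝒜 := 𝒜) i l'
    rw [hs, one_smul] at h
    rw [← h, extCoord_basisVector_mul, ih hl' hk', modelVector_single, hs, one_smul, map_one]

theorem wedgeProd_zero (w : Fin 0 → SuperSpace R p q) : wedgeProd 𝒜 p q w = 1 := by
  simp [wedgeProd]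

theorem wedgeProd_succ {k : ℕ} (w : Fin (k + 1) → SuperSpace R p q) :
    wedgeProd 𝒜 p q w = extVector 𝒜 p q (w 0) * wedgeProd 𝒜 p q fun i => w i.succ := by
  simp [wedgeProd, List.ofFn_succ]

/-- A reduced monomial is a wedge product of basis vectors. -/
theorem extMonomial_eq_wedgeProd {l : Fin p ⊕ Fin q → ℕ} (hl : IsReducedExp l) {k : ℕ}
    (hk : ∑ i, l i = k) : ∃ v : Fin k → Fin p ⊕ Fin q, (∀ i, l i = ∑ m, if v m = i then 1 else 0) ∧
      extMonomial 𝒜 p q l = wedgeProd 𝒜 p q fun m => Pi.single (v m) 1 := by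
  induction k generalizing l with
  | zero =>
    have : l = 0 := by
      funext i
      exact (Finset.sum_eq_zero_iff.1 hk) i (Finset.mem_univ i)
    refine ⟨Fin.elim0, fun i => by simp [this], ?_⟩
    rw [this, extMonomial_zero, wedgeProd_zero]
  | succ k ih =>
    obtain ⟨i, l', hl', hk', rfl, hs⟩ := hl.exists_first hk
    obtain ⟨v, hv, hw⟩ := ih hl' hk'
    have h := basisVector_mul_extMonomial (𝒜 := 𝒜) i l'
    rw [hs, one_smul] at h
    refine ⟨Fin.cons i v, fun j => ?_, ?_⟩
    · rw [Fin.sum_univ_succ, Pi.add_apply, hv j, add_comm]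
      simp [Pi.single_apply, eq_comm]
    · rw [← h, hw, wedgeProd_succ]
      rfl

/-- The exponents of the standard basis of `Λᵏ(V)`. -/
noncomputable def reducedExps (p q k : ℕ) : Finset (Fin p ⊕ Fin q → ℕ) :=
  open Classical in (Finset.piAntidiag Finset.univ k).filter IsReducedExp

theorem mem_reducedExps {k : ℕ} {l : Fin p ⊕ Fin q → ℕ} :
    l ∈ reducedExps p q k ↔ ∑ i, l i = k ∧ IsReducedExp l := by
  simp [reducedExps]

theorem extVector_mul_mem_span (k : ℕ) (v : SuperSpace R p q) {x : ExtAlg 𝒜 p q}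
    (hx : x ∈ Submodule.span R (extMonomial 𝒜 p q '' (reducedExps p q k))) :
    extVector 𝒜 p q v * x
      ∈ Submodule.span R (extMonomial 𝒜 p q '' (reducedExps p q (k + 1))) := by
  induction hx using Submodule.span_induction generalizing v with
  | zero =>
    rw [mul_zero]
    exact Submodule.zero_mem _
  | add x y _ _ hx hy =>
    rw [mul_add]
    exact Submodule.add_mem _ (hx v) (hy v)
  | smul r x _ hx =>
    rw [ext_smul_def, ← mul_assoc]
    have e : extVector 𝒜 p q v * extScalar 𝒜 p q r = extVector 𝒜 p q fun i => v i * r := by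
      rw [extVector_eq_liftVector, extVector_eq_liftVector]
      simp only [liftVector, Finset.sum_mul, mul_assoc, map_mul]
    rw [e]
    exact hx _
  | mem x hx =>
    obtain ⟨l, hl, rfl⟩ := hx
    rw [extVector_eq_liftVector, liftVector, Finset.sum_mul]
    refine Submodule.sum_mem _ fun i _ => ?_
    rw [isExtFamily_ext.comm, mul_assoc, basisVector_mul_extMonomial, ← ext_smul_def]
    refine Submodule.smul_mem _ _ ?_
    obtain ⟨h1, h2⟩ := mem_reducedExps.1 hl
    by_cases h0 : insSign i l = 0
    · rw [h0, zero_smul]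
      exact Submodule.zero_mem _
    · refine Submodule.smul_of_tower_mem _ _ (Submodule.subset_span ⟨_, ?_, rfl⟩)
      exact mem_reducedExps.2 ⟨by rw [sum_add_single, h1], h2.add_single h0⟩

theorem extPow_eq_span (k : ℕ) :
    extPow 𝒜 p q k = Submodule.span R (extMonomial 𝒜 p q '' (reducedExps p q k)) := by
  refine le_antisymm (Submodule.span_le.2 ?_) (Submodule.span_le.2 ?_)
  · rintro _ ⟨v, rfl⟩
    change wedgeProd 𝒜 p q v ∈ _
    induction k with
    | zero =>
      refine Submodule.subset_span ⟨0, mem_reducedExps.2 ⟨by simp, fun i _ => by simp⟩, ?_⟩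
      rw [extMonomial_zero, wedgeProd_zero]
    | succ k ih =>
      rw [wedgeProd_succ]
      exact extVector_mul_mem_span k _ (ih _)
  · rintro _ ⟨l, hl, rfl⟩
    obtain ⟨h1, h2⟩ := mem_reducedExps.1 hl
    obtain ⟨v, _, hv⟩ := extMonomial_eq_wedgeProd (𝒜 := 𝒜) h2 h1
    exact Submodule.subset_span ⟨_, hv.symm⟩

variable (𝒜 p q) in
/-- The standard monomial `e^l` of degree `k`, as an element of `Λᵏ(V)`. -/
noncomputable def extPowMonomial (k : ℕ) (l : reducedExps p q k) : extPow 𝒜 p q k :=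
  ⟨extMonomial 𝒜 p q l, by
    rw [extPow_eq_span]
    exact Submodule.subset_span ⟨l, l.2, rfl⟩⟩

theorem extCoord_extPowMonomial (k : ℕ) (l : reducedExps p q k) :
    extCoord 𝒜 p q (extPowMonomial 𝒜 p q k l) = Finsupp.single (l : Fin p ⊕ Fin q → ℕ) 1 :=
  extCoord_extMonomial (mem_reducedExps.1 l.2).2

variable (𝒜 p q) in
/-- The standard monomials form a basis of `Λᵏ(V)`. -/
noncomputable def extPowBasis (k : ℕ) : Module.Basis (reducedExps p q k) R (extPow 𝒜 p q k) :=
  Module.Basis.mk (v := extPowMonomial 𝒜 p q k)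
    (by
      refine LinearIndependent.of_comp ((extCoord 𝒜 p q).comp (extPow 𝒜 p q k).subtype) ?_
      have e : ((extCoord 𝒜 p q).comp (extPow 𝒜 p q k).subtype) ∘ extPowMonomial 𝒜 p q k
          = fun l : reducedExps p q k =>
            Finsupp.single (l : Fin p ⊕ Fin q → ℕ) (1 : R) := by
        funext l
        exact extCoord_extPowMonomial k l
      rw [e]
      exact (Finsupp.linearIndependent_single_one R _).comp
        (Subtype.val : reducedExps p q k → _) Subtype.val_injective)
    (by
      rw [← Submodule.map_le_map_iff_of_injective (extPow 𝒜 p q k).subtype_injective,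
        Submodule.map_top, Submodule.range_subtype, Submodule.map_span, ← Set.range_comp]
      refine (extPow_eq_span k).le.trans (Submodule.span_mono ?_)
      rintro _ ⟨l, hl, rfl⟩
      exact ⟨⟨l, hl⟩, rfl⟩)

theorem extPowBasis_apply (k : ℕ) (l : reducedExps p q k) :
    extPowBasis 𝒜 p q k l = extPowMonomial 𝒜 p q k l := Module.Basis.mk_apply _ _ _

theorem extPowBasis_repr (k : ℕ) (x : extPow 𝒜 p q k) (l : reducedExps p q k) :
    (extPowBasis 𝒜 p q k).repr x l = extCoord 𝒜 p q x l := by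
  have h := congrArg (fun y : extPow 𝒜 p q k => extCoord 𝒜 p q y l)
    ((extPowBasis 𝒜 p q k).sum_repr x)
  rw [← h]
  change _ = ((extCoord 𝒜 p q).comp (extPow 𝒜 p q k).subtype)
    (∑ i, (extPowBasis 𝒜 p q k).repr x i • extPowBasis 𝒜 p q k i) l
  rw [map_sum, Finsupp.finsetSum_apply, Finset.sum_eq_single l]
  · rw [map_smul, extPowBasis_apply]
    change _ = ((extPowBasis 𝒜 p q k).repr x l • extCoord 𝒜 p q (extPowMonomial 𝒜 p q k l)) l
    rw [extCoord_extPowMonomial]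
    simp
  · intro b _ hb
    rw [map_smul, extPowBasis_apply]
    change ((extPowBasis 𝒜 p q k).repr x b • extCoord 𝒜 p q (extPowMonomial 𝒜 p q k b)) l = 0
    rw [extCoord_extPowMonomial]
    simp [Subtype.coe_ne_coe.2 hb]
  · intro h
    exact absurd (Finset.mem_univ _) h

end ExtBasis

/-! ### Supertraces -/

section SuperTrace

variable {R : Type*} [Ring R] {𝒜 : ZMod 2 → AddSubgroup R} [GradedRing 𝒜] [IsSupercommutative 𝒜]

/-- The supertraces of `F G` and `G F` agree for even `F` and `G`. -/
theorem sum_mul_even_comm {ι κ : Type*} [Fintype ι] [Fintype κ] (a : ι → ZMod 2) (b : κ → ZMod 2)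
    (F : ι → κ → R) (G : κ → ι → R) (hF : ∀ i k, F i k ∈ 𝒜 (a i + b k))
    (hG : ∀ k i, G k i ∈ 𝒜 (b k + a i)) :
    ∑ i, paritySign (a i) • ∑ k, F i k * G k i = ∑ k, paritySign (b k) • ∑ i, G k i * F i k := by
  simp only [Finset.smul_sum]
  rw [Finset.sum_comm]
  refine Finset.sum_congr rfl fun k _ => Finset.sum_congr rfl fun i _ => ?_
  rw [IsSupercommutative.comm _ _ _ _ (hF i k) (hG k i), smul_smul]
  congr 1
  generalize a i = x
  generalize b k = y
  revert x y
  decide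

theorem parity_add_one_ne (m : ZMod 2) : m + 1 ≠ m := by
  revert m; decide

theorem parity_eq_or (i m : ZMod 2) : i = m ∨ i = m + 1 := by
  revert i m; decide

theorem eq_zero_of_mem_of_mem {r : R} {m : ZMod 2} (h : r ∈ 𝒜 m) (h' : r ∈ 𝒜 (m + 1)) : r = 0 := by
  rw [← DirectSum.decompose_of_mem_same 𝒜 h, DirectSum.decompose_of_mem_ne 𝒜 h' (parity_add_one_ne m)]

theorem decompose_add_decompose (r : R) (m : ZMod 2) :
    (DirectSum.decompose 𝒜 r m : R) + (DirectSum.decompose 𝒜 r (m + 1) : R) = r := by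
  induction r using DirectSum.Decomposition.inductionOn 𝒜 with
  | zero => simp
  | add r s hr hs =>
    rw [DirectSum.decompose_add, DirectSum.add_apply, DirectSum.add_apply, AddSubgroup.coe_add,
      AddSubgroup.coe_add, add_add_add_comm, hr, hs]
  | @homogeneous i r =>
    rcases parity_eq_or i m with rfl | rfl
    · rw [DirectSum.decompose_of_mem_same 𝒜 r.2, DirectSum.decompose_of_mem_ne 𝒜 r.2 
        (parity_add_one_ne i).symm, add_zero]
    · rw [DirectSum.decompose_of_mem_same 𝒜 r.2, DirectSum.decompose_of_mem_ne 𝒜 r.2 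
        (parity_add_one_ne m), zero_add]

theorem repr_map_eq_sum {M N ι κ : Type*} [AddCommGroup M] [Module R M] [AddCommGroup N]
    [Module R N] [Fintype ι] (b : Module.Basis ι R M) (c : Module.Basis κ R N) (f : M →ₗ[R] N)
    (x : M) (k : κ) : c.repr (f x) k = ∑ i, b.repr x i * c.repr (f (b i)) k := by
  have h := congrArg (fun y => c.repr (f y) k) (b.sum_repr x)
  rw [← h, map_sum, map_sum, Finsupp.finsetSum_apply]
  simp only [map_smul, Finsupp.smul_apply, smul_eq_mul]

section

variable {M : Type*} [AddCommGroup M] [Module R M] {ℳ : ZMod 2 → AddSubgroup M} {ι : Type*}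
  [Fintype ι] (b : Module.Basis ι R M) (a : ι → ZMod 2)
  (hℳ : ∀ n x, x ∈ ℳ n ↔ ∀ i, b.repr x i ∈ 𝒜 (n + a i))
include hℳ

theorem basis_mem_grading (i : ι) : b i ∈ ℳ (a i) := by
  classical
  rw [hℳ]
  intro j
  rw [b.repr_self, Finsupp.single_apply]
  split_ifs with h
  · subst h
    rw [CharTwo.add_self_eq_zero]
    exact SetLike.GradedOne.one_mem
  · exact (𝒜 _).zero_mem

theorem smul_mem_grading {m n : ZMod 2} {r : R} {x : M} (hr : r ∈ 𝒜 m) (hx : x ∈ ℳ n) :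
    r • x ∈ ℳ (m + n) := by
  rw [hℳ] at hx ⊢
  intro i
  rw [map_smul, Finsupp.smul_apply, smul_eq_mul, add_assoc]
  exact SetLike.GradedMul.mul_mem hr (hx i)

/-- With respect to any homogeneous basis, the coordinates of a homogeneous vector are homogeneous:
the sum of the terms of the wrong parity lies in both parts of the grading. -/
theorem repr_mem_of_mem_grading (B : HomogeneousBasis (R := R) ℳ) {n : ZMod 2} {x : M}
    (hx : x ∈ ℳ n) (i : Fin B.size) : B.basis.repr x i ∈ 𝒜 (n + B.parity i) := by
  set good : Fin B.size → R := fun i =>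
    (DirectSum.decompose 𝒜 (B.basis.repr x i) (n + B.parity i) : R) with hg
  set bad : Fin B.size → R := fun i =>
    (DirectSum.decompose 𝒜 (B.basis.repr x i) (n + B.parity i + 1) : R) with hb
  have hgb : ∀ i, good i + bad i = B.basis.repr x i := fun i => decompose_add_decompose _ _
  have hsum : ∑ i, good i • B.basis i + ∑ i, bad i • B.basis i = x := by
    rw [← Finset.sum_add_distrib]
    simp only [← add_smul, hgb]
    exact B.basis.sum_repr x
  have hgood : ∑ i, good i • B.basis i ∈ ℳ n := (ℳ n).sum_mem fun i _ => by
    have := smul_mem_grading b a hℳ (DirectSum.decompose 𝒜 (B.basis.repr x i) (n + B.parity i)).2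
      (B.mem i)
    rwa [add_assoc, CharTwo.add_self_eq_zero, add_zero] at this
  have hbad : ∑ i, bad i • B.basis i ∈ ℳ (n + 1) := (ℳ (n + 1)).sum_mem fun i _ => by
    have := smul_mem_grading b a hℳ
      (DirectSum.decompose 𝒜 (B.basis.repr x i) (n + B.parity i + 1)).2 (B.mem i)
    rwa [add_right_comm, add_assoc n, CharTwo.add_self_eq_zero, add_zero] at this
  have hbad' : ∑ i, bad i • B.basis i ∈ ℳ n := by
    rw [← eq_sub_iff_add_eq'] at hsum
    rw [hsum]
    exact (ℳ n).sub_mem hx hgood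
  have h0 : ∑ i, bad i • B.basis i = 0 := by
    apply b.repr.injective
    rw [map_zero]
    ext j
    refine eq_zero_of_mem_of_mem ((hℳ _ _).1 hbad' j) ?_
    rw [add_right_comm]
    exact (hℳ _ _).1 hbad j
  have hi : bad i = 0 := by
    have := congrArg (fun y => B.basis.repr y i) h0
    rwa [B.basis.repr_sum_self, map_zero, Finsupp.zero_apply] at this
  rw [← hgb i, hi, add_zero]
  exact (DirectSum.decompose 𝒜 _ _).2

/-- The supertrace may be computed in any homogeneous basis. -/
theorem superTrace_eq (f : M →ₗ[R] M) (hf : ∀ n, ∀ x ∈ ℳ n, f x ∈ ℳ n) :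
    (superTrace 𝒜 ℳ f : R) = ∑ i, paritySign (a i) • b.repr (f (b i)) i := by
  have hne : Nonempty (HomogeneousBasis (R := R) ℳ) :=
    ⟨⟨Fintype.card ι, fun m => a ((Fintype.equivFin ι).symm m), b.reindex (Fintype.equivFin ι),
      fun m => by
        rw [Module.Basis.reindex_apply]
        exact basis_mem_grading b a hℳ _⟩⟩
  rw [superTrace, dif_pos hne]
  set B := hne.some with hB
  have e1 : ((∑ i, paritySign (B.parity i) •
      (DirectSum.decompose 𝒜 (B.basis.repr (f (B.basis i)) i) 0 : 𝒜 0) : 𝒜 0) : R)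
      = ∑ i, paritySign (B.parity i) • B.basis.repr (f (B.basis i)) i := by
    rw [← evenIncl_apply, map_sum]
    refine Finset.sum_congr rfl fun i _ => ?_
    rw [map_zsmul, evenIncl_apply, DirectSum.decompose_of_mem_same 𝒜]
    have := repr_mem_of_mem_grading b a hℳ B (hf _ _ (B.mem i)) i
    rwa [CharTwo.add_self_eq_zero] at this
  rw [e1]
  have e2 : ∀ i, B.basis.repr (f (B.basis i)) i
      = ∑ l, b.repr (B.basis i) l * B.basis.repr (f (b l)) i := fun i =>
    repr_map_eq_sum b B.basis f _ i
  have e3 : ∀ l, b.repr (f (b l)) l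
      = ∑ i, B.basis.repr (f (b l)) i * b.repr (B.basis i) l := fun l =>
    repr_map_eq_sum B.basis b LinearMap.id _ l
  simp only [e2, e3]
  exact sum_mul_even_comm _ _ _ _ (fun i l => (hℳ _ _).1 (B.mem i) l) fun l i =>
    repr_mem_of_mem_grading b a hℳ B (hf _ _ (basis_mem_grading b a hℳ l)) i

theorem superTrace_comp_comm (f g : M →ₗ[R] M) (hf : ∀ n, ∀ x ∈ ℳ n, f x ∈ ℳ n)
    (hg : ∀ n, ∀ x ∈ ℳ n, g x ∈ ℳ n) :
    superTrace 𝒜 ℳ (f ∘ₗ g) = superTrace 𝒜 ℳ (g ∘ₗ f) := by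
  apply Subtype.ext
  rw [superTrace_eq b a hℳ _ fun n x hx => hf n (g x) (hg n x hx),
    superTrace_eq b a hℳ _ fun n x hx => hg n (f x) (hf n x hx)]
  have e : ∀ (f g : M →ₗ[R] M) (i : ι), b.repr ((f ∘ₗ g) (b i)) i
      = ∑ k, b.repr (g (b i)) k * b.repr (f (b k)) i := fun f g i =>
    repr_map_eq_sum b b f _ i
  simp only [e]
  exact sum_mul_even_comm _ _ _ _
    (fun i l => (hℳ _ _).1 (hg _ _ (basis_mem_grading b a hℳ i)) l) fun l i =>
    (hℳ _ _).1 (hf _ _ (basis_mem_grading b a hℳ l)) i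

end

end SuperTrace

/-! ### Traces on exterior powers -/

section ExtTrace

variable {R : Type*} [Ring R] {𝒜 : ZMod 2 → AddSubgroup R} {p q : ℕ} [GradedRing 𝒜]
  [IsSupercommutative 𝒜]

/-- The parity of the monomial `e^l`. -/
def expParity (l : Fin p ⊕ Fin q → ℕ) : ZMod 2 := ∑ i, (l i : ZMod 2) * idxParity i

theorem expParity_add_single (l : Fin p ⊕ Fin q → ℕ) (i : Fin p ⊕ Fin q) :
    expParity (l + Pi.single i 1) = expParity l + idxParity i := by
  simp only [expParity, Pi.add_apply, Nat.cast_add, add_mul, Finset.sum_add_distrib]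
  congr 1
  rw [Finset.sum_eq_single i]
  · simp
  · intro j _ hj
    simp [hj]
  · intro h
    exact absurd (Finset.mem_univ _) h

variable (𝒜 p q) in
/-- The combinations of monomials that are homogeneous of parity `n`. -/
def coordGrading (n : ZMod 2) : AddSubgroup ((Fin p ⊕ Fin q → ℕ) →₀ R) where
  carrier := {f | ∀ l, f l ∈ 𝒜 (n + expParity l)}
  zero_mem' := fun _ => (𝒜 _).zero_mem
  add_mem' := fun ha hb l => (𝒜 _).add_mem (ha l) (hb l)
  neg_mem' := fun ha l => (𝒜 _).neg_mem (ha l)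

theorem single_mem_coordGrading {n : ZMod 2} {l : Fin p ⊕ Fin q → ℕ} {x : R}
    (hx : x ∈ 𝒜 (n + expParity l)) : Finsupp.single l x ∈ coordGrading 𝒜 p q n := fun m => by
  classical
  rw [Finsupp.single_apply]
  split_ifs with h
  · rwa [← h]
  · exact (𝒜 _).zero_mem

theorem smul_mem_coordGrading {m n : ZMod 2} {r : R} {f : (Fin p ⊕ Fin q → ℕ) →₀ R}
    (hr : r ∈ 𝒜 m) (hf : f ∈ coordGrading 𝒜 p q n) : r • f ∈ coordGrading 𝒜 p q (m + n) :=
  fun l => by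
    rw [Finsupp.smul_apply, smul_eq_mul, add_assoc]
    exact SetLike.GradedMul.mul_mem hr (hf l)

theorem modelVector_mem_coordGrading (i : Fin p ⊕ Fin q) {n : ZMod 2}
    {f : (Fin p ⊕ Fin q → ℕ) →₀ R} (hf : f ∈ coordGrading 𝒜 p q n) :
    modelVector 𝒜 i f ∈ coordGrading 𝒜 p q (n + idxParity i) := by
  rw [← f.sum_single, Finsupp.sum, map_sum]
  refine (coordGrading 𝒜 p q _).sum_mem fun l _ => ?_
  rw [modelVector_single]
  refine single_mem_coordGrading ((𝒜 _).zsmul_mem (parityTwist_mem 𝒜 _ ?_) _)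
  have e : n + idxParity i + expParity (l + Pi.single i 1) = n + expParity l := by
    have : idxParity i + idxParity i = 0 := CharTwo.add_self_eq_zero _
    rw [expParity_add_single]
    linear_combination this
  rw [e]
  exact hf l

theorem extCoord_wedgeProd_mem {k : ℕ} (c : Fin k → ZMod 2) (v : Fin k → SuperSpace R p q)
    (hv : ∀ i, v i ∈ spaceGrading 𝒜 p q (c i)) :
    extCoord 𝒜 p q (wedgeProd 𝒜 p q v) ∈ coordGrading 𝒜 p q (∑ i, c i) := by
  induction k with
  | zero =>
    rw [wedgeProd_zero, extCoord_one]
    refine single_mem_coordGrading ?_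
    simpa [expParity] using SetLike.GradedOne.one_mem (A := 𝒜)
  | succ k ih =>
    rw [wedgeProd_succ, extCoord_vector_mul]
    refine (coordGrading 𝒜 p q _).sum_mem fun j _ => ?_
    have h := modelVector_mem_coordGrading j (smul_mem_coordGrading (hv 0 j)
      (ih (fun i => c i.succ) (fun i => v i.succ) fun i => hv i.succ))
    have e : c 0 + idxParity j + ∑ i : Fin k, c i.succ + idxParity j = ∑ i, c i := by
      rw [Fin.sum_univ_succ]
      have : idxParity j + idxParity j = 0 := CharTwo.add_self_eq_zero _
      linear_combination this
    rwa [e] at h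

/-- The parity on `Λᵏ(V)` is the one for which the standard basis is homogeneous. -/
theorem mem_extPowGrading_iff {k : ℕ} {n : ZMod 2} {x : extPow 𝒜 p q k} :
    x ∈ extPowGrading 𝒜 p q k n ↔
      ∀ l : reducedExps p q k, (extPowBasis 𝒜 p q k).repr x l ∈ 𝒜 (n + expParity (l : Fin p ⊕ Fin q → ℕ)) := by
  constructor
  · intro hx l
    rw [extPowBasis_repr]
    suffices H : extCoord 𝒜 p q x ∈ coordGrading 𝒜 p q n from H l
    change (x : ExtAlg 𝒜 p q) ∈ AddSubgroup.closure _ at hx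
    generalize (x : ExtAlg 𝒜 p q) = x at hx
    induction hx using AddSubgroup.closure_induction with
    | zero =>
      rw [map_zero]
      exact (coordGrading 𝒜 p q n).zero_mem
    | add y z _ _ hy hz =>
      rw [map_add]
      exact (coordGrading 𝒜 p q n).add_mem hy hz
    | neg y _ hy =>
      rw [map_neg]
      exact (coordGrading 𝒜 p q n).neg_mem hy
    | mem y hy =>
      obtain ⟨m, c, r, v, hr, hv, rfl, rfl⟩ := hy
      rw [map_smul]
      exact smul_mem_coordGrading hr (extCoord_wedgeProd_mem c v hv)
  · intro hx
    change (x : ExtAlg 𝒜 p q) ∈ AddSubgroup.closure _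
    have e : (x : ExtAlg 𝒜 p q) = ∑ l, (extPowBasis 𝒜 p q k).repr x l •
        extMonomial 𝒜 p q (l : Fin p ⊕ Fin q → ℕ) := by
      have h := congrArg (extPow 𝒜 p q k).subtype ((extPowBasis 𝒜 p q k).sum_repr x)
      rw [map_sum] at h
      refine h.symm.trans (Finset.sum_congr rfl fun l _ => ?_)
      rw [map_smul, extPowBasis_apply]
      rfl
    rw [e]
    refine AddSubgroup.sum_mem _ fun l _ => AddSubgroup.subset_closure ?_
    obtain ⟨h1, h2⟩ := mem_reducedExps.1 l.2
    obtain ⟨v, hv, hw⟩ := extMonomial_eq_wedgeProd (𝒜 := 𝒜) h2 h1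
    refine ⟨_, fun m => idxParity (v m), _, _, hx l,
      fun m => single_one_mem_spaceGrading (v m), ?_, by rw [hw]⟩
    have : expParity (l : Fin p ⊕ Fin q → ℕ) = ∑ m, idxParity (v m) := by
      simp only [expParity, hv, Nat.cast_sum, Finset.sum_mul]
      rw [Finset.sum_comm]
      simp
    rw [this, add_assoc, CharTwo.add_self_eq_zero, add_zero]

theorem extPowMap_mem_grading (B : evenMat 𝒜 p q) (k : ℕ) (n : ZMod 2) (x : extPow 𝒜 p q k)
    (hx : x ∈ extPowGrading 𝒜 p q k n) : extPowMap B k x ∈ extPowGrading 𝒜 p q k n := by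
  change extMap B (x : ExtAlg 𝒜 p q) ∈ AddSubgroup.closure _
  change (x : ExtAlg 𝒜 p q) ∈ AddSubgroup.closure _ at hx
  generalize (x : ExtAlg 𝒜 p q) = x at hx
  induction hx using AddSubgroup.closure_induction with
  | zero =>
    rw [map_zero]
    exact AddSubgroup.zero_mem _
  | add y z _ _ hy hz =>
    rw [map_add]
    exact AddSubgroup.add_mem _ hy hz
  | neg y _ hy =>
    rw [map_neg]
    exact AddSubgroup.neg_mem _ hy
  | mem y hy =>
    obtain ⟨m, c, r, v, hr, hv, hn, rfl⟩ := hy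
    refine AddSubgroup.subset_closure
      ⟨m, c, r, fun i => B.1.mulVec (v i), hr, fun i => mulVec_mem B (hv i), hn, ?_⟩
    rw [← extMap_wedgeProd]
    exact (extMapLin B).map_smul r _

theorem coe_extPowMap (B : evenMat 𝒜 p q) (k : ℕ) (x : extPow 𝒜 p q k) :
    (extPowMap B k x : ExtAlg 𝒜 p q) = extMap B x := rfl

theorem coe_extPowMonomial (k : ℕ) (l : reducedExps p q k) :
    (extPowMonomial 𝒜 p q k l : ExtAlg 𝒜 p q) = extMonomial 𝒜 p q l := rfl

theorem extPowBasis_repr_extPowMap (B : evenMat 𝒜 p q) (k : ℕ) (l : reducedExps p q k) :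
    (extPowBasis 𝒜 p q k).repr (extPowMap B k (extPowBasis 𝒜 p q k l)) l
      = extCoord 𝒜 p q (extMap B (extMonomial 𝒜 p q l)) l := by
  rw [extPowBasis_repr, extPowBasis_apply, coe_extPowMap, coe_extPowMonomial]

/-- The supertrace of `Λᵏ(B)`, computed in the standard basis. -/
theorem superTrace_extPowMap (B : evenMat 𝒜 p q) (k : ℕ) :
    ((superTrace 𝒜 (extPowGrading 𝒜 p q k) (extPowMap B k) : 𝒜 0) : R)
      = ∑ l ∈ reducedExps p q k, paritySign (expParity l) •
        extCoord 𝒜 p q (extMap B (extMonomial 𝒜 p q l)) l := by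
  rw [superTrace_eq (extPowBasis 𝒜 p q k)
    (fun l : reducedExps p q k => expParity (l : Fin p ⊕ Fin q → ℕ))
    (fun _ _ => mem_extPowGrading_iff) (extPowMap B k) (extPowMap_mem_grading B k)]
  simp only [extPowBasis_repr_extPowMap]
  exact Finset.sum_coe_sort (reducedExps p q k) fun l => paritySign (expParity l) •
        extCoord 𝒜 p q (extMap B (extMonomial 𝒜 p q l)) l

theorem trExt_natCast' (B : evenMat 𝒜 p q) (k : ℕ) :
    trExt B (k : ℤ) = superTrace 𝒜 (extPowGrading 𝒜 p q k) (extPowMap B k) :=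
  if_pos (Int.natCast_nonneg k)

theorem trExt_natCast (B : evenMat 𝒜 p q) (k : ℕ) :
    ((trExt B (k : ℤ) : 𝒜 0) : R) = ∑ l ∈ reducedExps p q k, paritySign (expParity l) •
      extCoord 𝒜 p q (extMap B (extMonomial 𝒜 p q l)) l := by
  rw [trExt_natCast', superTrace_extPowMap]

theorem extPowMap_mul (B C : evenMat 𝒜 p q) (k : ℕ) :
    extPowMap (B * C) k = extPowMap B k ∘ₗ extPowMap C k := by
  ext x
  change extMapLin (B * C) (x : ExtAlg 𝒜 p q)
    = (extMapLin B ∘ₗ extMapLin C) (x : ExtAlg 𝒜 p q)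
  refine LinearMap.eqOn_span (s := Set.range fun v : Fin k → SuperSpace R p q =>
    wedgeProd 𝒜 p q v) ?_ x.2
  rintro _ ⟨v, rfl⟩
  change extMap (B * C) (wedgeProd 𝒜 p q v) = extMap B (extMap C (wedgeProd 𝒜 p q v))
  rw [extMap_wedgeProd, extMap_wedgeProd, extMap_wedgeProd]
  congr 1
  funext i
  exact (Matrix.mulVec_mulVec _ _ _).symm

theorem trExt_mul_comm (B C : evenMat 𝒜 p q) (k : ℤ) : trExt (B * C) k = trExt (C * B) k := by
  unfold trExt
  split_ifs
  · rw [extPowMap_mul, extPowMap_mul]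
    exact superTrace_comp_comm (extPowBasis 𝒜 p q _)
      (fun l => expParity (l : Fin p ⊕ Fin q → ℕ)) (fun n x => mem_extPowGrading_iff) _ _
      (extPowMap_mem_grading B _) (extPowMap_mem_grading C _)
  · rfl

theorem trExt_conj (U : (evenMat 𝒜 p q)ˣ) {A B : evenMat 𝒜 p q}
    (h : (U : evenMat 𝒜 p q) * A = B * U) (k : ℤ) : trExt A k = trExt B k := by
  have e1 : A = (U⁻¹ : (evenMat 𝒜 p q)ˣ) * (B * U) := by rw [← h, Units.inv_mul_cancel_left]
  rw [e1, trExt_mul_comm, Units.mul_inv_cancel_right]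

theorem trExt_of_neg (B : evenMat 𝒜 p q) {k : ℤ} (hk : k < 0) : trExt B k = 0 :=
  if_neg (not_le.2 hk)

end ExtTrace

/-! ### Traces of triangular operators -/

section Triangular

variable {R : Type*} [Ring R] {𝒜 : ZMod 2 → AddSubgroup R} {p q : ℕ} [GradedRing 𝒜]
  [IsSupercommutative 𝒜]

/-- The weight of the monomial `e^l`, for which `eᵢ` weighs its position. -/
def expWeight (l : Fin p ⊕ Fin q → ℕ) : ℕ := ∑ i, l i * basisRank i

theorem expWeight_add_single (l : Fin p ⊕ Fin q → ℕ) (i : Fin p ⊕ Fin q) :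
    expWeight (l + Pi.single i 1) = expWeight l + basisRank i := by
  simp only [expWeight, Pi.add_apply, add_mul, Finset.sum_add_distrib]
  congr 1
  rw [Finset.sum_eq_single i]
  · simp
  · intro j _ hj
    simp [hj]
  · intro h
    exact absurd (Finset.mem_univ _) h

variable (R p q) in
/-- The combinations of monomials of weight less than `N`. -/
def lowWeight (N : ℕ) : AddSubgroup ((Fin p ⊕ Fin q → ℕ) →₀ R) where
  carrier := {f | ∀ l, N ≤ expWeight l → f l = 0}
  zero_mem' := fun _ _ => rfl
  add_mem' := fun ha hb l hl => by rw [Finsupp.add_apply, ha l hl, hb l hl, add_zero]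
  neg_mem' := fun ha l hl => by rw [Finsupp.neg_apply, ha l hl, neg_zero]

theorem single_mem_lowWeight {N : ℕ} {l : Fin p ⊕ Fin q → ℕ} (hl : expWeight l < N) (x : R) :
    Finsupp.single l x ∈ lowWeight R p q N := fun m hm => by
  refine Finsupp.single_eq_of_ne fun h => ?_
  subst h
  omega

theorem lowWeight_mono {N N' : ℕ} (h : N ≤ N') : lowWeight R p q N ≤ lowWeight R p q N' :=
  fun _ hf l hl => hf l (h.trans hl)

theorem smul_mem_lowWeight {N : ℕ} (r : R) {f : (Fin p ⊕ Fin q → ℕ) →₀ R}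
    (hf : f ∈ lowWeight R p q N) : r • f ∈ lowWeight R p q N := fun l hl => by
  rw [Finsupp.smul_apply, hf l hl, smul_zero]

theorem modelVector_mem_lowWeight (i : Fin p ⊕ Fin q) {N : ℕ} {f : (Fin p ⊕ Fin q → ℕ) →₀ R}
    (hf : f ∈ lowWeight R p q N) : modelVector 𝒜 i f ∈ lowWeight R p q (N + basisRank i) := by
  rw [← f.sum_single, Finsupp.sum, map_sum]
  refine (lowWeight R p q _).sum_mem fun l hl => ?_
  rw [modelVector_single]
  refine single_mem_lowWeight ?_ _
  rw [expWeight_add_single]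
  have : expWeight l < N := by
    by_contra h
    exact Finsupp.mem_support_iff.1 hl (hf l (not_lt.1 h))
  omega

/-- The `i`-th diagonal entry of an even supermatrix, in `R₀`. -/
def diagEntry (T : evenMat 𝒜 p q) (i : Fin p ⊕ Fin q) : 𝒜 0 :=
  ⟨T.1 i i, by simpa [CharTwo.add_self_eq_zero] using T.2 i i⟩

/-- The matrix `T` is upper triangular for the order of the basis vectors by position. -/
def IsUpper (T : Matrix (Fin p ⊕ Fin q) (Fin p ⊕ Fin q) R) : Prop :=
  ∀ i j, basisRank j < basisRank i → T i j = 0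

theorem extMap_basisVector_mul (B : evenMat 𝒜 p q) (i : Fin p ⊕ Fin q) (x : ExtAlg 𝒜 p q) :
    extCoord 𝒜 p q (extMap B (extBasisVector 𝒜 p q i * x))
      = ∑ j, modelVector 𝒜 j (B.1 j i • extCoord 𝒜 p q (extMap B x)) := by
  rw [map_mul, extBasisVector, extMap_extVector, extCoord_vector_mul]
  simp [Matrix.mulVec_single]

/-- A triangular operator multiplies a monomial by the product of the diagonal entries, up to terms
of lower weight. -/
theorem extCoord_extMap_of_isUpper {T : evenMat 𝒜 p q} (hT : IsUpper T.1)
    {l : Fin p ⊕ Fin q → ℕ} (hl : IsReducedExp l) :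
    extCoord 𝒜 p q (extMap T (extMonomial 𝒜 p q l))
      - Finsupp.single l ((∏ i, diagEntry T i ^ l i : 𝒜 0) : R)
      ∈ lowWeight R p q (expWeight l) := by
  obtain ⟨k, hk⟩ : ∃ k, ∑ i, l i = k := ⟨_, rfl⟩
  induction k generalizing l with
  | zero =>
    have : l = 0 := by
      funext i
      exact (Finset.sum_eq_zero_iff.1 hk) i (Finset.mem_univ i)
    subst this
    have e : ((∏ i, diagEntry T i ^ (0 : Fin p ⊕ Fin q → ℕ) i : 𝒜 0) : R) = 1 := by
      simp only [Pi.zero_apply, pow_zero, Finset.prod_const_one]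
      rfl
    rw [extMonomial_zero, map_one, extCoord_one, e, sub_self]
    exact (lowWeight R p q _).zero_mem
  | succ k ih =>
    obtain ⟨i, l', hl', hk', rfl, hs⟩ := hl.exists_first hk
    have h := basisVector_mul_extMonomial (𝒜 := 𝒜) i l'
    rw [hs, one_smul] at h
    rw [← h, extMap_basisVector_mul]
    set c : 𝒜 0 := ∏ i, diagEntry T i ^ l' i with hc
    have hprod : ∏ j, diagEntry T j ^ (l' + Pi.single i 1 : Fin p ⊕ Fin q → ℕ) j
        = diagEntry T i * c := by
      simp only [Pi.add_apply, pow_add, Finset.prod_mul_distrib]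
      rw [mul_comm, hc]
      congr 1
      rw [Finset.prod_eq_single i]
      · simp
      · intro j _ hj
        simp [hj]
      · intro h
        exact absurd (Finset.mem_univ _) h
    have hlow := ih hl' hk'
    set g := extCoord 𝒜 p q (extMap T (extMonomial 𝒜 p q l')) - Finsupp.single l' (c : R) with hg
    have hgc : extCoord 𝒜 p q (extMap T (extMonomial 𝒜 p q l'))
        = g + Finsupp.single l' (c : R) := (sub_add_cancel _ _).symm
    rw [hgc, hprod, expWeight_add_single]
    simp only [smul_add, map_add, Finset.sum_add_distrib]
    rw [add_sub_assoc]
    refine (lowWeight R p q _).add_mem ?_ ?_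
    · refine (lowWeight R p q _).sum_mem fun j _ => ?_
      by_cases hj : basisRank i < basisRank j
      · rw [hT j i hj, zero_smul, map_zero]
        exact (lowWeight R p q _).zero_mem
      · exact lowWeight_mono (by omega) (modelVector_mem_lowWeight j (smul_mem_lowWeight _ hlow))
    · have hi : modelVector 𝒜 i (T.1 i i • Finsupp.single l' (c : R))
          = Finsupp.single (l' + Pi.single i 1) ((diagEntry T i * c : 𝒜 0) : R) := by
        rw [Finsupp.smul_single, modelVector_single, hs, one_smul]
        congr 1
        change parityTwist 𝒜 _ ((diagEntry T i * c : 𝒜 0) : R) = _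
        rw [parityTwist_of_mem 𝒜 _ (diagEntry T i * c).2, mul_zero, paritySign_zero, one_smul]
      rw [← Finset.add_sum_erase _ _ (Finset.mem_univ i), hi, add_sub_cancel_left]
      refine (lowWeight R p q _).sum_mem fun j hj => ?_
      by_cases hji : basisRank i < basisRank j
      · rw [hT j i hji, zero_smul, map_zero]
        exact (lowWeight R p q _).zero_mem
      · rw [Finsupp.smul_single, modelVector_single]
        refine single_mem_lowWeight ?_ _
        rw [expWeight_add_single]
        have := basisRank_injective.ne (Finset.ne_of_mem_erase hj)
        omega

theorem paritySign_expParity (l : Fin p ⊕ Fin q → ℕ) :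
    paritySign (expParity l) = ∏ i, paritySign (idxParity i) ^ l i := by
  have h : ∀ s : Finset (Fin p ⊕ Fin q), paritySign (∑ i ∈ s, (l i : ZMod 2) * idxParity i)
      = ∏ i ∈ s, paritySign (idxParity i) ^ l i := fun s => by
    induction s using Finset.induction_on with
    | empty => simp [paritySign_zero]
    | insert a s ha ih =>
      rw [Finset.sum_insert ha, Finset.prod_insert ha, paritySign_add, ih]
      congr 1
      generalize l a = n
      induction n with
      | zero => simp [paritySign_zero]
      | succ n ihn => rw [pow_succ, ← ihn, ← paritySign_add, Nat.cast_succ, add_mul, one_mul]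
  exact h Finset.univ

theorem trExt_of_isUpper {T : evenMat 𝒜 p q} (hT : IsUpper T.1) (k : ℕ) :
    trExt T k = ∑ l ∈ reducedExps p q k,
      ∏ i, (paritySign (idxParity i) • diagEntry T i) ^ l i := by
  apply Subtype.ext
  rw [trExt_natCast, ← evenIncl_apply, map_sum]
  refine Finset.sum_congr rfl fun l hl => ?_
  have h := extCoord_extMap_of_isUpper hT (mem_reducedExps.1 hl).2 l le_rfl
  rw [Finsupp.sub_apply, Finsupp.single_eq_same, sub_eq_zero] at h
  rw [h, ← evenIncl_apply, ← map_zsmul, paritySign_expParity]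
  congr 1
  simp only [zsmul_eq_mul, mul_pow, Finset.prod_mul_distrib, Int.cast_prod, Int.cast_pow]

/-- The generating series of the traces of the exterior powers of one basis vector: `1 + d z` for an
even one and `(1 + d z)⁻¹` for an odd one. -/
noncomputable def rankOneSeries {S : Type*} [CommRing S] (i : Fin p ⊕ Fin q) (d : S) :
    PowerSeries S :=
  PowerSeries.mk fun n => if idxParity i = 0 ∧ 1 < n then 0 else (paritySign (idxParity i) • d) ^ n

theorem rankOneSeries_inl {S : Type*} [CommRing S] (i : Fin p) (d : S) :
    rankOneSeries (Sum.inl i : Fin p ⊕ Fin q) d = 1 + PowerSeries.X * PowerSeries.C d := by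
  ext n
  rw [rankOneSeries, PowerSeries.coeff_mk]
  rcases n with _ | _ | n
  · simp
  · simp [idxParity, paritySign, PowerSeries.coeff_one]
  · simp [idxParity, PowerSeries.coeff_one, PowerSeries.coeff_X]

theorem rankOneSeries_inr {S : Type*} [CommRing S] (j : Fin q) (d : S) :
    rankOneSeries (Sum.inr j : Fin p ⊕ Fin q) d * (1 + PowerSeries.X * PowerSeries.C d) = 1 := by
  ext n
  rw [mul_add, mul_one, ← mul_assoc, map_add, PowerSeries.coeff_mul_C, rankOneSeries]
  rcases n with _ | n
  · simp
  · rw [PowerSeries.coeff_succ_mul_X, PowerSeries.coeff_mk, PowerSeries.coeff_mk]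
    simp [idxParity, paritySign, PowerSeries.coeff_one, pow_succ]

/-- The generating series of the traces of the exterior powers of a triangular operator. -/
theorem mk_trExt_of_isUpper {T : evenMat 𝒜 p q} (hT : IsUpper T.1) :
    (PowerSeries.mk fun k => trExt T (k : ℤ)) = ∏ i, rankOneSeries i (diagEntry T i) := by
  classical
  ext k
  congr 1
  rw [PowerSeries.coeff_mk, trExt_of_isUpper hT, PowerSeries.coeff_prod]
  have h1 : ∀ l : Fin p ⊕ Fin q →₀ ℕ, ∏ i, PowerSeries.coeff (l i) (rankOneSeries i (diagEntry T i))
      = if IsReducedExp l then ∏ i, (paritySign (idxParity i) • diagEntry T i) ^ l i else 0 := by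
    intro l
    simp only [rankOneSeries, PowerSeries.coeff_mk]
    split_ifs with h
    · refine Finset.prod_congr rfl fun i _ => if_neg ?_
      rintro ⟨h0, h1⟩
      exact absurd (h i h0) (by omega)
    · simp only [IsReducedExp, not_forall, not_le] at h
      obtain ⟨i, h0, h1⟩ := h
      exact Finset.prod_eq_zero (Finset.mem_univ i) (if_pos ⟨h0, h1⟩)
  rw [Finset.sum_congr rfl fun l _ => h1 l, ← Finset.sum_filter]
  symm
  refine Finset.sum_bij (fun l _ => (l : Fin p ⊕ Fin q → ℕ)) ?_ ?_ ?_ ?_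
  · intro l hl
    rw [Finset.mem_filter, Finset.mem_finsuppAntidiag] at hl
    exact mem_reducedExps.2 ⟨hl.1.1, hl.2⟩
  · intro l _ m _ h
    exact DFunLike.coe_injective h
  · intro l hl
    obtain ⟨h1, h2⟩ := mem_reducedExps.1 hl
    refine ⟨Finsupp.equivFunOnFinite.symm l, ?_, rfl⟩
    rw [Finset.mem_filter, Finset.mem_finsuppAntidiag]
    exact ⟨⟨h1, Finset.subset_univ _⟩, h2⟩
  · intro l _
    rfl

theorem mk_trExt_mul_of_isUpper {T : evenMat 𝒜 p q} (hT : IsUpper T.1) :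
    (PowerSeries.mk fun k => trExt T (k : ℤ)) *
        ∏ j : Fin q, (1 + PowerSeries.X * PowerSeries.C (diagEntry T (Sum.inr j)))
      = ∏ i : Fin p, (1 + PowerSeries.X * PowerSeries.C (diagEntry T (Sum.inl i))) := by
  rw [mk_trExt_of_isUpper hT, Fintype.prod_sum_type, mul_assoc, ← Finset.prod_mul_distrib,
    Finset.prod_congr rfl fun j _ => rankOneSeries_inr j _, Finset.prod_const_one, mul_one]
  exact Finset.prod_congr rfl fun i _ => rankOneSeries_inl i _

end Triangular

/-! ### Triangularization over power series -/

section FixedPoint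

variable {R : Type*} [Ring R] {ι : Type*}

/-- Two families of power series agree in degrees below `n`. -/
def AgreeBelow (n : ℕ) (x y : ι → PowerSeries R) : Prop :=
  ∀ i, ∀ m < n, PowerSeries.coeff m (x i) = PowerSeries.coeff m (y i)

/-- A map that improves the order of agreement of families of power series has a fixed point; its
coefficients are those of the iterates of the map at zero. -/
theorem exists_fixedPoint_of_contracting (F : (ι → PowerSeries R) → ι → PowerSeries R)
    (hF : ∀ n x y, AgreeBelow n x y → AgreeBelow (n + 1) (F x) (F y)) (H : ι → AddSubgroup R)
    (hH : ∀ x, (∀ i n, PowerSeries.coeff n (x i) ∈ H i) →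
      ∀ i n, PowerSeries.coeff n (F x i) ∈ H i) :
    ∃ x, F x = x ∧ ∀ i n, PowerSeries.coeff n (x i) ∈ H i := by
  have hmem : ∀ n i m, PowerSeries.coeff m (F^[n] 0 i) ∈ H i := fun n => by
    induction n with
    | zero => exact fun i m => by simp
    | succ n ih =>
      rw [Function.iterate_succ_apply']
      exact hH _ ih
  have hstep : ∀ n, AgreeBelow n (F^[n] 0) (F^[n + 1] 0) := fun n => by
    induction n with
    | zero => exact fun i m hm => absurd hm (Nat.not_lt_zero m)
    | succ n ih =>
      rw [Function.iterate_succ_apply', Function.iterate_succ_apply' F (n + 1)]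
      exact hF n _ _ ih
  have hlim : ∀ n k, AgreeBelow n (F^[n] 0) (F^[n + k] 0) := fun n k => by
    induction k with
    | zero => exact fun i m _ => rfl
    | succ k ih =>
      exact fun i m hm => (ih i m hm).trans (hstep (n + k) i m (by omega))
  set x : ι → PowerSeries R := fun i =>
    PowerSeries.mk fun n => PowerSeries.coeff n (F^[n + 1] 0 i) with hx
  have hxn : ∀ n, AgreeBelow n x (F^[n] 0) := fun n i m hm => by
    rw [hx, PowerSeries.coeff_mk]
    obtain ⟨k, rfl⟩ := Nat.exists_eq_add_of_le (Nat.succ_le_of_lt hm)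
    exact hlim (m + 1) k i m (Nat.lt_succ_self m)
  refine ⟨x, ?_, fun i n => ?_⟩
  · funext i
    ext n
    have h1 := hF (n + 1) _ _ (hxn (n + 1)) i n (by omega)
    rw [h1, ← Function.iterate_succ_apply' F]
    exact ((hxn (n + 1 + 1)) i n (by omega)).symm
  · rw [hx, PowerSeries.coeff_mk]
    exact hmem _ _ _

/-- Two power series agree in degrees below `n`. -/
def AgreeUpTo (n : ℕ) (f g : PowerSeries R) : Prop :=
  ∀ m < n, PowerSeries.coeff m f = PowerSeries.coeff m g

namespace AgreeUpTo

variable {n : ℕ} {f f' g g' : PowerSeries R}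

theorem refl (n : ℕ) (f : PowerSeries R) : AgreeUpTo n f f := fun _ _ => rfl

theorem add (h : AgreeUpTo n f g) (h' : AgreeUpTo n f' g') : AgreeUpTo n (f + f') (g + g') :=
  fun m hm => by rw [map_add, map_add, h m hm, h' m hm]

theorem sub (h : AgreeUpTo n f g) (h' : AgreeUpTo n f' g') : AgreeUpTo n (f - f') (g - g') :=
  fun m hm => by rw [map_sub, map_sub, h m hm, h' m hm]

theorem mul (h : AgreeUpTo n f g) (h' : AgreeUpTo n f' g') : AgreeUpTo n (f * f') (g * g') :=
  fun m hm => by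
    rw [PowerSeries.coeff_mul, PowerSeries.coeff_mul]
    refine Finset.sum_congr rfl fun x hx => ?_
    rw [Finset.HasAntidiagonal.mem_antidiagonal] at hx
    rw [h _ (by omega), h' _ (by omega)]

theorem sum {κ : Type*} (s : Finset κ) {f g : κ → PowerSeries R}
    (h : ∀ k ∈ s, AgreeUpTo n (f k) (g k)) : AgreeUpTo n (∑ k ∈ s, f k) (∑ k ∈ s, g k) :=
  fun m hm => by
    rw [map_sum, map_sum]
    exact Finset.sum_congr rfl fun k hk => h k hk m hm

theorem X_pow_mul (h : AgreeUpTo n f g) {e : ℕ} (he : e ≠ 0) :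
    AgreeUpTo (n + 1) (PowerSeries.X ^ e * f) (PowerSeries.X ^ e * g) := fun m hm => by
  rw [PowerSeries.coeff_X_pow_mul', PowerSeries.coeff_X_pow_mul']
  split_ifs
  · exact h _ (by omega)
  · rfl

end AgreeUpTo

end FixedPoint

section Triangularize

variable {R : Type*} [Ring R] {𝒜 : ZMod 2 → AddSubgroup R} {p q : ℕ} [GradedRing 𝒜]
  [IsSupercommutative 𝒜]

variable (𝒜) in
/-- The homogeneous components of a power series. -/
noncomputable def seriesComponent (i : ZMod 2) : PowerSeries R →+ seriesGrading 𝒜 i :=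
  AddMonoidHom.mk' (fun f => ⟨PowerSeries.mk fun n =>
      (DirectSum.decompose 𝒜 (PowerSeries.coeff n f) i : R), fun n => by
        rw [PowerSeries.coeff_mk]
        exact (DirectSum.decompose 𝒜 _ i).2⟩) fun f g => by
    apply Subtype.ext
    ext n
    simp [DirectSum.decompose_add]

theorem coeff_seriesComponent (i : ZMod 2) (f : PowerSeries R) (n : ℕ) :
    PowerSeries.coeff n (seriesComponent 𝒜 i f : PowerSeries R)
      = DirectSum.decompose 𝒜 (PowerSeries.coeff n f) i :=
  PowerSeries.coeff_mk n fun n => (DirectSum.decompose 𝒜 (PowerSeries.coeff n f) i : R)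

theorem seriesComponent_of_mem {i : ZMod 2} (f : seriesGrading 𝒜 i) :
    seriesComponent 𝒜 i f = f := by
  apply Subtype.ext
  ext n
  rw [coeff_seriesComponent, DirectSum.decompose_of_mem_same 𝒜 (f.2 n)]

theorem seriesComponent_of_mem_ne {i j : ZMod 2} (f : seriesGrading 𝒜 i) (h : i ≠ j) :
    seriesComponent 𝒜 j f = 0 := by
  apply Subtype.ext
  ext n
  rw [coeff_seriesComponent, DirectSum.decompose_of_mem_ne 𝒜 (f.2 n) h]
  exact (map_zero _).symm

noncomputable instance seriesDecomposition : DirectSum.Decomposition (seriesGrading 𝒜) :=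
  DirectSum.Decomposition.ofAddHom _
    ((DirectSum.of (fun i => seriesGrading 𝒜 i) 0).comp (seriesComponent 𝒜 0)
      + (DirectSum.of (fun i => seriesGrading 𝒜 i) 1).comp (seriesComponent 𝒜 1))
    (by
      ext f n
      rw [AddMonoidHom.comp_apply, AddMonoidHom.add_apply, AddMonoidHom.comp_apply,
        AddMonoidHom.comp_apply, map_add, DirectSum.coeAddMonoidHom_of,
        DirectSum.coeAddMonoidHom_of, map_add, coeff_seriesComponent, coeff_seriesComponent]
      exact decompose_add_decompose _ 0)
    (by
      refine DirectSum.addHom_ext fun i f => ?_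
      rw [AddMonoidHom.comp_apply, DirectSum.coeAddMonoidHom_of, AddMonoidHom.add_apply,
        AddMonoidHom.comp_apply, AddMonoidHom.comp_apply, AddMonoidHom.id_apply]
      rcases parity_cases i with rfl | rfl
      · rw [seriesComponent_of_mem, seriesComponent_of_mem_ne f (by decide), map_zero, add_zero]
      · rw [seriesComponent_of_mem, seriesComponent_of_mem_ne f (by decide), map_zero, zero_add])

noncomputable instance seriesGradedRing : GradedRing (seriesGrading 𝒜) where

theorem X_pow_mul_mem {n : ZMod 2} {f : PowerSeries R} (hf : f ∈ seriesGrading 𝒜 n) (e : ℕ) :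
    PowerSeries.X ^ e * f ∈ seriesGrading 𝒜 n := fun m => by
  rw [PowerSeries.coeff_X_pow_mul']
  split_ifs
  · exact hf _
  · exact (𝒜 n).zero_mem

theorem C_mem {n : ZMod 2} {r : R} (hr : r ∈ 𝒜 n) : PowerSeries.C r ∈ seriesGrading 𝒜 n :=
  fun m => by
    rw [PowerSeries.coeff_C]
    split_ifs
    · exact hr
    · exact (𝒜 n).zero_mem

theorem X_pow_mem (e : ℕ) : (PowerSeries.X ^ e : PowerSeries R) ∈ seriesGrading 𝒜 0 := by
  have := X_pow_mul_mem (𝒜 := 𝒜) (SetLike.GradedOne.one_mem (A := seriesGrading 𝒜)) e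
  rwa [mul_one] at this

/-- The deformation `D + s^N A` of `A`, with `D` the diagonal matrix of the powers of `s` and
`N = p + q + 1`. It determines `A` by its terms of highest degree in `s`, and as the diagonal entries of
`D` differ at low order it can be made triangular over `R⟦s⟧`. -/
noncomputable def deformation (A : evenMat 𝒜 p q) : evenMat (seriesGrading 𝒜) p q :=
  ⟨fun i j => (if i = j then PowerSeries.X ^ basisRank i else 0)
      + PowerSeries.X ^ (p + q + 1) * PowerSeries.C (A.1 i j), fun i j => by
    refine (seriesGrading 𝒜 _).add_mem ?_ (X_pow_mul_mem (C_mem (A.2 i j)) _)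
    split_ifs with h
    · subst h
      rw [CharTwo.add_self_eq_zero]
      exact X_pow_mem _
    · exact (seriesGrading 𝒜 _).zero_mem⟩

theorem basisRank_lt (i : Fin p ⊕ Fin q) : basisRank i < p + q := (finSumFinEquiv i).2

/-- A strictly lower triangular even supermatrix is nilpotent. -/
theorem isNilpotent_of_strictly_lower (X : evenMat 𝒜 p q)
    (hX : ∀ i j, basisRank i ≤ basisRank j → X.1 i j = 0) : IsNilpotent X := by
  -- the entries of `X ^ m` vanish except at distance at least `m` below the diagonal
  have h : ∀ m i j, basisRank i < basisRank j + m → (X ^ m).1 i j = 0 := fun m => by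
    induction m with
    | zero =>
      intro i j hij
      rw [pow_zero]
      exact Matrix.one_apply_ne fun h => by simp [h] at hij
    | succ m ih =>
      intro i j hij
      rw [pow_succ]
      change ((X ^ m).1 * X.1) i j = 0
      rw [Matrix.mul_apply]
      refine Finset.sum_eq_zero fun k _ => ?_
      by_cases hk : basisRank k ≤ basisRank j
      · rw [hX k j hk, mul_zero]
      · rw [ih i k (by omega), zero_mul]
  refine ⟨p + q, Subtype.ext (Matrix.ext fun i j => ?_)⟩
  exact h _ _ _ (by have := basisRank_lt i; omega)

/-- The deformation of `A` is conjugate to a triangular matrix. -/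
theorem exists_triangular_deformation (A : evenMat 𝒜 p q) :
    ∃ (U : (evenMat (seriesGrading 𝒜) p q)ˣ) (T : evenMat (seriesGrading 𝒜) p q), IsUpper T.1 ∧
      (U : evenMat (seriesGrading 𝒜) p q) * deformation A = T * U := by
  classical
  set N := p + q + 1 with hN
  -- with `U = 1 + X`, the unknown `Z` holds `X i j = s^(N - j) Z i j` below the diagonal and
  -- `T i j = D i j + s^N Z i j` elsewhere; `W` is the part of the equation that is divisible by `s^N`,
  -- and the equation, divided by `s^N`, is `Z = F Z`
  let W : ((Fin p ⊕ Fin q) × (Fin p ⊕ Fin q) → PowerSeries R) →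
      (Fin p ⊕ Fin q) → (Fin p ⊕ Fin q) → PowerSeries R := fun Z i j =>
    PowerSeries.C (A.1 i j)
      + ∑ k, (if basisRank k < basisRank i then
          PowerSeries.X ^ (N - basisRank k) * (Z (i, k) * PowerSeries.C (A.1 k j)) else 0)
      - ∑ k, (if basisRank i ≤ basisRank k ∧ basisRank j < basisRank k then
          PowerSeries.X ^ (N - basisRank j) * (Z (i, k) * Z (k, j)) else 0)
  let F : ((Fin p ⊕ Fin q) × (Fin p ⊕ Fin q) → PowerSeries R) →
      (Fin p ⊕ Fin q) × (Fin p ⊕ Fin q) → PowerSeries R := fun Z x =>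
    if basisRank x.2 < basisRank x.1 then
      PowerSeries.X ^ (basisRank x.1 - basisRank x.2) * Z x - W Z x.1 x.2 else W Z x.1 x.2
  have hW : ∀ n Z Z', AgreeBelow n Z Z' → ∀ i j, AgreeUpTo (n + 1) (W Z i j) (W Z' i j) := by
    intro n Z Z' h i j
    refine ((AgreeUpTo.refl _ _).add (AgreeUpTo.sum _ fun k _ => ?_)).sub
      (AgreeUpTo.sum _ fun k _ => ?_)
    · split_ifs
      · have := basisRank_lt k
        exact AgreeUpTo.X_pow_mul (AgreeUpTo.mul (h _) (AgreeUpTo.refl _ _)) (by omega)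
      · exact AgreeUpTo.refl _ _
    · split_ifs
      · have := basisRank_lt j
        exact AgreeUpTo.X_pow_mul (AgreeUpTo.mul (h _) (h _)) (by omega)
      · exact AgreeUpTo.refl _ _
  have hF : ∀ n Z Z', AgreeBelow n Z Z' → AgreeBelow (n + 1) (F Z) (F Z') := by
    intro n Z Z' h x
    change AgreeUpTo (n + 1) (if _ then _ else _) (if _ then _ else _)
    split_ifs with hx
    · exact (AgreeUpTo.X_pow_mul (h x) (by omega)).sub (hW n Z Z' h _ _)
    · exact hW n Z Z' h _ _
  have hWmem : ∀ Z : (Fin p ⊕ Fin q) × (Fin p ⊕ Fin q) → PowerSeries R,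
      (∀ x, Z x ∈ seriesGrading 𝒜 (idxParity x.1 + idxParity x.2)) →
      ∀ i j, W Z i j ∈ seriesGrading 𝒜 (idxParity i + idxParity j) := by
    intro Z h i j
    have e : ∀ k : Fin p ⊕ Fin q, idxParity i + idxParity k + (idxParity k + idxParity j)
        = idxParity i + idxParity j := fun k => by
      rw [add_assoc, ← add_assoc (idxParity k), CharTwo.add_self_eq_zero, zero_add]
    refine (seriesGrading 𝒜 _).sub_mem ((seriesGrading 𝒜 _).add_mem (C_mem (A.2 i j))
      ((seriesGrading 𝒜 _).sum_mem fun k _ => ?_)) ((seriesGrading 𝒜 _).sum_mem fun k _ => ?_)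
    · split_ifs
      · refine X_pow_mul_mem ?_ _
        have := SetLike.GradedMul.mul_mem (h (i, k)) (C_mem (A.2 k j))
        rwa [e] at this
      · exact (seriesGrading 𝒜 _).zero_mem
    · split_ifs
      · refine X_pow_mul_mem ?_ _
        have := SetLike.GradedMul.mul_mem (h (i, k)) (h (k, j))
        rwa [e] at this
      · exact (seriesGrading 𝒜 _).zero_mem
  obtain ⟨Z, hZ, hZmem⟩ := exists_fixedPoint_of_contracting F hF
    (fun x => 𝒜 (idxParity x.1 + idxParity x.2)) (by
      intro Z h x
      change (if _ then _ else _) ∈ seriesGrading 𝒜 (idxParity x.1 + idxParity x.2)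
      split_ifs
      · exact (seriesGrading 𝒜 _).sub_mem (X_pow_mul_mem (h x) _) (hWmem Z h _ _)
      · exact hWmem Z h _ _)
  have hZlow : ∀ i j, basisRank j < basisRank i →
      Z (i, j) = PowerSeries.X ^ (basisRank i - basisRank j) * Z (i, j) - W Z i j := fun i j hij =>
    (congrFun hZ (i, j)).symm.trans (if_pos hij)
  have hZup : ∀ i j, ¬ basisRank j < basisRank i → Z (i, j) = W Z i j := fun i j hij =>
    (congrFun hZ (i, j)).symm.trans (if_neg hij)
  let X : evenMat (seriesGrading 𝒜) p q :=
    ⟨fun i j => if basisRank j < basisRank i then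
      PowerSeries.X ^ (N - basisRank j) * Z (i, j) else 0, fun i j => by
        beta_reduce
        split_ifs
        · exact X_pow_mul_mem (hZmem (i, j)) _
        · exact (seriesGrading 𝒜 _).zero_mem⟩
  let T : evenMat (seriesGrading 𝒜) p q :=
    ⟨fun i j => (if i = j then PowerSeries.X ^ basisRank i else 0) +
      if basisRank j < basisRank i then 0 else PowerSeries.X ^ N * Z (i, j), fun i j => by
        refine (seriesGrading 𝒜 _).add_mem ?_ ?_
        · split_ifs with h
          · subst h
            rw [CharTwo.add_self_eq_zero]
            exact X_pow_mem _
          · exact (seriesGrading 𝒜 _).zero_mem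
        · split_ifs
          · exact (seriesGrading 𝒜 _).zero_mem
          · exact X_pow_mul_mem (hZmem (i, j)) _⟩
  have hXnil : IsNilpotent X := isNilpotent_of_strictly_lower X fun i j hij => if_neg (by omega)
  obtain ⟨U, hU⟩ := hXnil.isUnit_one_add
  refine ⟨U, T, fun i j hij => ?_, ?_⟩
  · change (if i = j then _ else _) + (if _ then _ else _) = _
    rw [if_pos hij, if_neg (fun h => by simp [h] at hij), add_zero]
  · rw [hU]
    apply Subtype.ext
    ext1 i j
    change ((1 + X.1) * (deformation A).1) i j = (T.1 * (1 + X.1)) i j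
    rw [Matrix.add_mul, Matrix.mul_add, Matrix.one_mul, Matrix.mul_one, Matrix.add_apply,
      Matrix.add_apply, Matrix.mul_apply, Matrix.mul_apply]
    have e1 : ∑ k, X.1 i k * (deformation A).1 k j = X.1 i j * PowerSeries.X ^ basisRank j
        + PowerSeries.X ^ N * ∑ k, (if basisRank k < basisRank i then
          PowerSeries.X ^ (N - basisRank k) * (Z (i, k) * PowerSeries.C (A.1 k j)) else 0) := by
      change ∑ k, X.1 i k * ((if k = j then PowerSeries.X ^ basisRank k else 0)
        + PowerSeries.X ^ N * PowerSeries.C (A.1 k j)) = _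
      simp only [mul_add, Finset.sum_add_distrib, Finset.mul_sum]
      congr 1
      · simp
      · refine Finset.sum_congr rfl fun k _ => ?_
        change (if _ then _ else _) * _ = _
        split_ifs
        · rw [← mul_assoc, ← PowerSeries.X_pow_mul]
          simp only [mul_assoc]
        · simp
    have e2 : ∑ k, T.1 i k * X.1 k j = PowerSeries.X ^ basisRank i * X.1 i j
        + PowerSeries.X ^ N * ∑ k, (if basisRank i ≤ basisRank k ∧ basisRank j < basisRank k then
          PowerSeries.X ^ (N - basisRank j) * (Z (i, k) * Z (k, j)) else 0) := by
      change ∑ k, ((if i = k then PowerSeries.X ^ basisRank i else 0) +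
        if basisRank k < basisRank i then 0 else PowerSeries.X ^ N * Z (i, k)) * X.1 k j = _
      simp only [add_mul, Finset.sum_add_distrib, Finset.mul_sum]
      congr 1
      · simp
      · refine Finset.sum_congr rfl fun k _ => ?_
        change (if _ then _ else _) * (if _ then _ else _) = _
        by_cases h1 : basisRank k < basisRank i
        · rw [if_pos h1, zero_mul, if_neg (by omega), mul_zero]
        · by_cases h2 : basisRank j < basisRank k
          · rw [if_neg h1, if_pos h2, if_pos ⟨by omega, h2⟩, mul_assoc, ← mul_assoc (Z (i, k)),
              ← PowerSeries.X_pow_mul, mul_assoc]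
          · rw [if_neg h2, mul_zero, if_neg (by omega), mul_zero]
    rw [e1, e2]
    change ((if i = j then PowerSeries.X ^ basisRank i else 0)
        + PowerSeries.X ^ N * PowerSeries.C (A.1 i j)) + _
      = ((if i = j then PowerSeries.X ^ basisRank i else 0) +
      if basisRank j < basisRank i then 0 else PowerSeries.X ^ N * Z (i, j)) + _
    rw [← sub_eq_zero]
    by_cases hij : basisRank j < basisRank i
    · have hXij : X.1 i j = PowerSeries.X ^ (N - basisRank j) * Z (i, j) := if_pos hij
      have hj := basisRank_lt j
      have p1 : X.1 i j * PowerSeries.X ^ basisRank j = PowerSeries.X ^ N * Z (i, j) := by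
        rw [hXij, ← PowerSeries.X_pow_mul, ← mul_assoc, ← pow_add]
        congr 2
        omega
      have p2 : PowerSeries.X ^ basisRank i * X.1 i j
          = PowerSeries.X ^ N * (PowerSeries.X ^ (basisRank i - basisRank j) * Z (i, j)) := by
        rw [hXij, ← mul_assoc, ← mul_assoc, ← pow_add, ← pow_add]
        congr 2
        omega
      rw [if_pos hij, p1, p2]
      have := hZlow i j hij
      have h0 : PowerSeries.X ^ N * (W Z i j + Z (i, j)
          - PowerSeries.X ^ (basisRank i - basisRank j) * Z (i, j)) = 0 := by
        have h1 := eq_sub_iff_add_eq.1 this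
        rw [add_comm (W Z i j), h1, sub_self, mul_zero]
      refine Eq.trans ?_ h0
      simp only [W, mul_sub, mul_add]
      abel
    · have hXij : X.1 i j = 0 := if_neg hij
      rw [if_neg hij, hXij, zero_mul, mul_zero, hZup i j hij]
      simp only [W, mul_sub, mul_add]
      abel

end Triangularize

/-! ### Terms of highest degree -/

section HasTop

variable {R : Type*} [Ring R]

/-- The series `x` in `s` is a polynomial of degree at most `d` in which `s^d` has the
coefficient `y`. -/
def HasTop (d : ℕ) (x : PowerSeries R) (y : R) : Prop :=
  (∀ n, d < n → PowerSeries.coeff n x = 0) ∧ PowerSeries.coeff d x = y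

namespace HasTop

variable {d d' : ℕ} {x x' : PowerSeries R} {y y' : R}

theorem unique (h : HasTop d x y) (h' : HasTop d x y') : y = y' := h.2.symm.trans h'.2

theorem zero (d : ℕ) : HasTop d (0 : PowerSeries R) 0 := ⟨fun _ _ => map_zero _, map_zero _⟩

theorem one : HasTop 0 (1 : PowerSeries R) 1 :=
  ⟨fun n hn => by rw [PowerSeries.coeff_one, if_neg hn.ne'], by simp⟩

theorem add (h : HasTop d x y) (h' : HasTop d x' y') : HasTop d (x + x') (y + y') :=
  ⟨fun n hn => by rw [map_add, h.1 n hn, h'.1 n hn, add_zero], by rw [map_add, h.2, h'.2]⟩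

theorem zsmul (h : HasTop d x y) (m : ℤ) : HasTop d (m • x) (m • y) :=
  ⟨fun n hn => by rw [map_zsmul, h.1 n hn, smul_zero], by rw [map_zsmul, h.2]⟩

theorem neg (h : HasTop d x y) : HasTop d (-x) (-y) := by
  simpa using h.zsmul (-1)

theorem sum {κ : Type*} (s : Finset κ) {x : κ → PowerSeries R} {y : κ → R}
    (h : ∀ k ∈ s, HasTop d (x k) (y k)) : HasTop d (∑ k ∈ s, x k) (∑ k ∈ s, y k) :=
  ⟨fun n hn => by
    rw [map_sum]
    exact Finset.sum_eq_zero fun k hk => (h k hk).1 n hn, by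
    rw [map_sum]
    exact Finset.sum_congr rfl fun k hk => (h k hk).2⟩

theorem mul (h : HasTop d x y) (h' : HasTop d' x' y') : HasTop (d + d') (x * x') (y * y') := by
  refine ⟨fun n hn => ?_, ?_⟩
  · rw [PowerSeries.coeff_mul]
    refine Finset.sum_eq_zero fun a ha => ?_
    rw [Finset.HasAntidiagonal.mem_antidiagonal] at ha
    by_cases h1 : d < a.1
    · rw [h.1 _ h1, zero_mul]
    · rw [h'.1 _ (by omega), mul_zero]
  · rw [PowerSeries.coeff_mul, Finset.sum_eq_single (d, d')]
    · rw [h.2, h'.2]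
    · rintro ⟨a, b⟩ ha hne
      rw [Finset.HasAntidiagonal.mem_antidiagonal] at ha
      by_cases h1 : d < a
      · rw [h.1 _ h1, zero_mul]
      · by_cases h2 : d' < b
        · rw [h'.1 _ h2, mul_zero]
        · exact absurd (Prod.ext (by simp at ha ⊢; omega) (by simp at ha ⊢; omega)) hne
    · intro h0
      exact absurd (by rw [Finset.HasAntidiagonal.mem_antidiagonal]) h0

end HasTop

end HasTop

section TraceTop

variable {R : Type*} [Ring R] {𝒜 : ZMod 2 → AddSubgroup R} {p q : ℕ} [GradedRing 𝒜]
  [IsSupercommutative 𝒜]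

theorem coeff_parityTwist (i : ZMod 2) (f : PowerSeries R) (n : ℕ) :
    PowerSeries.coeff n (parityTwist (seriesGrading 𝒜) i f)
      = parityTwist 𝒜 i (PowerSeries.coeff n f) := by
  refine DFunLike.congr_fun (addHom_ext_homogeneous (seriesGrading 𝒜)
    (f := (PowerSeries.coeff (R := R) n).toAddMonoidHom.comp
      (parityTwist (seriesGrading 𝒜) i).toAddMonoidHom)
    (g := (parityTwist 𝒜 i).toAddMonoidHom.comp (PowerSeries.coeff (R := R) n).toAddMonoidHom)
    fun k r hr => ?_) f
  change PowerSeries.coeff n (parityTwist (seriesGrading 𝒜) i r)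
    = parityTwist 𝒜 i (PowerSeries.coeff n r)
  rw [parityTwist_of_mem _ i hr, parityTwist_of_mem 𝒜 i (hr n), map_zsmul]

theorem HasTop.parityTwist {d : ℕ} {x : PowerSeries R} {y : R} (h : HasTop d x y) (i : ZMod 2) :
    HasTop d (parityTwist (seriesGrading 𝒜) i x) (parityTwist 𝒜 i y) :=
  ⟨fun n hn => by rw [coeff_parityTwist, h.1 n hn, map_zero], by rw [coeff_parityTwist, h.2]⟩

theorem modelVector_apply (i : Fin p ⊕ Fin q) (f : (Fin p ⊕ Fin q → ℕ) →₀ R)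
    (m : Fin p ⊕ Fin q → ℕ) : modelVector 𝒜 i f m = if m i = 0 then 0 else
      insSign i (m - Pi.single i 1) •
        parityTwist 𝒜 (idxParity i) (f (m - Pi.single i 1)) := by
  classical
  induction f using Finsupp.induction_linear with
  | zero => simp
  | add f g hf hg =>
    rw [map_add, Finsupp.add_apply, hf, hg, Finsupp.add_apply, map_add, smul_add]
    split_ifs
    · rw [add_zero]
    · rfl
  | single l x =>
    rw [modelVector_single, Finsupp.single_apply, Finsupp.single_apply]
    split_ifs with h1 h2 h3 h4 h5
    · rw [← h1] at h2
      simp at h2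
    · rw [h3]
    · refine absurd ?_ h3
      rw [← h1]
      funext j
      simp
    · rfl
    · refine absurd ?_ h1
      rw [h5]
      funext j
      by_cases hj : j = i
      · subst hj
        simp
        omega
      · simp [hj]
    · rw [map_zero, smul_zero]

theorem HasTop.modelVector {d : ℕ} {F : (Fin p ⊕ Fin q → ℕ) →₀ PowerSeries R}
    {f : (Fin p ⊕ Fin q → ℕ) →₀ R} (h : ∀ l, HasTop d (F l) (f l)) (i : Fin p ⊕ Fin q)
    (l : Fin p ⊕ Fin q → ℕ) :
    HasTop d (modelVector (seriesGrading 𝒜) i F l) (modelVector 𝒜 i f l) := by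
  rw [modelVector_apply, modelVector_apply]
  split_ifs
  · exact HasTop.zero d
  · exact ((h _).parityTwist _).zsmul _

/-- If the entries of `B` have the entries of `A` as coefficients of `s^N`, of highest degree, then the
traces of the `k`-th exterior powers are related in the same way, with `N k` in place of `N`. -/
theorem HasTop.trExt {N : ℕ} {A : evenMat 𝒜 p q} {B : evenMat (seriesGrading 𝒜) p q}
    (h : ∀ i j, HasTop N (B.1 i j) (A.1 i j)) (k : ℕ) :
    HasTop (N * k) (trExt B k : PowerSeries R) (trExt A k : R) := by
  rw [trExt_natCast, trExt_natCast]
  refine HasTop.sum _ fun l hl => HasTop.zsmul ?_ _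
  obtain ⟨hk, hl⟩ := mem_reducedExps.1 hl
  suffices H : ∀ m, HasTop (N * k)
      (extCoord (seriesGrading 𝒜) p q (extMap B (extMonomial (seriesGrading 𝒜) p q l)) m)
      (extCoord 𝒜 p q (extMap A (extMonomial 𝒜 p q l)) m) from H l
  induction k generalizing l with
  | zero =>
    have : l = 0 := by
      funext i
      exact (Finset.sum_eq_zero_iff.1 hk) i (Finset.mem_univ i)
    subst this
    intro m
    rw [extMonomial_zero, extMonomial_zero, map_one (extMap B), map_one (extMap A), extCoord_one,
      extCoord_one]
    classical
    rw [Finsupp.single_apply, Finsupp.single_apply]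
    split_ifs
    · exact HasTop.one
    · exact HasTop.zero _
  | succ k ih =>
    obtain ⟨i, l', hl', hk', rfl, hs⟩ := hl.exists_first hk
    have h1 := basisVector_mul_extMonomial (𝒜 := 𝒜) i l'
    have h2 := basisVector_mul_extMonomial (𝒜 := seriesGrading 𝒜) i l'
    rw [hs, one_smul] at h1 h2
    intro m
    rw [← h1, ← h2, extMap_basisVector_mul, extMap_basisVector_mul, Finsupp.finsetSum_apply,
      Finsupp.finsetSum_apply]
    refine HasTop.sum _ fun j _ => HasTop.modelVector (fun m => ?_) _ _
    rw [Finsupp.smul_apply, Finsupp.smul_apply, mul_add_one, add_comm]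
    exact (h j i).mul (ih l' (mem_reducedExps.2 ⟨hk', hl'⟩) hk' hl' m)

theorem hasTop_deformation (A : evenMat 𝒜 p q) (i j : Fin p ⊕ Fin q) :
    HasTop (p + q + 1) ((deformation A).1 i j) (A.1 i j) := by
  have h := basisRank_lt i
  have e : (deformation A).1 i j = (if i = j then PowerSeries.X ^ basisRank i else 0)
      + PowerSeries.X ^ (p + q + 1) * PowerSeries.C (A.1 i j) := rfl
  rw [e]
  have h1 : HasTop (p + q + 1) (if i = j then (PowerSeries.X : PowerSeries R) ^ basisRank i else 0)
      0 := by
    split_ifs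
    · refine ⟨fun n hn => ?_, ?_⟩ <;> rw [PowerSeries.coeff_X_pow, if_neg (by omega)]
    · exact HasTop.zero _
  have h2 : HasTop (p + q + 1) (PowerSeries.X ^ (p + q + 1) * PowerSeries.C (A.1 i j))
      (A.1 i j) := by
    refine ⟨fun n hn => ?_, ?_⟩
    · rw [PowerSeries.coeff_X_pow_mul', if_pos hn.le, PowerSeries.coeff_C, if_neg (by omega)]
    · rw [PowerSeries.coeff_X_pow_mul', if_pos le_rfl, PowerSeries.coeff_C, if_pos (by omega)]
  simpa using h1.add h2

end TraceTop

/-! ### The characteristic series -/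

section CharSeries

variable {R : Type*} [Ring R] {𝒜 : ZMod 2 → AddSubgroup R} {p q : ℕ} [GradedRing 𝒜]
  [IsSupercommutative 𝒜]

variable (𝒜) in
/-- Even power series over `R` are power series over `R₀`. -/
noncomputable def evenSeriesEquiv : seriesGrading 𝒜 0 ≃+* PowerSeries (𝒜 0) where
  toFun f := PowerSeries.mk fun n => ⟨PowerSeries.coeff n (f : PowerSeries R), f.2 n⟩
  invFun g := ⟨PowerSeries.mk fun n => ((PowerSeries.coeff n g : 𝒜 0) : R), fun n => by
    rw [PowerSeries.coeff_mk]
    exact (PowerSeries.coeff n g).2⟩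
  left_inv f := by
    apply Subtype.ext
    ext n
    rw [PowerSeries.coeff_mk, PowerSeries.coeff_mk]
  right_inv g := by
    ext n
    rw [PowerSeries.coeff_mk]
    exact PowerSeries.coeff_mk (R := R) n fun n => ((PowerSeries.coeff n g : 𝒜 0) : R)
  map_add' f g := by
    ext n
    rw [map_add, PowerSeries.coeff_mk, PowerSeries.coeff_mk, PowerSeries.coeff_mk]
    exact map_add (PowerSeries.coeff (R := R) n) (f : PowerSeries R) g
  map_mul' f g := by
    ext n
    rw [PowerSeries.coeff_mk, PowerSeries.coeff_mul, ← evenIncl_apply (∑ _ ∈ _, _), map_sum]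
    refine (PowerSeries.coeff_mul n (f : PowerSeries R) g).trans
      (Finset.sum_congr rfl fun x _ => ?_)
    rw [map_mul, PowerSeries.coeff_mk, PowerSeries.coeff_mk]
    rfl

theorem coeff_evenSeriesEquiv (f : seriesGrading 𝒜 0) (n : ℕ) :
    ((PowerSeries.coeff n (evenSeriesEquiv 𝒜 f) : 𝒜 0) : R) = PowerSeries.coeff n (f : PowerSeries R) :=
  congrArg Subtype.val (PowerSeries.coeff_mk n fun n =>
    (⟨PowerSeries.coeff n (f : PowerSeries R), f.2 n⟩ : 𝒜 0))

theorem charSeries_eq (A : evenMat 𝒜 p q) :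
    charSeries A = evenSeriesEquiv 𝒜 (Ber (onePlusZ A)) := rfl

theorem onePlusZ_apply (A : evenMat 𝒜 p q) (i j : Fin p ⊕ Fin q) :
    (onePlusZ A).1 i j = (1 : Matrix _ _ (PowerSeries R)) i j
      + PowerSeries.X * PowerSeries.C (A.1 i j) := rfl

theorem map_block11_onePlusZ (A : evenMat 𝒜 p q) :
    (evenSeriesEquiv 𝒜).toRingHom.mapMatrix (block11 (onePlusZ A))
      = 1 + (PowerSeries.X : PowerSeries (𝒜 0)) • (block11 A).map PowerSeries.C := by
  ext i j n
  change ((PowerSeries.coeff n (evenSeriesEquiv 𝒜 (block11 (onePlusZ A) i j)) : 𝒜 0) : R) = _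
  rw [coeff_evenSeriesEquiv]
  change PowerSeries.coeff n ((onePlusZ A).1 (Sum.inr i) (Sum.inr j)) = _
  rw [onePlusZ_apply, Matrix.add_apply, Matrix.smul_apply, Matrix.map_apply, smul_eq_mul, map_add,
    map_add, AddSubgroup.coe_add]
  congr 1
  · rw [Matrix.one_apply, Matrix.one_apply]
    by_cases h : i = j
    · rw [if_pos h, if_pos (by rw [h]), PowerSeries.coeff_one, PowerSeries.coeff_one]
      split_ifs <;> rfl
    · rw [if_neg h, if_neg (by simpa using h), map_zero, map_zero]
      rfl
  · rcases n with _ | n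
    · rw [PowerSeries.coeff_zero_X_mul, PowerSeries.coeff_zero_X_mul]
      rfl
    · rw [PowerSeries.coeff_succ_X_mul, PowerSeries.coeff_succ_X_mul, PowerSeries.coeff_C,
        PowerSeries.coeff_C]
      split_ifs <;> rfl

theorem map_block00_onePlusZ (A : evenMat 𝒜 p q) :
    (evenSeriesEquiv 𝒜).toRingHom.mapMatrix (block00 (onePlusZ A))
      = 1 + (PowerSeries.X : PowerSeries (𝒜 0)) • (block00 A).map PowerSeries.C := by
  ext i j n
  change ((PowerSeries.coeff n (evenSeriesEquiv 𝒜 (block00 (onePlusZ A) i j)) : 𝒜 0) : R) = _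
  rw [coeff_evenSeriesEquiv]
  change PowerSeries.coeff n ((onePlusZ A).1 (Sum.inl i) (Sum.inl j)) = _
  rw [onePlusZ_apply, Matrix.add_apply, Matrix.smul_apply, Matrix.map_apply, smul_eq_mul, map_add,
    map_add, AddSubgroup.coe_add]
  congr 1
  · rw [Matrix.one_apply, Matrix.one_apply]
    by_cases h : i = j
    · rw [if_pos h, if_pos (by rw [h]), PowerSeries.coeff_one, PowerSeries.coeff_one]
      split_ifs <;> rfl
    · rw [if_neg h, if_neg (by simpa using h), map_zero, map_zero]
      rfl
  · rcases n with _ | n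
    · rw [PowerSeries.coeff_zero_X_mul, PowerSeries.coeff_zero_X_mul]
      rfl
    · rw [PowerSeries.coeff_succ_X_mul, PowerSeries.coeff_succ_X_mul, PowerSeries.coeff_C,
        PowerSeries.coeff_C]
      split_ifs <;> rfl

theorem constantCoeff_det_one_add_X_smul {S : Type*} [CommRing S] {n : Type*} [Fintype n]
    [DecidableEq n] (M : Matrix n n (PowerSeries S)) :
    PowerSeries.constantCoeff (1 + (PowerSeries.X : PowerSeries S) • M).det = 1 := by
  have h : (PowerSeries.constantCoeff (R := S)).mapMatrix (1 + (PowerSeries.X : PowerSeries S) • M)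
      = 1 := by
    rw [map_add, map_one, add_eq_left]
    ext i j
    simp
  rw [RingHom.map_det, h, Matrix.det_one]

theorem constantCoeff_det_block11_onePlusZ (A : evenMat 𝒜 p q) :
    PowerSeries.constantCoeff (evenSeriesEquiv 𝒜 (block11 (onePlusZ A)).det) = 1 := by
  change PowerSeries.constantCoeff ((evenSeriesEquiv 𝒜).toRingHom (block11 (onePlusZ A)).det) = 1
  rw [RingHom.map_det, map_block11_onePlusZ, constantCoeff_det_one_add_X_smul]

theorem isUnit_det_block11_onePlusZ (A : evenMat 𝒜 p q) : IsUnit (block11 (onePlusZ A)).det := by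
  rw [← MulEquiv.isUnit_map (evenSeriesEquiv 𝒜), PowerSeries.isUnit_iff_constantCoeff,
    constantCoeff_det_block11_onePlusZ]
  exact isUnit_one

end CharSeries

/-! ### The generating function of the traces of exterior powers -/

section TraceFormula

variable {R : Type*} [Ring R] {𝒜 : ZMod 2 → AddSubgroup R} {p q : ℕ} [GradedRing 𝒜]
  [IsSupercommutative 𝒜]

variable (𝒜 p q) in
/-- An even supermatrix over `R`, as a constant one over `R⟦z⟧`. -/
noncomputable def constMat : evenMat 𝒜 p q →+* evenMat (seriesGrading 𝒜) p q where
  toFun A := ⟨A.1.map PowerSeries.C, fun i j => C_mem (A.2 i j)⟩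
  map_one' := Subtype.ext (Matrix.map_one _ (map_zero _) (map_one _))
  map_mul' _ _ := Subtype.ext Matrix.map_mul
  map_zero' := Subtype.ext (Matrix.map_zero _ (map_zero _))
  map_add' _ _ := Subtype.ext (Matrix.map_add _ (map_add _) _ _)

theorem constMat_mul_onePlusZ (U A B : evenMat 𝒜 p q) (h : U * A = B * U) :
    constMat 𝒜 p q U * onePlusZ A = onePlusZ B * constMat 𝒜 p q U := by
  have e : ∀ A : evenMat 𝒜 p q,
      (onePlusZ A).1 = 1 + (PowerSeries.X : PowerSeries R) • (constMat 𝒜 p q A).1 := fun A => rfl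
  have h1 : (constMat 𝒜 p q U).1 * (constMat 𝒜 p q A).1
      = (constMat 𝒜 p q B).1 * (constMat 𝒜 p q U).1 := by
    have := congrArg (constMat 𝒜 p q) h
    rw [map_mul, map_mul] at this
    exact congrArg Subtype.val this
  apply Subtype.ext
  change (constMat 𝒜 p q U).1 * (onePlusZ A).1 = (onePlusZ B).1 * (constMat 𝒜 p q U).1
  rw [e, e, Matrix.mul_add, Matrix.add_mul, Matrix.mul_one, Matrix.one_mul, Matrix.smul_mul, ← h1]
  congr 1
  ext1 i j
  rw [Matrix.smul_apply, Matrix.mul_apply, Matrix.mul_apply, smul_eq_mul, Finset.mul_sum]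
  refine Finset.sum_congr rfl fun k _ => ?_
  rw [Matrix.smul_apply, smul_eq_mul, ← mul_assoc, ← PowerSeries.X_mul, mul_assoc]

theorem charSeries_conj (U : (evenMat 𝒜 p q)ˣ) {A B : evenMat 𝒜 p q}
    (h : (U : evenMat 𝒜 p q) * A = B * U) : charSeries A = charSeries B := by
  have h1 := constMat_mul_onePlusZ _ _ _ h
  set V : (evenMat (seriesGrading 𝒜) p q)ˣ := Units.map (constMat 𝒜 p q).toMonoidHom U with hV
  change (V : evenMat (seriesGrading 𝒜) p q) * onePlusZ A = onePlusZ B * V at h1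
  have hVu := isUnit_det_block11 V
  have h2 := congrArg Ber h1
  rw [Ber_mul _ _ hVu (isUnit_det_block11_onePlusZ A),
    Ber_mul _ _ (isUnit_det_block11_onePlusZ B) hVu, mul_comm] at h2
  have hu : IsUnit (Ber (V : evenMat (seriesGrading 𝒜) p q)) := by
    refine IsUnit.of_mul_eq_one (Ber ((V⁻¹ : _ˣ) : evenMat (seriesGrading 𝒜) p q)) ?_
    rw [← Ber_mul _ _ hVu (isUnit_det_block11 V⁻¹), Units.mul_inv, Ber_one]
  rw [charSeries_eq, charSeries_eq, hu.mul_right_cancel h2]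

/-- `R_A(z) det (1 + z A₁₁) = det (1 + z A₀₀)` for block upper triangular `A`. -/
theorem charSeries_mul_det (A : evenMat 𝒜 p q) (h : ∀ i j, A.1 (Sum.inr i) (Sum.inl j) = 0) :
    charSeries A * (1 + (PowerSeries.X : PowerSeries (𝒜 0)) • (block11 A).map PowerSeries.C).det
      = (1 + (PowerSeries.X : PowerSeries (𝒜 0)) • (block00 A).map PowerSeries.C).det := by
  have h0 : ∀ i j, (onePlusZ A).1 (Sum.inr i) (Sum.inl j) = 0 := fun i j => by
    rw [onePlusZ_apply, h, map_zero, mul_zero, add_zero]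
    exact Matrix.one_apply_ne (by simp)
  rw [charSeries_eq, Ber_of_block_upper _ h0, ← map_block11_onePlusZ,
    ← map_block00_onePlusZ, ← RingHom.map_det, ← RingHom.map_det]
  change evenSeriesEquiv 𝒜 _ * evenSeriesEquiv 𝒜 _ = evenSeriesEquiv 𝒜 _
  rw [← map_mul, mul_assoc, Ring.inverse_mul_cancel _ (isUnit_det_block11_onePlusZ A), mul_one]

theorem det_one_add_X_smul_of_upper {S : Type*} [CommRing S] {n : ℕ} (M : Matrix (Fin n) (Fin n) S)
    (h : ∀ i j, j < i → M i j = 0) :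
    (1 + (PowerSeries.X : PowerSeries S) • M.map PowerSeries.C).det
      = ∏ i, (1 + PowerSeries.X * PowerSeries.C (M i i)) := by
  rw [Matrix.det_of_isUpperTriangular]
  · simp
  · intro i j hij
    have hij : j < i := hij
    simp [h i j hij, Matrix.one_apply_ne hij.ne']

theorem charSeries_of_isUpper {T : evenMat 𝒜 p q} (hT : IsUpper T.1) :
    charSeries T = PowerSeries.mk fun k => trExt T (k : ℤ) := by
  have h1 := charSeries_mul_det T fun i j => hT _ _ (by simp [basisRank]; omega)
  have h2 := mk_trExt_mul_of_isUpper hT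
  have e1 : ∀ i j : Fin q, j < i → block11 T i j = 0 := fun i j hij =>
    Subtype.ext (hT _ _ (by simpa [basisRank] using hij))
  have e0 : ∀ i j : Fin p, j < i → block00 T i j = 0 := fun i j hij =>
    Subtype.ext (hT _ _ (by simpa [basisRank] using hij))
  rw [det_one_add_X_smul_of_upper _ e1, det_one_add_X_smul_of_upper _ e0] at h1
  have hu : IsUnit (∏ j : Fin q, (1 + PowerSeries.X * PowerSeries.C (diagEntry T (Sum.inr j)))) := by
    rw [PowerSeries.isUnit_iff_constantCoeff]
    simp
  exact hu.mul_right_cancel (h1.trans h2.symm)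

/-- `x` is a series in `z` over `R⟦s⟧` whose coefficient of `z^k` has degree at most `N k` in `s`, and
`y` has the coefficients of `s^{N k} z^k`. -/
def HasTopSeries (N : ℕ) (x : PowerSeries (PowerSeries R)) (y : PowerSeries R) : Prop :=
  ∀ k, HasTop (N * k) (PowerSeries.coeff k x) (PowerSeries.coeff k y)

namespace HasTopSeries

variable {N : ℕ} {x x' : PowerSeries (PowerSeries R)} {y y' : PowerSeries R}

theorem add (h : HasTopSeries N x y) (h' : HasTopSeries N x' y') :
    HasTopSeries N (x + x') (y + y') := fun k => by
  rw [map_add, map_add]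
  exact (h k).add (h' k)

theorem neg (h : HasTopSeries N x y) : HasTopSeries N (-x) (-y) := fun k => by
  rw [map_neg, map_neg]
  exact (h k).neg

theorem sum {κ : Type*} (s : Finset κ) {x : κ → PowerSeries (PowerSeries R)}
    {y : κ → PowerSeries R} (h : ∀ k ∈ s, HasTopSeries N (x k) (y k)) :
    HasTopSeries N (∑ k ∈ s, x k) (∑ k ∈ s, y k) := fun m => by
  rw [map_sum, map_sum]
  exact HasTop.sum _ fun k hk => h k hk m

theorem mul (h : HasTopSeries N x y) (h' : HasTopSeries N x' y') :
    HasTopSeries N (x * x') (y * y') := fun k => by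
  rw [PowerSeries.coeff_mul, PowerSeries.coeff_mul]
  refine HasTop.sum _ fun a ha => ?_
  rw [Finset.HasAntidiagonal.mem_antidiagonal] at ha
  rw [← ha, mul_add]
  exact (h _).mul (h' _)

theorem zero (N : ℕ) : HasTopSeries N (0 : PowerSeries (PowerSeries R)) 0 := fun k => by
  rw [map_zero, map_zero]
  exact HasTop.zero _

theorem one (N : ℕ) : HasTopSeries N (1 : PowerSeries (PowerSeries R)) 1 := fun k => by
  rw [PowerSeries.coeff_one, PowerSeries.coeff_one]
  split_ifs with h
  · subst h
    exact HasTop.one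
  · exact HasTop.zero _

theorem X_mul_C {a : PowerSeries R} {b : R} (h : HasTop N a b) :
    HasTopSeries N (PowerSeries.X * PowerSeries.C a) (PowerSeries.X * PowerSeries.C b) :=
  fun k => by
    rcases k with _ | _ | k
    · simp [HasTop.zero]
    · simpa using h
    · rw [PowerSeries.coeff_succ_X_mul, PowerSeries.coeff_succ_X_mul, PowerSeries.coeff_C,
        PowerSeries.coeff_C, if_neg (by omega), if_neg (by omega)]
      exact HasTop.zero _

/-- The relation passes to inverses of series with constant term `1`, as the coefficients of the
inverse are computed recursively. -/
theorem inverse {u v : PowerSeries (PowerSeries R)} {u' v' : PowerSeries R}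
    (h : HasTopSeries N u u') (hu : PowerSeries.coeff 0 u = 1) (hu' : PowerSeries.coeff 0 u' = 1)
    (huv : u * v = 1) (huv' : u' * v' = 1) : HasTopSeries N v v' := fun k => by
  induction k using Nat.strong_induction_on with
  | _ k ih =>
    have e : v = 1 + -((u + -1) * v) := by
      rw [add_mul, huv]
      simp
    have e' : v' = 1 + -((u' + -1) * v') := by
      rw [add_mul, huv']
      simp
    rw [e, e', map_add, map_add, map_neg, map_neg]
    refine (HasTopSeries.one N k).add (HasTop.neg ?_)
    rw [PowerSeries.coeff_mul, PowerSeries.coeff_mul]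
    refine HasTop.sum _ fun a ha => ?_
    rw [Finset.HasAntidiagonal.mem_antidiagonal] at ha
    rw [← ha, mul_add]
    rcases Nat.eq_zero_or_pos a.1 with h0 | h0
    · rw [h0]
      have z : PowerSeries.coeff 0 (u + -1) = 0 := by
        rw [map_add, hu]
        simp
      have z' : PowerSeries.coeff 0 (u' + -1) = 0 := by
        rw [map_add, hu']
        simp
      rw [z, z', zero_mul, zero_mul]
      exact HasTop.zero _
    · exact (h.add (HasTopSeries.one N).neg a.1).mul (ih a.2 (by omega))

end HasTopSeries

variable (𝒜) in
/-- The pairs of even series that are related by `HasTopSeries`. -/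
noncomputable def topPairs (N : ℕ) :
    Subring (seriesGrading (seriesGrading 𝒜) 0 × seriesGrading 𝒜 0) where
  carrier := {x | HasTopSeries N (x.1 : PowerSeries (PowerSeries R)) (x.2 : PowerSeries R)}
  zero_mem' := HasTopSeries.zero N
  one_mem' := HasTopSeries.one N
  add_mem' ha hb := HasTopSeries.add ha hb
  neg_mem' ha := HasTopSeries.neg ha
  mul_mem' ha hb := HasTopSeries.mul ha hb

section PairMatrix

variable {S S' : Type*} [CommRing S] [CommRing S'] {n : Type*} [Fintype n] [DecidableEq n]
  {L : Subring (S × S')} {M : Matrix n n S} {M' : Matrix n n S'}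

theorem det_mem_pairs (h : ∀ i j, (M i j, M' i j) ∈ L) : (M.det, M'.det) ∈ L := by
  let P : Matrix n n L := fun i j => ⟨(M i j, M' i j), h i j⟩
  have e : ((P.det : L) : S × S') = (M.det, M'.det) := by
    refine Prod.ext ?_ ?_
    · exact RingHom.map_det ((RingHom.fst S S').comp L.subtype) P
    · exact RingHom.map_det ((RingHom.snd S S').comp L.subtype) P
  rw [← e]
  exact P.det.2

theorem adjugate_mem_pairs (h : ∀ i j, (M i j, M' i j) ∈ L) (i j : n) :
    (M.adjugate i j, M'.adjugate i j) ∈ L := by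
  let P : Matrix n n L := fun i j => ⟨(M i j, M' i j), h i j⟩
  have e : ((P.adjugate i j : L) : S × S') = (M.adjugate i j, M'.adjugate i j) := by
    refine Prod.ext ?_ ?_
    · exact congrFun (congrFun (RingHom.map_adjugate ((RingHom.fst S S').comp L.subtype) P) i) j
    · exact congrFun (congrFun (RingHom.map_adjugate ((RingHom.snd S S').comp L.subtype) P) i) j
  rw [← e]
  exact (P.adjugate i j).2

theorem inv_mem_pairs (h : ∀ i j, (M i j, M' i j) ∈ L)
    (hd : (Ring.inverse M.det, Ring.inverse M'.det) ∈ L) (i j : n) : (M⁻¹ i j, M'⁻¹ i j) ∈ L := by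
  rw [Matrix.inv_def, Matrix.inv_def]
  exact L.mul_mem hd (adjugate_mem_pairs h i j)

theorem det_sub_mul_mem_pairs {K : Matrix n n S} {K' : Matrix n n S'} {d : S} {d' : S'}
    (h : ∀ i j, (M i j, M' i j) ∈ L) (hK : ∀ i j, (K i j, K' i j) ∈ L) (hd : (d, d') ∈ L) :
    ((M - K).det * d, (M' - K').det * d') ∈ L :=
  L.mul_mem (det_mem_pairs fun i j => L.sub_mem (h i j) (hK i j)) hd

end PairMatrix

theorem coeff_zero_det_block11_onePlusZ (A : evenMat 𝒜 p q) :
    PowerSeries.coeff 0 ((block11 (onePlusZ A)).det : PowerSeries R) = 1 := by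
  rw [← coeff_evenSeriesEquiv, PowerSeries.coeff_zero_eq_constantCoeff_apply,
    constantCoeff_det_block11_onePlusZ]
  rfl

theorem HasTop.onePlusZ {N : ℕ} {A : evenMat 𝒜 p q} {B : evenMat (seriesGrading 𝒜) p q}
    (h : ∀ i j, HasTop N (B.1 i j) (A.1 i j)) (i j : Fin p ⊕ Fin q) :
    HasTopSeries N ((onePlusZ B).1 i j) ((onePlusZ A).1 i j) := by
  rw [onePlusZ_apply, onePlusZ_apply, Matrix.one_apply, Matrix.one_apply]
  refine HasTopSeries.add ?_ (HasTopSeries.X_mul_C (h i j))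
  split_ifs
  · exact HasTopSeries.one N
  · exact HasTopSeries.zero N

theorem HasTopSeries.oddBlockProd {N : ℕ} {M : evenMat (seriesGrading (seriesGrading 𝒜)) p q}
    {M' : evenMat (seriesGrading 𝒜) p q} (h : ∀ i j, HasTopSeries N (M.1 i j) (M'.1 i j))
    {K : Matrix (Fin q) (Fin q) (seriesGrading (seriesGrading 𝒜) 0)}
    {K' : Matrix (Fin q) (Fin q) (seriesGrading 𝒜 0)}
    (hK : ∀ i j, HasTopSeries N (K i j : PowerSeries (PowerSeries R)) (K' i j : PowerSeries R))
    (i j : Fin p) :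
    HasTopSeries N (oddBlockProd M K i j : PowerSeries (PowerSeries R))
      (oddBlockProd M' K' i j : PowerSeries R) := by
  change HasTopSeries N
    (∑ k, ∑ l, M.1 (Sum.inl i) (Sum.inr k) * (K k l : PowerSeries (PowerSeries R))
      * M.1 (Sum.inr l) (Sum.inl j))
    (∑ k, ∑ l, M'.1 (Sum.inl i) (Sum.inr k) * (K' k l : PowerSeries R)
      * M'.1 (Sum.inr l) (Sum.inl j))
  exact HasTopSeries.sum _ fun k _ => HasTopSeries.sum _ fun l _ =>
    ((h (Sum.inl i) (Sum.inr k)).mul (hK k l)).mul (h (Sum.inr l) (Sum.inl j))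

theorem Ber_onePlusZ_mem_topPairs {N : ℕ} {A : evenMat 𝒜 p q} {B : evenMat (seriesGrading 𝒜) p q}
    (h : ∀ i j, HasTop N (B.1 i j) (A.1 i j)) :
    (Ber (onePlusZ B), Ber (onePlusZ A)) ∈ topPairs 𝒜 N := by
  have h1 := HasTop.onePlusZ h
  have h11 : ∀ i j, (block11 (onePlusZ B) i j, block11 (onePlusZ A) i j) ∈ topPairs 𝒜 N :=
    fun i j => h1 _ _
  have hd := det_mem_pairs h11
  have hi : (Ring.inverse (block11 (onePlusZ B)).det, Ring.inverse (block11 (onePlusZ A)).det)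
      ∈ topPairs 𝒜 N :=
    HasTopSeries.inverse hd (coeff_zero_det_block11_onePlusZ B) (coeff_zero_det_block11_onePlusZ A)
      (congrArg Subtype.val (Ring.mul_inverse_cancel _ (isUnit_det_block11_onePlusZ B)))
      (congrArg Subtype.val (Ring.mul_inverse_cancel _ (isUnit_det_block11_onePlusZ A)))
  have hinv : ∀ i j, ((block11 (onePlusZ B))⁻¹ i j, (block11 (onePlusZ A))⁻¹ i j)
      ∈ topPairs 𝒜 N := inv_mem_pairs h11 hi
  have hp : ∀ i j, (oddBlockProd (onePlusZ B) (block11 (onePlusZ B))⁻¹ i j,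
      oddBlockProd (onePlusZ A) (block11 (onePlusZ A))⁻¹ i j) ∈ topPairs 𝒜 N := HasTopSeries.oddBlockProd h1 hinv
  have h00 : ∀ i j, (block00 (onePlusZ B) i j, block00 (onePlusZ A) i j) ∈ topPairs 𝒜 N :=
    fun i j => h1 _ _
  exact det_sub_mul_mem_pairs h00 hp hi

theorem HasTop.charSeries {N : ℕ} {A : evenMat 𝒜 p q} {B : evenMat (seriesGrading 𝒜) p q}
    (h : ∀ i j, HasTop N (B.1 i j) (A.1 i j)) (k : ℕ) :
    HasTop (N * k) ((PowerSeries.coeff k (charSeries B) : seriesGrading 𝒜 0) : PowerSeries R)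
      ((PowerSeries.coeff k (charSeries A) : 𝒜 0) : R) := by
  rw [charSeries_eq, charSeries_eq]
  have := Ber_onePlusZ_mem_topPairs h k
  rwa [← coeff_evenSeriesEquiv, ← coeff_evenSeriesEquiv] at this

/-- The characteristic function is the generating function of the traces `Tr Λᵏ A`. It holds for
triangular matrices, and both sides are polynomial in the entries of `A`, so it can be read off the
top coefficients for a deformation of `A` that is conjugate to a triangular matrix. -/
theorem charSeries_eq_mk_trExt (A : evenMat 𝒜 p q) :
    charSeries A = PowerSeries.mk fun k => trExt A (k : ℤ) := by
  obtain ⟨U, T, hT, hU⟩ := exists_triangular_deformation A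
  have h := (charSeries_conj U hU).trans (charSeries_of_isUpper hT)
  ext k
  have h1 := HasTop.charSeries (hasTop_deformation A) k
  have h2 := HasTop.trExt (hasTop_deformation A) k
  rw [h, PowerSeries.coeff_mk, ← trExt_conj U hU] at h1
  rw [PowerSeries.coeff_mk]
  exact h1.unique h2

end TraceFormula

/-! ### Laurent polynomials acting on two-sided sequences -/

section Sequences

open Polynomial LaurentPolynomial

variable {S : Type*} [CommRing S]

/-- Translation of two-sided sequences, as a representation of `ℤ`. -/
def seqShift (S : Type*) [CommRing S] : Multiplicative ℤ →* Module.End S (ℤ → S) where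
  toFun n := LinearMap.funLeft S S fun k => k - n.toAdd
  map_one' := by
    ext1 s
    funext k
    simp [LinearMap.funLeft_apply]
  map_mul' m n := by
    ext1 s
    funext k
    simp [LinearMap.funLeft_apply, sub_sub]

/-- The action of Laurent polynomials on two-sided sequences for which `T` is the translation
`s ↦ (k ↦ s (k - 1))`; a sequence satisfies a linear recurrence iff a polynomial kills it. -/
noncomputable def seqAct (S : Type*) [CommRing S] : S[T;T⁻¹] →ₐ[S] Module.End S (ℤ → S) :=
  AddMonoidAlgebra.lift S (Module.End S (ℤ → S)) ℤ (seqShift S)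

theorem seqAct_T (n : ℤ) (s : ℤ → S) (k : ℤ) : seqAct S (T n) s k = s (k - n) := by
  unfold seqAct T
  rw [AddMonoidAlgebra.lift_single, one_smul]
  rfl

theorem seqAct_C (a : S) (s : ℤ → S) : seqAct S (LaurentPolynomial.C a) s = a • s := by
  rw [LaurentPolynomial.C_eq_algebraMap, AlgHom.commutes]
  rfl

theorem seqAct_mul (f g : S[T;T⁻¹]) (s : ℤ → S) : seqAct S (f * g) s = seqAct S f (seqAct S g s) := by
  rw [map_mul]
  rfl

theorem seqAct_comm (f g : S[T;T⁻¹]) (s : ℤ → S) :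
    seqAct S f (seqAct S g s) = seqAct S g (seqAct S f s) := by
  rw [← seqAct_mul, mul_comm, seqAct_mul]

theorem seqAct_toLaurent (f : S[X]) {n : ℕ} (hn : f.natDegree ≤ n) (s : ℤ → S) (k : ℤ) :
    seqAct S (toLaurent f) s k = ∑ i ∈ Finset.range (n + 1), f.coeff i * s (k - i) := by
  conv_lhs => rw [f.as_sum_range' (n + 1) (by omega)]
  simp only [← C_mul_X_pow_eq_monomial, map_sum, LinearMap.sum_apply, Finset.sum_apply,
    toLaurent_C_mul_X_pow, seqAct_mul, seqAct_C, Pi.smul_apply, smul_eq_mul, seqAct_T]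

/-- The sequence of coefficients of a power series, continued by zero. -/
noncomputable def seriesSeq (f : PowerSeries S) (k : ℤ) : S :=
  if 0 ≤ k then PowerSeries.coeff k.toNat f else 0

theorem seriesSeq_natCast (f : PowerSeries S) (n : ℕ) : seriesSeq f n = PowerSeries.coeff n f := by
  simp [seriesSeq]

theorem seriesSeq_of_neg (f : PowerSeries S) {k : ℤ} (hk : k < 0) : seriesSeq f k = 0 :=
  if_neg (by omega)

theorem seriesSeq_X_mul (f : PowerSeries S) (k : ℤ) :
    seriesSeq (PowerSeries.X * f) k = seriesSeq f (k - 1) := by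
  rcases lt_trichotomy k 0 with hk | rfl | hk
  · rw [seriesSeq_of_neg _ hk, seriesSeq_of_neg _ (by omega)]
  · rw [seriesSeq_of_neg f (by omega)]
    simp [seriesSeq]
  · obtain ⟨n, rfl⟩ : ∃ n : ℕ, k = (n + 1 : ℕ) := ⟨(k - 1).toNat, by omega⟩
    rw [seriesSeq_natCast, PowerSeries.coeff_succ_X_mul]
    push_cast
    rw [add_sub_cancel_right, seriesSeq_natCast]

theorem seqAct_seriesSeq (f : S[X]) (g : PowerSeries S) :
    seqAct S (toLaurent f) (seriesSeq g) = seriesSeq ((f : PowerSeries S) * g) := by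
  induction f using Polynomial.induction_on' generalizing g with
  | add f₁ f₂ h₁ h₂ =>
    rw [map_add, map_add, LinearMap.add_apply, h₁, h₂, Polynomial.coe_add, add_mul]
    funext k
    simp only [Pi.add_apply, seriesSeq]
    split_ifs <;> simp
  | monomial n a =>
    induction n generalizing g with
    | zero =>
      rw [monomial_zero_left, toLaurent_C, seqAct_C, Polynomial.coe_C]
      funext k
      simp only [Pi.smul_apply, seriesSeq]
      split_ifs <;> simp
    | succ n ih =>
      have e : (monomial (n + 1) a : S[X]) = X * monomial n a := by rw [X_mul_monomial]
      rw [e, map_mul, seqAct_mul, ih, Polynomial.coe_mul, Polynomial.coe_X, mul_assoc, toLaurent_X]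
      funext k
      rw [seqAct_T, seriesSeq_X_mul]

/-- The reflection of a sequence. -/
def seqRev (s : ℤ → S) (k : ℤ) : S := s (-k)

theorem seqRev_seqAct (f : S[T;T⁻¹]) (s : ℤ → S) :
    seqRev (seqAct S f s) = seqAct S (invert f) (seqRev s) := by
  induction f using LaurentPolynomial.induction_on' with
  | add f g hf hg =>
    rw [map_add, map_add, map_add, LinearMap.add_apply, LinearMap.add_apply, ← hf, ← hg]
    rfl
  | C_mul_T n a =>
    rw [map_mul invert, invert_C, invert_T, seqAct_mul, seqAct_mul, seqAct_C, seqAct_C]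
    funext k
    rw [Pi.smul_apply, seqAct_T]
    simp only [seqRev, Pi.smul_apply, seqAct_T]
    congr 2
    ring

/-- A sequence that vanishes far to the right and satisfies a recurrence whose trailing coefficient
is a unit vanishes. -/
theorem eq_zero_of_seqAct_eq_zero {f : S[X]} {n : ℕ} (hn : f.natDegree ≤ n)
    (hu : IsUnit (f.coeff n)) {s : ℤ → S} (hs : seqAct S (toLaurent f) s = 0) {N : ℤ}
    (hN : ∀ k, N ≤ k → s k = 0) : s = 0 := by
  have H : ∀ m : ℕ, ∀ k, N - m ≤ k → s k = 0 := by
    intro m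
    induction m with
    | zero => simpa using hN
    | succ m ih =>
      intro k hk
      have h := congrFun hs (k + n)
      rw [seqAct_toLaurent f hn, Finset.sum_range_succ, Finset.sum_eq_zero, zero_add,
        add_sub_cancel_right] at h
      · exact (hu.mul_right_eq_zero).1 h
      · intro i hi
        rw [ih _ (by have := Finset.mem_range.1 hi; push_cast at hk; omega), mul_zero]
  funext k
  exact H (N - k).toNat k (by omega)

/-- A matrix with a vector in its kernel that has a coordinate `1` has determinant zero. -/
theorem det_eq_zero_of_mulVec {n : Type*} [Fintype n] [DecidableEq n] {M : Matrix n n S} {v : n → S}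
    (h : M.mulVec v = 0) (i : n) (hv : v i = 1) : M.det = 0 := by
  have h1 : M.adjugate.mulVec (M.mulVec v) = 0 := by rw [h, Matrix.mulVec_zero]
  rw [Matrix.mulVec_mulVec, Matrix.adjugate_mul, Matrix.smul_mulVec, Matrix.one_mulVec] at h1
  simpa [hv] using congrFun h1 i

/-- If a sequence satisfies a recurrence of order `q` to the right of `N`, its Hankel-type
determinants of order `q + 1` with rows to the right of `N` vanish. -/
theorem det_rows_eq_zero_of_recurrence {q : ℕ} {f : S[X]} (hq : f.natDegree ≤ q)
    (h0 : f.coeff 0 = 1) {s : ℤ → S} {N : ℤ} (hs : ∀ k, N < k → seqAct S (toLaurent f) s k = 0)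
    {k : Fin (q + 1) → ℤ} (hk : ∀ i, N < k i) :
    (Matrix.of fun i j : Fin (q + 1) => s (k i + (j : ℕ))).det = 0 := by
  refine det_eq_zero_of_mulVec (v := fun j => f.coeff (q - j)) ?_ (Fin.last q) (by simpa using h0)
  funext i
  have h := hs (k i + q) (by have := hk i; omega)
  rw [seqAct_toLaurent f hq, ← Finset.sum_range_reflect, Finset.sum_range] at h
  refine Eq.trans ?_ h
  change ∑ j : Fin (q + 1), s (k i + (j : ℕ)) * f.coeff (q - j) = _
  refine Finset.sum_congr rfl fun j _ => ?_
  rw [mul_comm, Nat.add_sub_cancel]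
  congr 2
  omega

/-- The vanishing of the determinants with rows far to the right propagates to all rows. -/
theorem det_rows_eq_zero_of_eventually {m : ℕ} {f : S[X]} {n : ℕ} (hn : f.natDegree ≤ n)
    (hu : IsUnit (f.coeff n)) {s : ℤ → S} (hs : seqAct S (toLaurent f) s = 0) {N : ℤ}
    (hN : ∀ k : Fin m → ℤ, (∀ i, N ≤ k i) →
      (Matrix.of fun i j : Fin m => s (k i + (j : ℕ))).det = 0) (k : Fin m → ℤ) :
    (Matrix.of fun i j : Fin m => s (k i + (j : ℕ))).det = 0 := by
  suffices H : ∀ I : Finset (Fin m), ∀ k : Fin m → ℤ, (∀ i ∉ I, N ≤ k i) →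
      (Matrix.of fun i j : Fin m => s (k i + (j : ℕ))).det = 0 from
    H Finset.univ k fun i hi => absurd (Finset.mem_univ i) hi
  intro I
  induction I using Finset.induction_on with
  | empty => exact fun k hk => hN k fun i => hk i (Finset.notMem_empty i)
  | insert a I ha ih =>
    intro k hk
    set M : Matrix (Fin m) (Fin m) S := Matrix.of fun i j : Fin m => s (k i + (j : ℕ)) with hM
    -- the determinant as a function of the index of the row `a` satisfies the recurrence
    let y : ℤ → S := fun t => (M.updateRow a fun j => s (t + (j : ℕ))).det
    have hyt : ∀ t, y t = (Matrix.of fun i j : Fin m => s (Function.update k a t i + (j : ℕ))).det := by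
      intro t
      refine congrArg Matrix.det ?_
      ext i j
      rcases eq_or_ne i a with rfl | hi
      · simp
      · simp [hi, hM]
    have hy : seqAct S (toLaurent f) y = 0 := by
      funext t
      rw [seqAct_toLaurent f hn]
      have e : ∀ t, y t = (Matrix.detRowAlternating (R := S)).toMultilinearMap.toLinearMap M a
          fun j : Fin m => s (t + (j : ℕ)) := fun t => rfl
      simp only [e, ← smul_eq_mul, ← map_smul, ← map_sum]
      refine (congrArg _ ?_).trans (map_zero _)
      funext j
      have h := congrFun hs (t + (j : ℕ))
      rw [seqAct_toLaurent f hn] at h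
      rw [Finset.sum_apply]
      refine Eq.trans ?_ h
      refine Finset.sum_congr rfl fun i _ => ?_
      rw [Pi.smul_apply, smul_eq_mul]
      congr 2
      ring
    have hz := eq_zero_of_seqAct_eq_zero hn hu hy (N := N) fun t ht => by
      rw [hyt]
      refine ih _ fun i hi => ?_
      rcases eq_or_ne i a with rfl | hia
      · rwa [Function.update_self]
      · rw [Function.update_of_ne hia]
        exact hk i (by simp [hi, hia])
    have := congrFun hz (k a)
    rw [hyt, Function.update_eq_self] at this
    exact this

end Sequences

/-! ### The Berezinian of a pencil `x + y A` as a fraction -/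

section Pencil

variable {R : Type*} [Ring R] {𝒜 : ZMod 2 → AddSubgroup R} {p q : ℕ} [GradedRing 𝒜]
  [IsSupercommutative 𝒜]

/-- The product of an entry of `A₀₁` and an entry of `A₁₀`, an even element. -/
def oddEntryProd (A : evenMat 𝒜 p q) (i j : Fin p) (k l : Fin q) : 𝒜 0 :=
  ⟨A.1 (Sum.inl i) (Sum.inr k) * A.1 (Sum.inr l) (Sum.inl j),
    odd_mul_odd_mem (block01_odd A i k) (block10_odd A l j)⟩

theorem oddBlockProd_apply_eq (A : evenMat 𝒜 p q) (N : Matrix (Fin q) (Fin q) (𝒜 0))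
    (i j : Fin p) : oddBlockProd A N i j = ∑ k, ∑ l, N k l * oddEntryProd A i j k l := by
  apply evenIncl_injective (𝒜 := 𝒜)
  simp only [map_sum, map_mul, evenIncl_apply]
  change ∑ k : Fin q, ∑ l : Fin q, A.1 (Sum.inl i) (Sum.inr k) * (N k l : R)
    * A.1 (Sum.inr l) (Sum.inl j) = ∑ k : Fin q, ∑ l : Fin q, (N k l : R)
    * (A.1 (Sum.inl i) (Sum.inr k) * A.1 (Sum.inr l) (Sum.inl j))
  refine Finset.sum_congr rfl fun k _ => Finset.sum_congr rfl fun l _ => ?_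
  rw [← mul_assoc, even_mul_comm (N k l).2 (A.2 _ _)]

theorem Ber_mul_det_pow (M : evenMat 𝒜 p q) (h : IsUnit (block11 M).det) :
    Ber M * (block11 M).det ^ (p + 1) = (Matrix.of fun i j =>
      (block11 M).det * block00 M i j
        - ∑ k, ∑ l, (block11 M).adjugate k l * oddEntryProd M i j k l).det := by
  have e : (Matrix.of fun i j => (block11 M).det * block00 M i j
      - ∑ k, ∑ l, (block11 M).adjugate k l * oddEntryProd M i j k l)
      = (block11 M).det • (block00 M - oddBlockProd M (block11 M)⁻¹) := by
    ext1 i j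
    rw [Matrix.smul_apply, Matrix.sub_apply, oddBlockProd_apply_eq, smul_eq_mul, mul_sub,
      Finset.mul_sum, Matrix.of_apply]
    congr 1
    refine Finset.sum_congr rfl fun k _ => ?_
    rw [Finset.mul_sum]
    refine Finset.sum_congr rfl fun l _ => ?_
    rw [Matrix.inv_def, Matrix.smul_apply, smul_eq_mul, ← mul_assoc, ← mul_assoc,
      Ring.mul_inverse_cancel _ h, one_mul]
  rw [e, Matrix.det_smul, Fintype.card_fin, Ber, pow_succ]
  linear_combination ((block00 M - oddBlockProd M (block11 M)⁻¹).det * (block11 M).det ^ p)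
    * Ring.inverse_mul_cancel _ h

section Fraction

variable {T T' : Type*} [CommRing T] [CommRing T'] (f : 𝒜 0 →+* T) (A : evenMat 𝒜 p q)

/-- The lower right block of the pencil `x + y A`, over a ring `T` that receives `R₀`. -/
def pencil11 (x y : T) : Matrix (Fin q) (Fin q) T := x • 1 + y • (block11 A).map f

/-- The denominator `det (x + y A₁₁)^(p + 1)` of `Ber (x + y A)`. -/
def pencilDen (x y : T) : T := (pencil11 f A x y).det ^ (p + 1)

/-- The numerator of `Ber (x + y A)` that goes with the denominator `det (x + y A₁₁)^(p + 1)`: the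
inverse of `x + y A₁₁` is replaced by the adjugate. -/
def pencilNum (x y : T) : T :=
  (Matrix.of fun i j : Fin p =>
    (pencil11 f A x y).det * (x * (1 : Matrix (Fin p) (Fin p) T) i j + y * f (block00 A i j))
      - ∑ k, ∑ l, (pencil11 f A x y).adjugate k l * (y ^ 2 * f (oddEntryProd A i j k l))).det

variable {f A}

theorem map_pencil11 (φ : T →+* T') (x y : T) :
    φ.mapMatrix (pencil11 f A x y) = pencil11 (φ.comp f) A (φ x) (φ y) := by
  ext i j
  simp [pencil11, Matrix.one_apply, apply_ite φ]

theorem map_pencilDen (φ : T →+* T') (x y : T) :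
    φ (pencilDen f A x y) = pencilDen (φ.comp f) A (φ x) (φ y) := by
  rw [pencilDen, pencilDen, map_pow, RingHom.map_det, map_pencil11]

theorem map_pencilNum (φ : T →+* T') (x y : T) :
    φ (pencilNum f A x y) = pencilNum (φ.comp f) A (φ x) (φ y) := by
  rw [pencilNum, pencilNum, RingHom.map_det]
  congr 1
  ext i j
  have h := RingHom.map_adjugate φ (pencil11 f A x y)
  rw [map_pencil11] at h
  simp only [RingHom.mapMatrix_apply, Matrix.map_apply, Matrix.of_apply, map_sub, map_mul, map_add,
    map_sum, map_pow, RingHom.comp_apply, RingHom.map_det, Matrix.one_apply, apply_ite φ, map_one,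
    map_zero, ← h]
  rw [← RingHom.mapMatrix_apply, map_pencil11]

theorem pencil11_mul (t x y : T) : pencil11 f A (t * x) (t * y) = t • pencil11 f A x y := by
  rw [pencil11, pencil11, smul_add, smul_smul, smul_smul]

theorem pencilDen_mul (t x y : T) :
    pencilDen f A (t * x) (t * y) = t ^ (q * (p + 1)) * pencilDen f A x y := by
  rw [pencilDen, pencilDen, pencil11_mul, Matrix.det_smul, Fintype.card_fin, mul_pow, pow_mul]

theorem pencilNum_mul (t x y : T) :
    pencilNum f A (t * x) (t * y) = t ^ ((q + 1) * p) * pencilNum f A x y := by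
  rw [pencilNum, pencilNum, pow_mul]
  refine Eq.trans ?_ ((Matrix.det_smul _ _).trans (by rw [Fintype.card_fin]))
  congr 1
  ext i j
  rw [pencil11_mul, Matrix.adjugate_smul, Matrix.det_smul, Matrix.smul_apply, Matrix.of_apply,
    Matrix.of_apply, Fintype.card_fin, smul_eq_mul, mul_sub, Finset.mul_sum]
  congr 1
  · ring
  · refine Finset.sum_congr rfl fun k _ => ?_
    rw [Finset.mul_sum]
    refine Finset.sum_congr rfl fun l _ => ?_
    rw [Matrix.smul_apply, smul_eq_mul]
    obtain ⟨n, rfl⟩ : ∃ n, q = n + 1 := ⟨q - 1, by have := k.2; omega⟩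
    rw [Nat.add_sub_cancel]
    ring

/-- If an even supermatrix `M` is `x + y A`, where both may be compared in a ring `T`, then its
Berezinian is the fraction `pencilNum / pencilDen`. -/
theorem map_Ber_mul_pencilDen {R' : Type*} [Ring R'] {ℬ : ZMod 2 → AddSubgroup R'} [GradedRing ℬ]
    [IsSupercommutative ℬ] {M : evenMat ℬ p q} (e : ℬ 0 →+* T) {x y : T}
    (hM : IsUnit (block11 M).det) (h00 : ∀ i j, e (block00 M i j)
      = x * (1 : Matrix (Fin p) (Fin p) T) i j + y * f (block00 A i j))
    (h11 : ∀ i j, e (block11 M i j)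
      = x * (1 : Matrix (Fin q) (Fin q) T) i j + y * f (block11 A i j))
    (hodd : ∀ i j k l, e (oddEntryProd M i j k l) = y ^ 2 * f (oddEntryProd A i j k l)) :
    e (Ber M) * pencilDen f A x y = pencilNum f A x y := by
  have h : e.mapMatrix (block11 M) = pencil11 f A x y := by
    ext i j
    exact h11 i j
  have h1 := congrArg e (Ber_mul_det_pow M hM)
  rw [map_mul, map_pow, RingHom.map_det, RingHom.map_det, h] at h1
  rw [pencilDen, h1, pencilNum]
  congr 1
  ext i j
  have h' := RingHom.map_adjugate e (block11 M)
  rw [h] at h'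
  simp only [RingHom.mapMatrix_apply, Matrix.map_apply, Matrix.of_apply, map_sub, map_mul, map_sum,
    h00, hodd, RingHom.map_det, ← h']
  rw [← RingHom.mapMatrix_apply, h]

end Fraction

theorem Ber_mul_pencilDen (A : evenMat 𝒜 p q) (h : IsUnit (block11 A).det) :
    Ber A * pencilDen (RingHom.id _) A 0 1 = pencilNum (RingHom.id _) A 0 1 :=
  map_Ber_mul_pencilDen (RingHom.id _) h (by simp) (by simp) (by simp)

theorem coe_evenSeriesEquiv_symm_C (a : 𝒜 0) :
    ((evenSeriesEquiv 𝒜).symm (PowerSeries.C a) : PowerSeries R) = PowerSeries.C (a : R) := by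
  ext n
  rw [← coeff_evenSeriesEquiv, RingEquiv.apply_symm_apply, PowerSeries.coeff_C, PowerSeries.coeff_C]
  split_ifs <;> rfl

theorem coe_evenSeriesEquiv_symm_X :
    ((evenSeriesEquiv 𝒜).symm PowerSeries.X : PowerSeries R) = PowerSeries.X := by
  ext n
  rw [← coeff_evenSeriesEquiv, RingEquiv.apply_symm_apply, PowerSeries.coeff_X, PowerSeries.coeff_X]
  split_ifs <;> rfl

/-- The fraction `Ber (x + y A)` for `x + y A` with entries in `R⟦z⟧`. -/
theorem evenSeriesEquiv_Ber_mul_pencilDen {A : evenMat 𝒜 p q} {M : evenMat (seriesGrading 𝒜) p q}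
    {x y : seriesGrading 𝒜 0} (h : IsUnit (block11 M).det)
    (hM : ∀ i j, M.1 i j = (x : PowerSeries R) * (1 : Matrix _ _ (PowerSeries R)) i j
      + (y : PowerSeries R) * PowerSeries.C (A.1 i j)) :
    evenSeriesEquiv 𝒜 (Ber M)
        * pencilDen PowerSeries.C A (evenSeriesEquiv 𝒜 x) (evenSeriesEquiv 𝒜 y)
      = pencilNum PowerSeries.C A (evenSeriesEquiv 𝒜 x) (evenSeriesEquiv 𝒜 y) := by
  have key : ∀ {n : ℕ} (B : Matrix (Fin n) (Fin n) (seriesGrading 𝒜 0))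
      (B' : Matrix (Fin n) (Fin n) (𝒜 0)) (i j : Fin n),
      (B i j : PowerSeries R) = x * (1 : Matrix (Fin n) (Fin n) (PowerSeries R)) i j
        + y * PowerSeries.C (B' i j : R) →
      evenSeriesEquiv 𝒜 (B i j) = evenSeriesEquiv 𝒜 x
        * (1 : Matrix (Fin n) (Fin n) (PowerSeries (𝒜 0))) i j
        + evenSeriesEquiv 𝒜 y * PowerSeries.C (B' i j) := by
    intro n B B' i j hB
    have e : B i j = x * (1 : Matrix (Fin n) (Fin n) (seriesGrading 𝒜 0)) i j
        + y * (evenSeriesEquiv 𝒜).symm (PowerSeries.C (B' i j)) := by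
      apply evenIncl_injective (𝒜 := seriesGrading 𝒜)
      rw [map_add, map_mul, map_mul]
      simp only [evenIncl_apply, coe_evenSeriesEquiv_symm_C, hB, Matrix.one_apply]
      split_ifs <;> rfl
    rw [e, map_add, map_mul, map_mul, RingEquiv.apply_symm_apply, Matrix.one_apply,
      Matrix.one_apply]
    split_ifs <;> simp
  refine map_Ber_mul_pencilDen (evenSeriesEquiv 𝒜).toRingHom h
    (fun i j => key _ _ i j ?_) (fun i j => key _ _ i j ?_) fun i j k l => ?_
  · refine (hM _ _).trans ?_
    simp [Matrix.one_apply, block00]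
  · refine (hM _ _).trans ?_
    simp [Matrix.one_apply, block11]
  · have e : oddEntryProd M i j k l
        = y ^ 2 * (evenSeriesEquiv 𝒜).symm (PowerSeries.C (oddEntryProd A i j k l)) := by
      apply evenIncl_injective (𝒜 := seriesGrading 𝒜)
      rw [map_mul, map_pow]
      simp only [evenIncl_apply, coe_evenSeriesEquiv_symm_C]
      change M.1 _ _ * M.1 _ _ = _ * PowerSeries.C (A.1 _ _ * A.1 _ _)
      rw [hM, hM, Matrix.one_apply_ne (by simp), Matrix.one_apply_ne (by simp), mul_zero, zero_add,
        zero_add, map_mul, pow_two, mul_assoc, mul_assoc, ← mul_assoc (PowerSeries.C _),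
        ← even_mul_comm (𝒜 := seriesGrading 𝒜) y.2 (C_mem (A.2 _ _)), mul_assoc]
    rw [e]
    change evenSeriesEquiv 𝒜 _ = _
    rw [map_mul, map_pow, RingEquiv.apply_symm_apply]

end Pencil

/-! ### Duality -/

section Duality

variable {R : Type*} [Ring R] {𝒜 : ZMod 2 → AddSubgroup R} {p q : ℕ} [GradedRing 𝒜]
  [IsSupercommutative 𝒜]

theorem block00_supertranspose (M : evenMat 𝒜 p q) :
    block00 (supertranspose M) = (block00 M).transpose := by
  ext i j
  simp [block00, supertranspose, idxParity, paritySign]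

theorem block11_supertranspose (M : evenMat 𝒜 p q) :
    block11 (supertranspose M) = (block11 M).transpose := by
  ext i j
  simp [block11, supertranspose, idxParity, paritySign, CharTwo.add_self_eq_zero]

theorem Ber_supertranspose (M : evenMat 𝒜 p q) : Ber (supertranspose M) = Ber M := by
  have h : oddBlockProd (supertranspose M) (block11 (supertranspose M))⁻¹
      = (oddBlockProd M (block11 M)⁻¹).transpose := by
    ext1 i j
    rw [Matrix.transpose_apply, oddBlockProd_apply_eq, oddBlockProd_apply_eq, Finset.sum_comm]
    refine Finset.sum_congr rfl fun k _ => Finset.sum_congr rfl fun l _ => ?_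
    rw [block11_supertranspose, ← Matrix.transpose_nonsing_inv, Matrix.transpose_apply]
    congr 1
    apply Subtype.ext
    have e : ((1 : ZMod 2) = 0) = False := by decide
    change (paritySign _ • M.1 _ _) * (paritySign _ • M.1 _ _) = M.1 _ _ * M.1 _ _
    simp only [idxParity, paritySign, Sum.elim_inl, Sum.elim_inr, zero_mul, if_true, one_smul,
      add_zero, mul_one, e, if_false, neg_smul]
    rw [mul_neg]
    exact neg_eq_iff_eq_neg.2 (odd_mul_odd_comm (block10_odd M l i) (block01_odd M j k))
  rw [Ber, Ber, h, block00_supertranspose, block11_supertranspose, ← Matrix.transpose_sub,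
    Matrix.det_transpose, Matrix.det_transpose]

theorem onePlusZ_supertranspose (M : evenMat 𝒜 p q) :
    onePlusZ (supertranspose M) = supertranspose (onePlusZ M) := by
  apply Subtype.ext
  ext1 i j
  change _ = paritySign _ • (onePlusZ M).1 j i
  rw [onePlusZ_apply, onePlusZ_apply, smul_add]
  congr 1
  · rcases eq_or_ne i j with rfl | h
    · rw [CharTwo.add_self_eq_zero, mul_zero, paritySign_zero, one_smul]
    · rw [Matrix.one_apply_ne h, Matrix.one_apply_ne h.symm, smul_zero]
  · rw [← mul_smul_comm, ← map_zsmul]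
    rfl

/-- The traces of the exterior powers of an operator and of its dual agree, because the
characteristic functions do. -/
theorem trExt_supertranspose (M : evenMat 𝒜 p q) (k : ℤ) : trExt (supertranspose M) k = trExt M k := by
  rcases lt_or_ge k 0 with hk | hk
  · rw [trExt_of_neg _ hk, trExt_of_neg _ hk]
  · have h : charSeries (supertranspose M) = charSeries M := by
      rw [charSeries_eq, charSeries_eq, onePlusZ_supertranspose, Ber_supertranspose]
    rw [charSeries_eq_mk_trExt, charSeries_eq_mk_trExt] at h
    have := congrArg (PowerSeries.coeff k.toNat) h
    rwa [PowerSeries.coeff_mk, PowerSeries.coeff_mk, Int.toNat_of_nonneg hk] at this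

theorem superTrace_evenScale {M : Type*} [AddCommGroup M] [Module R M] (ℳ : ZMod 2 → AddSubgroup M)
    (a : 𝒜 0) (f : M →ₗ[R] M) : superTrace 𝒜 ℳ (evenScale a f) = a * superTrace 𝒜 ℳ f := by
  unfold superTrace
  split_ifs with h
  · rw [Finset.mul_sum]
    refine Finset.sum_congr rfl fun i _ => ?_
    rw [mul_smul_comm]
    congr 1
    apply Subtype.ext
    change (DirectSum.decompose 𝒜 (h.some.basis.repr ((a : R) • f (h.some.basis i)) i) 0 : R) = _
    rw [map_smul, Finsupp.smul_apply, smul_eq_mul]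
    exact DirectSum.coe_decompose_mul_add_of_left_mem (i := 0) (j := 0) 𝒜 a.2
  · rw [mul_zero]

theorem trSigma_eq (A : (evenMat 𝒜 p q)ˣ) (k : ℤ) :
    trSigma A (q + k) = Ber (A : evenMat 𝒜 p q)
      * trExt ((A⁻¹ : (evenMat 𝒜 p q)ˣ) : evenMat 𝒜 p q) (p - q - k) := by
  unfold trSigma
  split_ifs with h
  · rw [sigmaMap, superTrace_evenScale, ← trExt_natCast', trExt_supertranspose,
      Int.toNat_of_nonneg (by omega), ← sub_sub]
  · rw [trExt_of_neg _ (by omega), mul_zero]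

theorem trExt_eq_seriesSeq (A : evenMat 𝒜 p q) : trExt A = seriesSeq (charSeries A) := by
  funext k
  rcases lt_or_ge k 0 with hk | hk
  · rw [trExt_of_neg _ hk, seriesSeq_of_neg _ hk]
  · rw [charSeries_eq_mk_trExt, seriesSeq, if_pos hk, PowerSeries.coeff_mk, Int.toNat_of_nonneg hk]

open LaurentPolynomial in
/-- `Tr Σ^{q+k} A` is the reflection of the sequence of the traces of `Λ A⁻¹`. -/
theorem gammaSeq_eq (A : (evenMat 𝒜 p q)ˣ) :
    gammaSeq A = trExt (A : evenMat 𝒜 p q) - Ber (A : evenMat 𝒜 p q)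
      • seqAct (𝒜 0) (T (p - q : ℤ))
        (seqRev (trExt ((A⁻¹ : (evenMat 𝒜 p q)ˣ) : evenMat 𝒜 p q))) := by
  funext k
  rw [gammaSeq, trSigma_eq, Pi.sub_apply, Pi.smul_apply, smul_eq_mul, seqAct_T, seqRev, neg_sub]

theorem gammaSeq_of_lt (A : (evenMat 𝒜 p q)ˣ) {k : ℤ} (hk : (p : ℤ) - q < k) :
    gammaSeq A k = trExt (A : evenMat 𝒜 p q) k := by
  rw [gammaSeq, trSigma_eq, trExt_of_neg _ (by omega : (p : ℤ) - q - k < 0), mul_zero, sub_zero]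

end Duality

/-! ### The recurrence satisfied by `γ` -/

section Recurrence

open Polynomial LaurentPolynomial

variable {R : Type*} [Ring R] {𝒜 : ZMod 2 → AddSubgroup R} {p q : ℕ} [GradedRing 𝒜]
  [IsSupercommutative 𝒜]

theorem coe_pencilDen (A : evenMat 𝒜 p q) (x y : (𝒜 0)[X]) :
    ((pencilDen Polynomial.C A x y : (𝒜 0)[X]) : PowerSeries (𝒜 0)) 
      = pencilDen PowerSeries.C A (x : PowerSeries (𝒜 0)) (y : PowerSeries (𝒜 0)) := by
  have h := map_pencilDen (f := Polynomial.C) (A := A) (Polynomial.coeToPowerSeries.ringHom) x y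
  have e : (Polynomial.coeToPowerSeries.ringHom).comp (Polynomial.C : 𝒜 0 →+* _) = PowerSeries.C := by
    ext1 a
    exact Polynomial.coe_C a
  rwa [e] at h

theorem coe_pencilNum (A : evenMat 𝒜 p q) (x y : (𝒜 0)[X]) :
    ((pencilNum Polynomial.C A x y : (𝒜 0)[X]) : PowerSeries (𝒜 0)) 
      = pencilNum PowerSeries.C A (x : PowerSeries (𝒜 0)) (y : PowerSeries (𝒜 0)) := by
  have h := map_pencilNum (f := Polynomial.C) (A := A) (Polynomial.coeToPowerSeries.ringHom) x y
  have e : (Polynomial.coeToPowerSeries.ringHom).comp (Polynomial.C : 𝒜 0 →+* _) = PowerSeries.C := by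
    ext1 a
    exact Polynomial.coe_C a
  rwa [e] at h

/-- The characteristic function as a fraction (with degrees that are too large in general). -/
theorem charSeries_mul_pencilDen (A : evenMat 𝒜 p q) :
    charSeries A * pencilDen PowerSeries.C A 1 PowerSeries.X
      = pencilNum PowerSeries.C A 1 PowerSeries.X := by
  have h := evenSeriesEquiv_Ber_mul_pencilDen (A := A) (M := onePlusZ A) (x := 1)
    (y := (evenSeriesEquiv 𝒜).symm PowerSeries.X) (isUnit_det_block11_onePlusZ A) fun i j => by
      rw [onePlusZ_apply, coe_evenSeriesEquiv_symm_X]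
      congr 1
      exact (one_mul _).symm
  rwa [map_one, RingEquiv.apply_symm_apply] at h

theorem evenSeriesEquiv_Ber_constMat (A : (evenMat 𝒜 p q)ˣ) :
    evenSeriesEquiv 𝒜 (Ber (constMat 𝒜 p q A)) = PowerSeries.C (Ber (A : evenMat 𝒜 p q)) := by
  have h := evenSeriesEquiv_Ber_mul_pencilDen (A := (A : evenMat 𝒜 p q)) (x := 0) (y := 1)
    (isUnit_det_block11 (Units.map (constMat 𝒜 p q).toMonoidHom A)) fun i j => by
      refine Eq.trans (b := PowerSeries.C (A.1.1 i j)) rfl ?_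
      have e0 : ((0 : seriesGrading 𝒜 0) : PowerSeries R) = 0 := rfl
      have e1 : ((1 : seriesGrading 𝒜 0) : PowerSeries R) = 1 := rfl
      rw [e0, e1, zero_mul, one_mul, zero_add]
  have h' := congrArg PowerSeries.C
    (Ber_mul_pencilDen (A : evenMat 𝒜 p q) (isUnit_det_block11 A))
  rw [map_mul, map_pencilDen, map_pencilNum, RingHom.comp_id, map_zero, map_one] at h'
  rw [map_zero, map_one] at h
  have hu : IsUnit (pencilDen PowerSeries.C (A : evenMat 𝒜 p q) 0 1) := by
    have h1 := map_pencilDen (f := RingHom.id _) (A := (A : evenMat 𝒜 p q)) PowerSeries.C 0 1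
    rw [RingHom.comp_id, map_zero, map_one] at h1
    rw [← h1]
    refine IsUnit.map _ (IsUnit.pow _ ?_)
    have e : pencil11 (RingHom.id (𝒜 0)) (A : evenMat 𝒜 p q) 0 1 = block11 (A : evenMat 𝒜 p q) := by
      ext i j
      simp [pencil11]
    rw [e]
    exact isUnit_det_block11 A
  exact hu.mul_right_cancel (h.trans h'.symm)

/-- `Ber (1 + z A) = Ber A · Ber (z + A⁻¹)`. -/
theorem charSeries_mul_pencilDen_inv (A : (evenMat 𝒜 p q)ˣ) :
    charSeries (A : evenMat 𝒜 p q)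
        * pencilDen PowerSeries.C ((A⁻¹ : (evenMat 𝒜 p q)ˣ) : evenMat 𝒜 p q) PowerSeries.X 1
      = PowerSeries.C (Ber (A : evenMat 𝒜 p q))
        * pencilNum PowerSeries.C ((A⁻¹ : (evenMat 𝒜 p q)ˣ) : evenMat 𝒜 p q) PowerSeries.X 1 := by
  set cA : (evenMat (seriesGrading 𝒜) p q)ˣ := Units.map (constMat 𝒜 p q).toMonoidHom A with hcA
  set Z : evenMat (seriesGrading 𝒜) p q := onePlusZ (A : evenMat 𝒜 p q) * (cA⁻¹ : _ˣ) with hZ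
  have hu := isUnit_det_block11_onePlusZ (A : evenMat 𝒜 p q)
  have hZu : IsUnit (block11 Z).det :=
    (Ber_mul_aux _ _ hu (isUnit_det_block11 cA⁻¹)).1
  have e : charSeries (A : evenMat 𝒜 p q)
      = evenSeriesEquiv 𝒜 (Ber Z) * PowerSeries.C (Ber (A : evenMat 𝒜 p q)) := by
    rw [← evenSeriesEquiv_Ber_constMat, ← map_mul]
    change _ = evenSeriesEquiv 𝒜 (Ber Z * Ber (cA : evenMat (seriesGrading 𝒜) p q))
    rw [← Ber_mul _ _ hZu (isUnit_det_block11 cA), hZ, Units.inv_mul_cancel_right, charSeries_eq]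
  have h := evenSeriesEquiv_Ber_mul_pencilDen
    (A := ((A⁻¹ : (evenMat 𝒜 p q)ˣ) : evenMat 𝒜 p q))
    (x := (evenSeriesEquiv 𝒜).symm PowerSeries.X) (y := 1) hZu fun i j => by
      have e1 : Z.1 = (cA⁻¹ : _ˣ).1.1 + (PowerSeries.X : PowerSeries R) • 1 := by
        have e2 : (onePlusZ (A : evenMat 𝒜 p q)).1 = 1 + (PowerSeries.X : PowerSeries R) • cA.1.1 :=
          rfl
        have e3 : cA.1.1 * (cA⁻¹ : _ˣ).1.1 = 1 := congrArg Subtype.val cA.mul_inv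
        rw [hZ, Subring.coe_mul, e2, Matrix.add_mul, Matrix.smul_mul, e3, Matrix.one_mul]
      have e4 : ((1 : seriesGrading 𝒜 0) : PowerSeries R) = 1 := rfl
      rw [e1, coe_evenSeriesEquiv_symm_X, e4, one_mul, Matrix.add_apply, add_comm,
        Matrix.smul_apply, smul_eq_mul]
      rfl
  rw [map_one, RingEquiv.apply_symm_apply] at h
  rw [e, ← h]
  ring

/-- The denominator of `Ber (z + A)` is, up to a power of `z`, the denominator of
`Ber (1 + z⁻¹ A)`. -/
theorem toLaurent_pencilDen_X_one (A : evenMat 𝒜 p q) :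
    toLaurent (pencilDen Polynomial.C A X 1)
      = T (q * (p + 1) : ℕ) * invert (toLaurent (pencilDen Polynomial.C A 1 X)) := by
  have e1 : (toLaurent : (𝒜 0)[X] →+* _).comp Polynomial.C = LaurentPolynomial.C := by
    ext1 a
    exact toLaurent_C a
  have e2 : (invert (R := 𝒜 0)).toRingEquiv.toRingHom.comp LaurentPolynomial.C
      = LaurentPolynomial.C := by
    ext1 a
    exact invert_C a
  have h : invert (pencilDen LaurentPolynomial.C A 1 (T 1))
      = pencilDen LaurentPolynomial.C A 1 (T (-1)) := by
    have := map_pencilDen (f := LaurentPolynomial.C) (A := A)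
      (invert (R := 𝒜 0)).toRingEquiv.toRingHom 1 (T 1)
    rw [e2, map_one] at this
    refine this.trans (congrArg _ (invert_T 1))
  rw [map_pencilDen, map_pencilDen, e1, map_one, toLaurent_X, h]
  have := pencilDen_mul (f := LaurentPolynomial.C) (A := A) (T 1) 1 (T (-1))
  rwa [mul_one, ← T_add, add_neg_cancel, T_zero, T_pow, mul_one] at this

theorem toLaurent_pencilNum_X_one (A : evenMat 𝒜 p q) :
    toLaurent (pencilNum Polynomial.C A X 1)
      = T ((q + 1) * p : ℕ) * invert (toLaurent (pencilNum Polynomial.C A 1 X)) := by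
  have e1 : (toLaurent : (𝒜 0)[X] →+* _).comp Polynomial.C = LaurentPolynomial.C := by
    ext1 a
    exact toLaurent_C a
  have e2 : (invert (R := 𝒜 0)).toRingEquiv.toRingHom.comp LaurentPolynomial.C
      = LaurentPolynomial.C := by
    ext1 a
    exact invert_C a
  have h : invert (pencilNum LaurentPolynomial.C A 1 (T 1))
      = pencilNum LaurentPolynomial.C A 1 (T (-1)) := by
    have := map_pencilNum (f := LaurentPolynomial.C) (A := A)
      (invert (R := 𝒜 0)).toRingEquiv.toRingHom 1 (T 1)
    rw [e2, map_one] at this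
    refine this.trans (congrArg _ (invert_T 1))
  rw [map_pencilNum, map_pencilNum, e1, map_one, toLaurent_X, h]
  have := pencilNum_mul (f := LaurentPolynomial.C) (A := A) (T 1) 1 (T (-1))
  rwa [mul_one, ← T_add, add_neg_cancel, T_zero, T_pow, mul_one] at this

theorem seqAct_trExt_of_mul_eq {A : evenMat 𝒜 p q} {f g : (𝒜 0)[X]}
    (h : (f : PowerSeries (𝒜 0)) * charSeries A = g) :
    seqAct (𝒜 0) (toLaurent f) (trExt A) = seqAct (𝒜 0) (toLaurent g) (seriesSeq 1) := by
  rw [trExt_eq_seriesSeq, seqAct_seriesSeq, seqAct_seriesSeq, h, mul_one]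

/-- `Tr Λᵏ A` and `Tr Σ^{q+k} A` are the coefficients of the expansions of the same fraction at zero
and at infinity, so the product of the two denominators kills their difference. -/
theorem seqAct_pencilDen_gammaSeq (A : (evenMat 𝒜 p q)ˣ) :
    seqAct (𝒜 0) (toLaurent (pencilDen Polynomial.C (A : evenMat 𝒜 p q) 1 X
      * pencilDen Polynomial.C ((A⁻¹ : (evenMat 𝒜 p q)ˣ) : evenMat 𝒜 p q) X 1)) (gammaSeq A) = 0 := by
  set B : evenMat 𝒜 p q := ((A⁻¹ : (evenMat 𝒜 p q)ˣ) : evenMat 𝒜 p q) with hB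
  set b := Ber (A : evenMat 𝒜 p q) with hb
  have hF : ∀ A : evenMat 𝒜 p q, ((pencilDen Polynomial.C A 1 X : (𝒜 0)[X]) : PowerSeries (𝒜 0)) * charSeries A
      = (pencilNum Polynomial.C A 1 X : (𝒜 0)[X]) := fun A => by
    rw [coe_pencilDen, coe_pencilNum, Polynomial.coe_one, Polynomial.coe_X, mul_comm,
      charSeries_mul_pencilDen]
  have hP : pencilNum Polynomial.C (A : evenMat 𝒜 p q) 1 X * pencilDen Polynomial.C B X 1
      = Polynomial.C b * pencilNum Polynomial.C B X 1
        * pencilDen Polynomial.C (A : evenMat 𝒜 p q) 1 X := by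
    apply Polynomial.coe_injective
    rw [Polynomial.coe_mul, ← hF, Polynomial.coe_mul, Polynomial.coe_mul, mul_assoc,
      coe_pencilDen B, coe_pencilNum B, Polynomial.coe_one, Polynomial.coe_X,
      charSeries_mul_pencilDen_inv, Polynomial.coe_C]
    ring
  have hrev : seqRev (seriesSeq (1 : PowerSeries (𝒜 0))) = seriesSeq 1 := by
    funext k
    rw [seqRev]
    rcases lt_trichotomy k 0 with hk | rfl | hk
    · obtain ⟨n, hn⟩ : ∃ n : ℕ, -k = n := ⟨(-k).toNat, by omega⟩
      rw [seriesSeq_of_neg _ hk, hn, seriesSeq_natCast, PowerSeries.coeff_one, if_neg (by omega)]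
    · rfl
    · obtain ⟨n, hn⟩ : ∃ n : ℕ, k = n := ⟨k.toNat, by omega⟩
      rw [seriesSeq_of_neg _ (by omega : -k < 0), hn, seriesSeq_natCast, PowerSeries.coeff_one,
        if_neg (by omega)]
  have hinf : seqAct (𝒜 0) (toLaurent (pencilDen Polynomial.C B X 1))
      (seqAct (𝒜 0) (T (p - q : ℤ)) (seqRev (trExt B)))
      = seqAct (𝒜 0) (toLaurent (pencilNum Polynomial.C B X 1)) (seriesSeq 1) := by
    rw [seqAct_comm, toLaurent_pencilDen_X_one, toLaurent_pencilNum_X_one, seqAct_mul,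
      ← seqRev_seqAct, seqAct_trExt_of_mul_eq (hF B), seqRev_seqAct, hrev, ← seqAct_mul, ← T_add,
      ← seqAct_mul]
    congr 4
    push_cast
    ring
  have h0 := seqAct_trExt_of_mul_eq (hF A)
  generalize pencilNum Polynomial.C (A : evenMat 𝒜 p q) 1 X = P at hP h0
  generalize pencilDen Polynomial.C (A : evenMat 𝒜 p q) 1 X = Q at hP h0 ⊢
  generalize pencilNum Polynomial.C B X 1 = P' at hP hinf
  generalize pencilDen Polynomial.C B X 1 = Q' at hP hinf ⊢
  have hl : seqAct (𝒜 0) (toLaurent (Q * Q')) (trExt (A : evenMat 𝒜 p q))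
      = seqAct (𝒜 0) (toLaurent (P * Q')) (seriesSeq 1) := by
    rw [mul_comm Q, map_mul, seqAct_mul, h0, ← seqAct_mul, ← map_mul, mul_comm]
  have hr : seqAct (𝒜 0) (toLaurent (Q * Q')) (seqAct (𝒜 0) (T (p - q : ℤ)) (seqRev (trExt B)))
      = seqAct (𝒜 0) (toLaurent (Q * P')) (seriesSeq 1) := by
    rw [map_mul, seqAct_mul, hinf, ← seqAct_mul, ← map_mul]
  rw [gammaSeq_eq, map_sub, map_smul, sub_eq_zero, hl, hr, hP, mul_assoc, map_mul, toLaurent_C,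
    seqAct_mul, seqAct_C, mul_comm P']

theorem pencil11_C_one_X (A : evenMat 𝒜 p q) : pencil11 Polynomial.C A 1 X
    = (X : (𝒜 0)[X]) • (block11 A).map Polynomial.C + (1 : Matrix _ _ (𝒜 0)).map Polynomial.C := by
  rw [pencil11, add_comm, one_smul, Matrix.map_one _ (map_zero _) (map_one _)]

theorem pencil11_C_X_one (A : evenMat 𝒜 p q) : pencil11 Polynomial.C A X 1
    = (X : (𝒜 0)[X]) • (1 : Matrix _ _ (𝒜 0)).map Polynomial.C + (block11 A).map Polynomial.C := by
  rw [pencil11, one_smul, Matrix.map_one _ (map_zero _) (map_one _)]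

/-- The recurrence of `seqAct_pencilDen_gammaSeq` has a unit as its trailing coefficient. -/
theorem exists_seqAct_gammaSeq_eq_zero (A : (evenMat 𝒜 p q)ˣ) :
    ∃ (f : (𝒜 0)[X]) (n : ℕ), f.natDegree ≤ n ∧ IsUnit (f.coeff n) ∧
      seqAct (𝒜 0) (toLaurent f) (gammaSeq A) = 0 := by
  set B : evenMat 𝒜 p q := ((A⁻¹ : (evenMat 𝒜 p q)ˣ) : evenMat 𝒜 p q) with hB
  have h1 : (pencil11 Polynomial.C (A : evenMat 𝒜 p q) 1 X).det.natDegree ≤ q := by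
    rw [pencil11_C_one_X]
    simpa using natDegree_det_X_add_C_le (block11 (A : evenMat 𝒜 p q)) 1
  have h2 : (pencil11 Polynomial.C B X 1).det.natDegree ≤ q := by
    rw [pencil11_C_X_one]
    simpa using natDegree_det_X_add_C_le 1 (block11 B)
  have c1 : (pencil11 Polynomial.C (A : evenMat 𝒜 p q) 1 X).det.coeff q
      = (block11 (A : evenMat 𝒜 p q)).det := by
    rw [pencil11_C_one_X]
    simpa using coeff_det_X_add_C_card (block11 (A : evenMat 𝒜 p q)) 1
  have c2 : (pencil11 Polynomial.C B X 1).det.coeff q = 1 := by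
    rw [pencil11_C_X_one]
    simpa using coeff_det_X_add_C_card 1 (block11 B)
  have d1 := natDegree_pow_le_of_le (p + 1) h1
  have d2 := natDegree_pow_le_of_le (p + 1) h2
  refine ⟨_, (p + 1) * q + (p + 1) * q, natDegree_mul_le_of_le d1 d2, ?_,
    seqAct_pencilDen_gammaSeq A⟩
  rw [coeff_mul_add_eq_of_natDegree_le d1 d2, coeff_pow_of_natDegree_le h1,
    coeff_pow_of_natDegree_le h2, c1, c2, one_pow, mul_one]
  exact (isUnit_det_block11 A).pow _

end Recurrence

/-! ### Hankel determinants -/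

section Hankel

variable {R : Type*} [Ring R] {𝒜 : ZMod 2 → AddSubgroup R} {p q : ℕ} [GradedRing 𝒜]
  [IsSupercommutative 𝒜]

theorem HasTop.prod {S : Type*} [CommRing S] {κ : Type*} (s : Finset κ) {d : κ → ℕ}
    {x : κ → PowerSeries S} {y : κ → S} (h : ∀ k ∈ s, HasTop (d k) (x k) (y k)) :
    HasTop (∑ k ∈ s, d k) (∏ k ∈ s, x k) (∏ k ∈ s, y k) := by
  classical
  induction s using Finset.induction_on with
  | empty => exact HasTop.one
  | insert a s ha ih =>
    rw [Finset.sum_insert ha, Finset.prod_insert ha, Finset.prod_insert ha]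
    exact (h a (Finset.mem_insert_self a s)).mul
      (ih fun k hk => h k (Finset.mem_insert_of_mem hk))

theorem HasTop.det {S : Type*} [CommRing S] {n : ℕ} {a b : Fin n → ℕ}
    {M : Matrix (Fin n) (Fin n) (PowerSeries S)} {M' : Matrix (Fin n) (Fin n) S}
    (h : ∀ i j, HasTop (a i + b j) (M i j) (M' i j)) :
    HasTop (∑ i, a i + ∑ i, b i) M.det M'.det := by
  rw [Matrix.det_apply, Matrix.det_apply]
  refine HasTop.sum _ fun σ _ => ?_
  rw [Units.smul_def, Units.smul_def, ← Equiv.sum_comp σ a, ← Finset.sum_add_distrib]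
  exact HasTop.zsmul (HasTop.prod _ fun i _ => h _ _) _

theorem HasTop.evenSeriesEquiv {d : ℕ} {x : seriesGrading 𝒜 0} {y : 𝒜 0}
    (h : HasTop d (x : PowerSeries R) (y : R)) : HasTop d (evenSeriesEquiv 𝒜 x) y :=
  ⟨fun n hn => Subtype.ext ((coeff_evenSeriesEquiv x n).trans (h.1 n hn)),
    Subtype.ext ((coeff_evenSeriesEquiv x d).trans h.2)⟩

open Polynomial in
theorem det_trExt_eq_zero_of_isUpper {T : evenMat 𝒜 p q} (hT : IsUpper T.1)
    {k : Fin (q + 1) → ℤ} (hk : ∀ i, (p : ℤ) < k i) :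
    (Matrix.of fun i j : Fin (q + 1) => trExt T (k i + (j : ℕ))).det = 0 := by
  have hd : ∀ (n : ℕ) (d : Fin n → 𝒜 0), (∏ j, (1 + X * C (d j))).natDegree ≤ n := by
    intro n d
    refine (natDegree_prod_le _ _).trans ((Finset.sum_le_card_nsmul _ _ 1 fun j _ => ?_).trans ?_)
    · compute_degree
    · simp
  set f : (𝒜 0)[X] := ∏ j : Fin q, (1 + X * C (diagEntry T (Sum.inr j))) with hf
  set g : (𝒜 0)[X] := ∏ j : Fin p, (1 + X * C (diagEntry T (Sum.inl j))) with hg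
  have h : (f : PowerSeries (𝒜 0)) * charSeries T = g := by
    have e : ∀ (n : ℕ) (d : Fin n → 𝒜 0), ((∏ j, (1 + X * C (d j)) : (𝒜 0)[X]) : PowerSeries (𝒜 0))
        = ∏ j, (1 + PowerSeries.X * PowerSeries.C (d j)) := by
      intro n d
      rw [← coeToPowerSeries.ringHom_apply, map_prod]
      exact Finset.prod_congr rfl fun j _ => by simp [PowerSeries.X_mul]
    rw [hf, hg, e, e, mul_comm, charSeries_eq_mk_trExt, mk_trExt_mul_of_isUpper hT]
  refine det_rows_eq_zero_of_recurrence (f := f) (hd q _) (by simp [hf, coeff_zero_prod]) (N := p)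
    (fun k hk => ?_) hk
  rw [trExt_eq_seriesSeq, seqAct_seriesSeq, h]
  obtain ⟨n, rfl⟩ : ∃ n : ℕ, k = n := ⟨k.toNat, by omega⟩
  rw [seriesSeq_natCast, Polynomial.coeff_coe]
  exact coeff_eq_zero_of_natDegree_lt ((hd p _).trans_lt (by omega))

/-- The Hankel-type determinants of order `q + 1` with rows to the right of `p` vanish: they do for
a deformation of `A` that is conjugate to a triangular matrix, and those for `A` are the top
coefficients. -/
theorem det_trExt_eq_zero (A : evenMat 𝒜 p q) {k : Fin (q + 1) → ℤ} (hk : ∀ i, (p : ℤ) < k i) :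
    (Matrix.of fun i j : Fin (q + 1) => trExt A (k i + (j : ℕ))).det = 0 := by
  obtain ⟨U, T, hT, hU⟩ := exists_triangular_deformation A
  have h0 := det_trExt_eq_zero_of_isUpper hT hk
  simp only [← trExt_conj U hU] at h0
  have h1 := congrArg (evenSeriesEquiv 𝒜).toRingHom h0
  rw [RingHom.map_det, map_zero] at h1
  obtain ⟨n, hn⟩ : ∃ n : Fin (q + 1) → ℕ, ∀ i, k i = n i :=
    ⟨fun i => (k i).toNat, fun i => (Int.toNat_of_nonneg (by have := hk i; omega)).symm⟩
  have h2 := HasTop.det (a := fun i => (p + q + 1) * n i)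
    (b := fun j : Fin (q + 1) => (p + q + 1) * (j : ℕ))
    (M := (evenSeriesEquiv 𝒜).toRingHom.mapMatrix
      (Matrix.of fun i j : Fin (q + 1) => trExt (deformation A) (k i + (j : ℕ))))
    (M' := Matrix.of fun i j : Fin (q + 1) => trExt A (k i + (j : ℕ))) fun i j => by
      rw [← mul_add, Matrix.of_apply, hn]
      refine HasTop.evenSeriesEquiv ?_
      rw [Matrix.of_apply, hn]
      exact_mod_cast HasTop.trExt (hasTop_deformation A) (n i + j)
  rw [h1] at h2
  exact h2.unique (HasTop.zero _)

theorem det_gammaSeq_eq_zero (A : (evenMat 𝒜 p q)ˣ) (k : Fin (q + 1) → ℤ) :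
    (Matrix.of fun i j : Fin (q + 1) => gammaSeq A (k i + (j : ℕ))).det = 0 := by
  obtain ⟨f, n, hn, hu, hf⟩ := exists_seqAct_gammaSeq_eq_zero A
  refine det_rows_eq_zero_of_eventually hn hu hf (N := p + 1) (fun k hk => ?_) k
  rw [← det_trExt_eq_zero (A : evenMat 𝒜 p q) (k := k) fun i => by have := hk i; omega]
  refine congrArg Matrix.det (Matrix.ext fun i j => ?_)
  exact gammaSeq_of_lt A (by have := hk i; omega)

theorem hankelDet_gammaSeq_eq_zero (A : (evenMat 𝒜 p q)ˣ) (k : ℤ) :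
    hankelDet (gammaSeq A) k (q + 1) = 0 :=
  det_gammaSeq_eq_zero A fun i => k + (i : ℕ)

end Hankel

/-! ### Fractions that represent the characteristic function -/

section Fractions

open Polynomial LaurentPolynomial

variable {R : Type*} [Ring R] {𝒜 : ZMod 2 → AddSubgroup R} {p q : ℕ} [GradedRing 𝒜]
  [IsSupercommutative 𝒜]

/-- The denominator of the characteristic function gives a recurrence for `γ`: the sequence
`Q · γ` vanishes far to the right, and it is killed by a polynomial with invertible trailing
coefficient. -/
theorem seqAct_gammaSeq_of_isFractionOf (A : (evenMat 𝒜 p q)ˣ) {P Q : (𝒜 0)[X]}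
    (h : IsFractionOf p q P Q (charSeries (A : evenMat 𝒜 p q))) :
    seqAct (𝒜 0) (toLaurent Q) (gammaSeq A) = 0 := by
  obtain ⟨hP, hQ, -, hF⟩ := h
  obtain ⟨f, n, hn, hu, hf⟩ := exists_seqAct_gammaSeq_eq_zero A
  refine eq_zero_of_seqAct_eq_zero hn hu (N := p + 1) ?_ fun k hk => ?_
  · rw [seqAct_comm, hf, map_zero]
  · have h1 : seqAct (𝒜 0) (toLaurent Q) (gammaSeq A) k
        = seqAct (𝒜 0) (toLaurent Q) (trExt (A : evenMat 𝒜 p q)) k := by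
      rw [seqAct_toLaurent Q hQ, seqAct_toLaurent Q hQ]
      refine Finset.sum_congr rfl fun i hi => ?_
      rw [gammaSeq_of_lt A (by have := Finset.mem_range.1 hi; omega)]
    rw [h1, trExt_eq_seriesSeq, seqAct_seriesSeq, hF]
    obtain ⟨m, rfl⟩ : ∃ m : ℕ, k = m := ⟨k.toNat, by omega⟩
    rw [seriesSeq_natCast, Polynomial.coeff_coe]
    exact coeff_eq_zero_of_natDegree_lt (hP.trans_lt (by omega))

/-- In general position the vanishing of the determinants of order `q + 1` yields a recurrence of
order `q`: its coefficients are found from the rows `p - q + 1, …, p`. -/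
theorem exists_recurrence_of_isUnit_hankelDet (A : (evenMat 𝒜 p q)ˣ)
    (h : IsUnit (hankelDet (trExt (A : evenMat 𝒜 p q)) ((p : ℤ) - q + 1) q)) :
    ∃ v : Fin (q + 1) → 𝒜 0, v (Fin.last q) = 1 ∧
      ∀ k : ℤ, ∑ j : Fin (q + 1), gammaSeq A (k + (j : ℕ)) * v j = 0 := by
  set s : ℤ → 𝒜 0 := gammaSeq A with hs
  set k₀ : ℤ := (p : ℤ) - q + 1 with hk₀
  let H : Matrix (Fin q) (Fin q) (𝒜 0) := Matrix.of fun i j => s (k₀ + (i : ℕ) + (j : ℕ))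
  have hH : IsUnit H.det := by
    have e : H.det = hankelDet (trExt (A : evenMat 𝒜 p q)) k₀ q :=
      congrArg Matrix.det (Matrix.ext fun i j => gammaSeq_of_lt A (by omega))
    rwa [e]
  let w : Fin q → 𝒜 0 := H⁻¹.mulVec fun i : Fin q => -s (k₀ + (i : ℕ) + q)
  have hw : H.mulVec w = fun i : Fin q => -s (k₀ + (i : ℕ) + q) := by
    rw [Matrix.mulVec_mulVec, Matrix.mul_nonsing_inv _ hH, Matrix.one_mulVec]
  refine ⟨Fin.snoc w 1, Fin.snoc_last _ _, fun k => ?_⟩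
  -- the determinant with the rows `k₀, …, k₀ + q - 1` and `k`
  let r : Fin (q + 1) → ℤ := Fin.snoc (fun i : Fin q => k₀ + (i : ℕ)) k
  let M : Matrix (Fin (q + 1)) (Fin (q + 1)) (𝒜 0) := Matrix.of fun i j => s (r i + (j : ℕ))
  have hM : M.det = 0 := det_gammaSeq_eq_zero A r
  have hv : M.mulVec (Fin.snoc w 1)
      = Pi.single (Fin.last q) (∑ j : Fin (q + 1), s (k + (j : ℕ)) * (Fin.snoc w 1 : Fin (q + 1) → 𝒜 0) j) := by
    funext i
    refine Fin.lastCases ?_ (fun i => ?_) i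
    · rw [Pi.single_eq_same]
      change ∑ j : Fin (q + 1), s (r (Fin.last q) + (j : ℕ)) * _ = _
      simp only [r, Fin.snoc_last]
    · rw [Pi.single_eq_of_ne (Fin.castSucc_lt_last i).ne]
      change ∑ j : Fin (q + 1), s (r i.castSucc + (j : ℕ)) * _ = _
      rw [Fin.sum_univ_castSucc]
      simp only [r, Fin.snoc_castSucc, Fin.snoc_last, Fin.val_castSucc, Fin.val_last, mul_one]
      rw [← eq_neg_iff_add_eq_zero]
      exact congrFun hw i
  have h1 : M.adjugate.mulVec (M.mulVec (Fin.snoc w 1)) = 0 := by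
    rw [Matrix.mulVec_mulVec, Matrix.adjugate_mul, hM, zero_smul, Matrix.zero_mulVec]
  have h2 := congrFun h1 (Fin.last q)
  have hs : M.submatrix (Fin.last q).succAbove (Fin.last q).succAbove = H := by
    ext1 i j
    simp [M, H, r]
  rw [hv, Matrix.mulVec_single, Pi.smul_apply, Matrix.col_apply,
    Matrix.adjugate_fin_succ_eq_det_submatrix, hs, ← two_mul, pow_mul, neg_one_sq, one_pow,
    one_mul] at h2
  exact hH.mul_right_eq_zero.1 h2

theorem exists_isFractionOf_of_isUnit_hankelDet (A : (evenMat 𝒜 p q)ˣ)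
    (h : IsUnit (hankelDet (trExt (A : evenMat 𝒜 p q)) ((p : ℤ) - q + 1) q)) :
    ∃ P Q : (𝒜 0)[X], IsFractionOf p q P Q (charSeries (A : evenMat 𝒜 p q)) := by
  obtain ⟨v, hv, h⟩ := exists_recurrence_of_isUnit_hankelDet A h
  let Q : (𝒜 0)[X] := ∑ j : Fin (q + 1), Polynomial.C (v j) * X ^ (q - j)
  have hQ : Q.natDegree ≤ q :=
    natDegree_sum_le_of_forall_le _ _ fun j _ => (natDegree_C_mul_X_pow_le _ _).trans (by omega)
  refine ⟨PowerSeries.trunc (p + 1) (Q * charSeries (A : evenMat 𝒜 p q)), Q, ?_, hQ, ?_, ?_⟩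
  · exact Nat.lt_succ_iff.1 (PowerSeries.natDegree_trunc_lt _ p)
  · rw [finsetSum_coeff, Finset.sum_eq_single (Fin.last q)]
    · simpa using hv
    · intro j _ hj
      have : (j : ℕ) < q := Fin.val_lt_last hj
      rw [coeff_C_mul_X_pow, if_neg (by omega)]
    · intro hq
      exact absurd (Finset.mem_univ _) hq
  · ext1 n
    rw [Polynomial.coeff_coe, PowerSeries.coeff_trunc]
    split_ifs with hn
    · rfl
    have h1 : seqAct (𝒜 0) (toLaurent Q) (trExt (A : evenMat 𝒜 p q)) n
        = ∑ j : Fin (q + 1), gammaSeq A (n - q + (j : ℕ)) * v j := by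
      rw [map_sum, map_sum, LinearMap.sum_apply, Finset.sum_apply]
      refine Finset.sum_congr rfl fun j _ => ?_
      rw [toLaurent_C_mul_X_pow, seqAct_mul, seqAct_C, Pi.smul_apply, smul_eq_mul, seqAct_T,
        gammaSeq_of_lt A (by omega), mul_comm]
      congr 2
      have : (j : ℕ) ≤ q := by omega
      omega
    rw [h, trExt_eq_seriesSeq, seqAct_seriesSeq, seriesSeq_natCast] at h1
    exact h1

theorem exists_isFractionOf_of_isBlockDiagonalizable {A : evenMat 𝒜 p q}
    (h : IsBlockDiagonalizable A) : ∃ P Q : (𝒜 0)[X], IsFractionOf p q P Q (charSeries A) := by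
  obtain ⟨U, B, hU, -, h0⟩ := h
  have h1 := charSeries_mul_det B h0
  rw [← charSeries_conj U hU] at h1
  have e : ∀ {n : ℕ} (N : Matrix (Fin n) (Fin n) (𝒜 0)),
      (((X : (𝒜 0)[X]) • N.map Polynomial.C + (1 : Matrix (Fin n) (Fin n) (𝒜 0)).map Polynomial.C).det
        : PowerSeries (𝒜 0)) = (1 + (PowerSeries.X : PowerSeries (𝒜 0)) • N.map PowerSeries.C).det := by
    intro n N
    refine (RingHom.map_det (Polynomial.coeToPowerSeries.ringHom (R := 𝒜 0)) _).trans (congrArg Matrix.det ?_)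
    ext1 i j
    rw [add_comm]
    simp [Matrix.one_apply, apply_ite, PowerSeries.X_mul]
  refine ⟨((X : (𝒜 0)[X]) • (block00 B).map Polynomial.C + (1 : Matrix _ _ (𝒜 0)).map Polynomial.C).det,
    ((X : (𝒜 0)[X]) • (block11 B).map Polynomial.C + (1 : Matrix _ _ (𝒜 0)).map Polynomial.C).det,
    ?_, ?_, ?_, ?_⟩
  · simpa using natDegree_det_X_add_C_le (block00 B) 1
  · simpa using natDegree_det_X_add_C_le (block11 B) 1
  · simpa using coeff_det_X_add_C_zero (block11 B) 1
  · rw [← e, ← e] at h1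
    exact (mul_comm _ _).trans h1

end Fractions

theorem mainTheorem1 {R : Type*} [Ring R] (𝒜 : ZMod 2 → AddSubgroup R) [GradedRing 𝒜]
    [IsSupercommutative 𝒜] (p q : ℕ) (A : (evenMat 𝒜 p q)ˣ) :
    (∀ P Q : Polynomial (𝒜 0), IsFractionOf p q P Q (charSeries (A : evenMat 𝒜 p q)) →
      ∀ k : ℤ, ∑ i ∈ Finset.range (q + 1), Q.coeff i * gammaSeq A (k + q - i) = 0) ∧
    ((IsUnit (hankelDet (trExt (A : evenMat 𝒜 p q)) ((p : ℤ) - q + 1) q) ∨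
        IsBlockDiagonalizable (A : evenMat 𝒜 p q)) →
      ∃ P Q : Polynomial (𝒜 0), IsFractionOf p q P Q (charSeries (A : evenMat 𝒜 p q))) ∧
    ∀ k : ℤ, hankelDet (gammaSeq A) k (q + 1) = 0 := by
  refine ⟨fun P Q h k => ?_, ?_, hankelDet_gammaSeq_eq_zero A⟩
  · rw [← seqAct_toLaurent Q h.2.1, seqAct_gammaSeq_of_isFractionOf A h]
    rfl
  · rintro (h | h)
    · exact exists_isFractionOf_of_isUnit_hankelDet A h
    · exact exists_isFractionOf_of_isBlockDiagonalizable h
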